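/- Let $2\le k\le n$ be integers. For $u\in C_c^2(\mathbb{R}^n)$ let $F_k[u]$ be the sum of the $k\times k$ principal minors of the Hessian matrix $D^2u$; $F_k[u]$ is identified with the distribution $\varphi\mapsto\int_{\mathbb{R}^n}F_k[u]\,\varphi\,dx$. For $1<s<2$ and $1\le p<\infty$ let $B(s,p)$ be the space of all $u\in W^{1,p}(\mathbb{R}^n)$ with finite norm $$\|u\|_{s,p}=\|u\|_{W^{1,p}}+\left(\int_{\mathbb{R}^n}\int_{\mathbb{R}^n}\frac{|Du(x)-Du(y)|^p}{|x-y|^{n+(s-1)p}}\,dx\,dy\right)^{1/p},\qquad \|u\|_{W^{1,p}}=\|u\|_{L^p}+\|Du\|_{L^p},$$ and let $B(1,p)=W^{1,p}(\mathbb{R}^n)$ with norm $\|u\|_{1,p}=\|u\|_{W^{1,p}}$ (this covers $k=2$, where $2-\frac2k=1$). Write $\|\cdot\|$ for the norm of $B(2-\frac2k,k)$. Then $C_c^2(\mathbb{R}^n)\subset B(2-\frac2k,k)$, and the $k$-Hessian operator $u\mapsto F_k[u]$, $C_c^2(\mathbb{R}^n)\to\mathcal{D}'(\mathbb{R}^n)$,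 extends uniquely to a continuous map $u\mapsto\mathcal{F}_k[u]$, $B(2-\frac2k,k)\to\mathcal{D}'(\mathbb{R}^n)$. Here the extension is continuous for the topology on $\mathcal{D}'(\mathbb{R}^n)$ of uniform convergence on compact sets of test functions, and it is unique even among the maps that are continuous for the weak topology of $\mathcal{D}'(\mathbb{R}^n)$. Moreover, each $\mathcal{F}_k[u]$ extends to a continuous linear functional on $C_c^2(\mathbb{R}^n)$ (a distribution of order at most $2$), still written $\langle\mathcal{F}_k[u],\cdot\rangle$ and equal to $\varphi\mapsto\int_{\mathbb{R}^n} F_k[u]\,\varphi\,dx$ when $u\in C_c^2(\mathbb{R}^n)$, and there is a constant $C$, depending only on $n$ and $k$, such that for all $u_1,u_2\in B(2-\frac2k,k)$ and all $\varphi\in C_c^2(\mathbb{R}^n)$ $$\left|\langle\mathcal{F}_k[u_1]-\mathcal{F}_k[u_2],\varphi\rangle\right|\le C\,\|u_1-u_2\|\left(\|u_1\|^{k-1}+\|u_2\|^{k-1}\right)\|D^2\varphi\|_{L^\infty}.$$ In particular, for all $u_1,u_2,\varphi\in C_c^2(\mathbb{R}^n)$, $$\left|\int_{\mathbb{R}^n}\left(F_k[u_1]-F_k[u_2]\right)\varphi\,dx\right|\le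 C\,\|u_1-u_2\|\left(\|u_1\|^{k-1}+\|u_2\|^{k-1}\right)\|D^2\varphi\|_{L^\infty}.$$ -/

import Mathlib

open MeasureTheory TopologicalSpace
open scoped NNReal ENNReal Distributions

/-- The Hessian matrix `D²u(x) = (∂ᵢ∂ⱼu(x))`. -/
noncomputable def hessianMatrix {n : ℕ} (u : EuclideanSpace ℝ (Fin n) → ℝ)
    (x : EuclideanSpace ℝ (Fin n)) : Matrix (Fin n) (Fin n) ℝ :=
  Matrix.of fun i j =>
    iteratedFDeriv ℝ 2 u x ![EuclideanSpace.single i 1, EuclideanSpace.single j 1]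

/-- `[A]_k`, the sum of the `k × k` principal minors of `A`. -/
noncomputable def kTrace {n : ℕ} (k : ℕ) (A : Matrix (Fin n) (Fin n) ℝ) : ℝ :=
  ∑ α ∈ Finset.powersetCard k (Finset.univ : Finset (Fin n)),
    (A.submatrix (fun i : α => (i : Fin n)) (fun i : α => (i : Fin n))).det

/-- The `k`-Hessian `F_k[u](x) = [D²u(x)]_k`. -/
noncomputable def kHessian {n : ℕ} (k : ℕ) (u : EuclideanSpace ℝ (Fin n) → ℝ)
    (x : EuclideanSpace ℝ (Fin n)) : ℝ :=
  kTrace k (hessianMatrix u x)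

/-- `C_c^m(ℝⁿ)` with its usual inductive limit topology; `m = ⊤` gives `C_c^∞(ℝⁿ)`. -/
abbrev CcSpace (n : ℕ) (m : ℕ∞) : Type :=
  𝓓^{m}((⊤ : Opens (EuclideanSpace ℝ (Fin n))), ℝ)

/-- Distributions of order at most `m` on `ℝⁿ`, i.e. continuous linear functionals on `C_c^m(ℝⁿ)`;
`m = ⊤` gives `𝓓'(ℝⁿ)`. -/
abbrev DistSpace (n : ℕ) (m : ℕ∞) : Type :=
  𝓓'^{m}((⊤ : Opens (EuclideanSpace ℝ (Fin n))), ℝ)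

/-- `‖D²φ‖_{L^∞}`, with the operator norm of `D²φ(x)` as a bilinear form. -/
noncomputable def hessianSupNorm {n : ℕ} (φ : EuclideanSpace ℝ (Fin n) → ℝ) : ℝ :=
  (eLpNorm (iteratedFDeriv ℝ 2 φ) ∞ volume).toReal

/-- `g` is the weak (distributional) gradient of `u` on `ℝⁿ`. -/
def HasWeakGradient {n : ℕ} (u : EuclideanSpace ℝ (Fin n) → ℝ)
    (g : EuclideanSpace ℝ (Fin n) → EuclideanSpace ℝ (Fin n)) : Prop :=
  ∀ (φ : CcSpace n ⊤) (i : Fin n),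
    ∫ x, u x * fderiv ℝ φ x (EuclideanSpace.single i 1) = -∫ x, g x i * φ x

/-- The fractional part of the norm of `B(s,p)`, in terms of the gradient `g = Du`:
`(∫∫ |g(x) - g(y)|^p / |x - y|^{n + (s-1)p} dx dy)^{1/p}` when `1 < s < 2`. In the integer case
`s = 1`, where the space is the Sobolev space `W^{1,p}`, there is no such term. -/
noncomputable def besovSeminorm {n : ℕ} (s : ℝ) (p : ℝ≥0)
    (g : EuclideanSpace ℝ (Fin n) → EuclideanSpace ℝ (Fin n)) : ℝ≥0∞ :=
  if s = 1 then 0 else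
    (∫⁻ x, ∫⁻ y, ‖g x - g y‖ₑ ^ (p : ℝ) / ‖x - y‖ₑ ^ ((n : ℝ) + (s - 1) * p)) ^ (1 / (p : ℝ))

section Aux

variable {n : ℕ} {s : ℝ} {p : ℝ≥0}

instance factOneLeCoe [h : Fact (1 ≤ p)] : Fact (1 ≤ (p : ℝ≥0∞)) :=
  ⟨by exact_mod_cast h.out⟩

theorem besovSeminorm_congr {g h : EuclideanSpace ℝ (Fin n) → EuclideanSpace ℝ (Fin n)}
    (hgh : g =ᵐ[volume] h) : besovSeminorm s p g = besovSeminorm s p h := by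
  unfold besovSeminorm
  split_ifs
  · rfl
  · congr 1
    refine lintegral_congr_ae ?_
    filter_upwards [hgh] with x hx
    refine lintegral_congr_ae ?_
    filter_upwards [hgh] with y hy
    rw [hx, hy]

theorem besovSeminorm_zero [hp : Fact (1 ≤ p)] :
    besovSeminorm s p (0 : EuclideanSpace ℝ (Fin n) → EuclideanSpace ℝ (Fin n)) = 0 := by
  have hp0 : 0 < (p : ℝ) := lt_of_lt_of_le zero_lt_one (by exact_mod_cast hp.out)
  unfold besovSeminorm
  split_ifs
  · rfl
  · simp [hp0]

theorem besovSeminorm_smul [hp : Fact (1 ≤ p)] (c : ℝ)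
    (g : EuclideanSpace ℝ (Fin n) → EuclideanSpace ℝ (Fin n)) :
    besovSeminorm s p (c • g) = ‖c‖ₑ * besovSeminorm s p g := by
  have hp0 : 0 < (p : ℝ) := lt_of_lt_of_le zero_lt_one (by exact_mod_cast hp.out)
  unfold besovSeminorm
  split_ifs
  · simp
  · have hc : ‖c‖ₑ ^ (p : ℝ) ≠ ∞ := ENNReal.rpow_ne_top_of_nonneg hp0.le (by simp)
    have h1 : ∀ x y : EuclideanSpace ℝ (Fin n),
        ‖(c • g) x - (c • g) y‖ₑ ^ (p : ℝ) / ‖x - y‖ₑ ^ ((n : ℝ) + (s - 1) * p)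
        = ‖c‖ₑ ^ (p : ℝ) *
          (‖g x - g y‖ₑ ^ (p : ℝ) / ‖x - y‖ₑ ^ ((n : ℝ) + (s - 1) * p)) := by
      intro x y
      rw [Pi.smul_apply, Pi.smul_apply, ← smul_sub, enorm_smul,
        ENNReal.mul_rpow_of_nonneg _ _ hp0.le, mul_div_assoc]
    simp_rw [h1, lintegral_const_mul' _ _ hc]
    rw [ENNReal.mul_rpow_of_nonneg _ _ (by positivity), ← ENNReal.rpow_mul,
      mul_one_div_cancel hp0.ne', ENNReal.rpow_one]

theorem besovSeminorm_add_le [hp : Fact (1 ≤ p)]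
    {g h : EuclideanSpace ℝ (Fin n) → EuclideanSpace ℝ (Fin n)}
    (hg : StronglyMeasurable g) (hh : StronglyMeasurable h) :
    besovSeminorm s p (g + h) ≤ besovSeminorm s p g + besovSeminorm s p h := by
  have hp1 : 1 ≤ (p : ℝ) := by exact_mod_cast hp.out
  have hp0 : 0 < (p : ℝ) := lt_of_lt_of_le zero_lt_one hp1
  unfold besovSeminorm
  split_ifs
  · simp
  · set e : ℝ := (n : ℝ) + (s - 1) * p with he
    let w : EuclideanSpace ℝ (Fin n) × EuclideanSpace ℝ (Fin n) → ℝ≥0∞ :=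
      fun z => ((‖z.1 - z.2‖ₑ ^ e)⁻¹) ^ (1 / (p : ℝ))
    let A : (EuclideanSpace ℝ (Fin n) → EuclideanSpace ℝ (Fin n)) →
        EuclideanSpace ℝ (Fin n) × EuclideanSpace ℝ (Fin n) → ℝ≥0∞ :=
      fun g z => ‖g z.1 - g z.2‖ₑ * w z
    have hw : Measurable w := by fun_prop
    have hA : ∀ g, StronglyMeasurable g → Measurable (A g) := by
      intro g hg
      have hg' := hg.measurable
      exact ((hg'.comp measurable_fst).sub (hg'.comp measurable_snd)).enorm.mul hw
    have hI : ∀ g, StronglyMeasurable g →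
        ∫⁻ x, ∫⁻ y, ‖g x - g y‖ₑ ^ (p : ℝ) / ‖x - y‖ₑ ^ e
          = ∫⁻ z, (A g z) ^ (p : ℝ) ∂(volume.prod volume) := by
      intro g hg
      rw [lintegral_prod _ ((hA g hg).pow_const _).aemeasurable]
      refine lintegral_congr fun x => lintegral_congr fun y => ?_
      simp only [A, w]
      rw [ENNReal.mul_rpow_of_nonneg _ _ hp0.le, ← ENNReal.rpow_mul,
        one_div_mul_cancel hp0.ne', ENNReal.rpow_one, div_eq_mul_inv]
    rw [hI _ hg, hI _ hh, hI _ (hg.add hh)]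
    refine le_trans ?_
      (ENNReal.lintegral_Lp_add_le (hA g hg).aemeasurable (hA h hh).aemeasurable hp1)
    gcongr with z
    simp only [A, Pi.add_apply, ← add_mul]
    gcongr
    rw [add_sub_add_comm]
    exact enorm_add_le _ _

theorem locallyIntegrable_coe [Fact (1 ≤ p)] {F : Type*} [NormedAddCommGroup F]
    (u : Lp F (p : ℝ≥0∞) (volume : Measure (EuclideanSpace ℝ (Fin n)))) :
    LocallyIntegrable u volume :=
  (Lp.memLp u).locallyIntegrable Fact.out

theorem integrable_mul_of_continuous {u : EuclideanSpace ℝ (Fin n) → ℝ}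
    (hu : LocallyIntegrable u volume) {f : EuclideanSpace ℝ (Fin n) → ℝ} (hf : Continuous f)
    (hc : HasCompactSupport f) : Integrable (fun x => u x * f x) volume := by
  simpa [mul_comm] using hu.integrable_smul_left_of_hasCompactSupport hf hc

theorem locallyIntegrable_coord [Fact (1 ≤ p)]
    (g : Lp (EuclideanSpace ℝ (Fin n)) (p : ℝ≥0∞) (volume : Measure (EuclideanSpace ℝ (Fin n))))
    (i : Fin n) : LocallyIntegrable (fun x => g x i) volume := by
  have := ((EuclideanSpace.proj (𝕜 := ℝ) i).comp_memLp' (Lp.memLp g))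
  exact this.locallyIntegrable Fact.out

theorem continuous_partial (φ : CcSpace n ⊤) (v : EuclideanSpace ℝ (Fin n)) :
    Continuous (fun x => fderiv ℝ φ x v) :=
  (φ.contDiff.continuous_fderiv (by simp)).clm_apply continuous_const

theorem hasCompactSupport_partial (φ : CcSpace n ⊤) (v : EuclideanSpace ℝ (Fin n)) :
    HasCompactSupport (fun x => fderiv ℝ φ x v) :=
  φ.hasCompactSupport.fderiv_apply (𝕜 := ℝ) v

theorem HasWeakGradient.congr {u u' : EuclideanSpace ℝ (Fin n) → ℝ}
    {g g' : EuclideanSpace ℝ (Fin n) → EuclideanSpace ℝ (Fin n)}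
    (h : HasWeakGradient u g) (hu : u =ᵐ[volume] u') (hg : g =ᵐ[volume] g') :
    HasWeakGradient u' g' := by
  intro φ i
  have h1 : ∫ x, u' x * fderiv ℝ φ x (EuclideanSpace.single i 1) =
      ∫ x, u x * fderiv ℝ φ x (EuclideanSpace.single i 1) := by
    refine integral_congr_ae ?_
    filter_upwards [hu] with x hx
    rw [hx]
  have h2 : ∫ x, g' x i * φ x = ∫ x, g x i * φ x := by
    refine integral_congr_ae ?_
    filter_upwards [hg] with x hx
    rw [hx]
  rw [h1, h2]
  exact h φ i

end Aux

/-- The space `B(s,p)`, `1 ≤ s < 2`, `1 ≤ p < ∞`, as a linear space: the pairs `(u, Du)` with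
`u ∈ L^p(ℝⁿ)`, weak gradient `Du ∈ L^p(ℝⁿ)`, and finite fractional seminorm. As the weak gradient
is determined by `u`, this is the same as the space of all such `u` (see `BesovSpace.ext_val`). -/
noncomputable def besovSubmodule (n : ℕ) (s : ℝ) (p : ℝ≥0) [hp : Fact (1 ≤ p)] :
    Submodule ℝ (Lp ℝ (p : ℝ≥0∞) (volume : Measure (EuclideanSpace ℝ (Fin n))) ×
      Lp (EuclideanSpace ℝ (Fin n)) (p : ℝ≥0∞) (volume : Measure (EuclideanSpace ℝ (Fin n)))) where
  carrier := {w | HasWeakGradient w.1 w.2 ∧ besovSeminorm s p w.2 < ∞}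
  zero_mem' := by
    refine ⟨?_, ?_⟩
    · have h0 : HasWeakGradient (0 : EuclideanSpace ℝ (Fin n) → ℝ) 0 := by
        intro φ i
        simp
      exact h0.congr (Lp.coeFn_zero _ _ _).symm (Lp.coeFn_zero _ _ _).symm
    · have := besovSeminorm_congr (s := s) (p := p)
        (Lp.coeFn_zero (EuclideanSpace ℝ (Fin n)) (p : ℝ≥0∞)
          (volume : Measure (EuclideanSpace ℝ (Fin n))))
      rw [besovSeminorm_zero] at this
      exact this.trans_lt ENNReal.zero_lt_top
  add_mem' := by
    rintro a b ⟨ha, ha'⟩ ⟨hb, hb'⟩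
    refine ⟨?_, ?_⟩
    · refine HasWeakGradient.congr (u := ⇑a.1 + ⇑b.1) (g := ⇑a.2 + ⇑b.2) ?_
        (Lp.coeFn_add a.1 b.1).symm (Lp.coeFn_add a.2 b.2).symm
      intro φ i
      have h1 := ha φ i
      have h2 := hb φ i
      simp only [Pi.add_apply, PiLp.add_apply, add_mul]
      rw [integral_add, integral_add, h1, h2, neg_add]
      · exact integrable_mul_of_continuous (locallyIntegrable_coord _ i) φ.continuous
          φ.hasCompactSupport
      · exact integrable_mul_of_continuous (locallyIntegrable_coord _ i) φ.continuous
          φ.hasCompactSupport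
      · exact integrable_mul_of_continuous (locallyIntegrable_coe _) (continuous_partial φ _)
          (hasCompactSupport_partial φ _)
      · exact integrable_mul_of_continuous (locallyIntegrable_coe _) (continuous_partial φ _)
          (hasCompactSupport_partial φ _)
    · rw [Prod.snd_add, besovSeminorm_congr (Lp.coeFn_add _ _)]
      exact (besovSeminorm_add_le (Lp.stronglyMeasurable _) (Lp.stronglyMeasurable _)).trans_lt
        (ENNReal.add_lt_top.2 ⟨ha', hb'⟩)
  smul_mem' := by
    rintro c a ⟨ha, ha'⟩
    refine ⟨?_, ?_⟩
    · refine HasWeakGradient.congr (u := c • ⇑a.1) (g := c • ⇑a.2) ?_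
        (Lp.coeFn_smul c a.1).symm (Lp.coeFn_smul c a.2).symm
      intro φ i
      have h1 := ha φ i
      simp only [Pi.smul_apply, PiLp.smul_apply, smul_eq_mul, mul_assoc]
      rw [integral_const_mul, integral_const_mul, h1, mul_neg]
    · change besovSeminorm s p (c • a.2 : Lp _ _ _) < ∞
      rw [besovSeminorm_congr (Lp.coeFn_smul _ _), besovSeminorm_smul]
      exact ENNReal.mul_lt_top (by simp) ha'

/-- The Besov space `B(s,p)` of functions on `ℝⁿ` (modulo almost everywhere equality). -/
def BesovSpace (n : ℕ) (s : ℝ) (p : ℝ≥0) [Fact (1 ≤ p)] : Type := ↥(besovSubmodule n s p)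

namespace BesovSpace

variable {n : ℕ} {s : ℝ} {p : ℝ≥0} [hp : Fact (1 ≤ p)]

noncomputable instance : AddCommGroup (BesovSpace n s p) :=
  inferInstanceAs (AddCommGroup ↥(besovSubmodule n s p))

noncomputable instance : Module ℝ (BesovSpace n s p) :=
  inferInstanceAs (Module ℝ ↥(besovSubmodule n s p))

/-- The underlying function of an element of `B(s,p)`, as an `L^p` class. -/
noncomputable def val (u : BesovSpace n s p) :
    Lp ℝ (p : ℝ≥0∞) (volume : Measure (EuclideanSpace ℝ (Fin n))) := u.1.1

/-- The weak gradient `Du` of an element `u` of `B(s,p)`. -/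
noncomputable def grad (u : BesovSpace n s p) :
    Lp (EuclideanSpace ℝ (Fin n)) (p : ℝ≥0∞) (volume : Measure (EuclideanSpace ℝ (Fin n))) := u.1.2

theorem hasWeakGradient (u : BesovSpace n s p) : HasWeakGradient u.val u.grad := u.2.1

theorem besovSeminorm_lt_top (u : BesovSpace n s p) : besovSeminorm s p u.grad < ∞ := u.2.2

/-- An element of `B(s,p)` is determined by its underlying function. -/
theorem ext_val {u v : BesovSpace n s p} (h : u.val = v.val) : u = v := by
  refine Subtype.ext (Prod.ext h ?_)
  change u.grad = v.grad
  refine Lp.ext ?_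
  have key : ∀ i : Fin n, ∀ᵐ x, u.grad x i = v.grad x i := by
    intro i
    refine ae_eq_of_integral_contDiff_smul_eq (locallyIntegrable_coord _ i)
      (locallyIntegrable_coord _ i) ?_
    intro f hf hc
    have h1 := u.hasWeakGradient ⟨f, hf, hc, by simp⟩ i
    have h2 := v.hasWeakGradient ⟨f, hf, hc, by simp⟩ i
    rw [h, h2, neg_inj] at h1
    simpa [mul_comm] using h1.symm
  filter_upwards [ae_all_iff.2 key] with x hx
  ext i
  exact hx i

/-- `‖u‖_{s,p} = ‖u‖_{W^{1,p}} + (fractional seminorm of Du)`, where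
`‖u‖_{W^{1,p}} = ‖u‖_{L^p} + ‖Du‖_{L^p}`. -/
noncomputable instance : Norm (BesovSpace n s p) :=
  ⟨fun u => ‖u.val‖ + ‖u.grad‖ + (besovSeminorm s p u.grad).toReal⟩

theorem norm_def (u : BesovSpace n s p) :
    ‖u‖ = ‖u.val‖ + ‖u.grad‖ + (besovSeminorm s p u.grad).toReal := rfl

theorem normedSpaceCore : NormedSpace.Core ℝ (BesovSpace n s p) where
  norm_nonneg u := by
    rw [norm_def]
    positivity
  norm_smul c u := by
    have h1 : (c • u).val = c • u.val := rfl
    have h2 : (c • u).grad = c • u.grad := rfl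
    rw [norm_def, norm_def, h1, h2, besovSeminorm_congr (Lp.coeFn_smul _ _), besovSeminorm_smul,
      norm_smul, norm_smul, ENNReal.toReal_mul, toReal_enorm]
    ring
  norm_triangle u v := by
    have h1 : (u + v).val = u.val + v.val := rfl
    have h2 : (u + v).grad = u.grad + v.grad := rfl
    rw [norm_def, norm_def, norm_def, h1, h2, besovSeminorm_congr (Lp.coeFn_add _ _)]
    have h3 := ENNReal.toReal_mono
      (ENNReal.add_lt_top.2 ⟨u.besovSeminorm_lt_top, v.besovSeminorm_lt_top⟩).ne
      (besovSeminorm_add_le (s := s) (p := p) (Lp.stronglyMeasurable u.grad)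
        (Lp.stronglyMeasurable v.grad))
    rw [ENNReal.toReal_add u.besovSeminorm_lt_top.ne v.besovSeminorm_lt_top.ne] at h3
    linarith [norm_add_le u.val v.val, norm_add_le u.grad v.grad]
  norm_eq_zero_iff u := by
    constructor
    · intro h
      rw [norm_def] at h
      have h1 : ‖u.val‖ = 0 := by
        have := norm_nonneg u.val
        have := norm_nonneg u.grad
        have := ENNReal.toReal_nonneg (a := besovSeminorm s p u.grad)
        linarith
      exact ext_val (norm_eq_zero.1 h1)
    · rintro rfl
      have h1 : (0 : BesovSpace n s p).val = 0 := rfl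
      have h2 : (0 : BesovSpace n s p).grad = 0 := rfl
      rw [norm_def, h1, h2, besovSeminorm_congr (Lp.coeFn_zero _ _ _), besovSeminorm_zero]
      simp

noncomputable instance : NormedAddCommGroup (BesovSpace n s p) :=
  NormedAddCommGroup.ofCore normedSpaceCore

noncomputable instance : NormedSpace ℝ (BesovSpace n s p) :=
  NormedSpace.ofCore normedSpaceCore

/-- The element `v` of `B(s,p)` is (the class of) the function `u`. -/
def Represents (v : BesovSpace n s p) (u : EuclideanSpace ℝ (Fin n) → ℝ) : Prop :=
  (v.val : EuclideanSpace ℝ (Fin n) → ℝ) =ᵐ[volume] u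

end BesovSpace

/-- The map `𝓕` from `B(s,p)` to the distributions of order at most `m` extends the `k`-Hessian
`u ↦ F_k[u]` on `C_c²(ℝⁿ)`, where `F_k[u]` is the distribution `φ ↦ ∫ F_k[u] φ dx`. -/
def ExtendsKHessian {n : ℕ} {s : ℝ} {p : ℝ≥0} [Fact (1 ≤ p)] {m : ℕ∞} (k : ℕ)
    (𝓕 : BesovSpace n s p → DistSpace n m) : Prop :=
  ∀ (u : CcSpace n 2) (v : BesovSpace n s p), v.Represents u →
    ∀ φ : CcSpace n m, 𝓕 v φ = ∫ x, kHessian k u x * φ x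

/-!
The proof is by mollification in `ℝⁿ`. Let `N[f₁, …, f_k]` be the polarized `k`-Hessian
(`mixedHessian`), a sum over multi-indices `r, c` of the generalized Kronecker symbol times
`∏ₘ ∂_{r m} ∂_{c m} fₘ`, so that `N[f, …, f] = k! F_k[f]`. Everything follows from the multilinear
estimate `exists_abs_hessianForm_le`

  `|∫ N[f₁, …, f_k] φ| ≤ C ∏ₘ ‖fₘ‖ ‖D²φ‖_∞`, for `fₘ`, `φ` of class `C_c²`,

and from the density of `C_c²` in `B(2 - 2/k, k)` (`denseRange_toBesov`).

*The multilinear estimate.* The Kronecker symbol is antisymmetric in `r` and in `c`, so that the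
divergence of the cofactors vanishes and two integrations by parts move two derivatives from any
chosen factor onto `φ` (`integral_mixedHessian_mul`). Let `T_J = ∫ N[η_t * f₁, …, η_t * f_k] φ` with
`t = 2^{-J}`. By telescoping, `T_{J+1} - T_J` is a sum of terms with one factor
`η_{t/2} * fₘ - η_t * fₘ`, which is left undifferentiated, while the other factors keep their second
derivatives. With `Q_t` the mean over `|y| ≤ t` of `|Df(x - y) - Df(x)|`, the difference is at most
a constant times `t Q_t` and the second derivatives of the mollifications are at most a constant
times `Q_t / t` (`abs_mollify_sub_mollify_half_le`, `abs_partialDeriv_mollify_le`). Hence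
`|T_{J+1} - T_J| ≤ C t^{2-k} ∑ₘ ∫ Q_t[fₘ]^k ‖D²φ‖_∞` when the norms are at most one, and the sum over
the dyadic scales is controlled by the integral of `|Df(x - y) - Df(x)|^k / |y|^{n+k-2}`
(`sum_lintegral_meanOscillation_le`), which is the fractional part of the norm of
`B(2 - 2/k, k)`. For `k = 2`, where there is no such term, the two integrations by parts are done so
that two first derivatives remain, which are in `L²`. Letting `J → ∞` and using homogeneity gives
the estimate.

*Density.* Functions `χ(t ·) (η_t * u)` approximate `u`. The fractional seminorm of a field `G` is an
integral over `h` of a power of the modulus of continuity `‖G(· - h) - G‖_{L^k}`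
(`gagliardoIntegral_eq`); this modulus tends to zero for each `h` by `L^k` convergence, and is
dominated by twice that of `Du` plus a multiple of `min 1 |h|`, so dominated convergence applies.

*The extension.* The estimate, applied to the differences by telescoping, shows that `∫ F_k[a_j] φ`
converges along each sequence in `C_c²` converging in `B(2 - 2/k, k)`. The limits form distributions
of order at most two which obey the same estimate. As `‖D²φ‖_∞` is bounded on compact sets of test
functions, the extension is continuous for the topology of uniform convergence on these sets.
-/

/-! ### The polarized `k`-Hessian -/

/-- The generalized Kronecker symbol `δ^{r₁⋯r_k}_{c₁⋯c_k} = det (δ_{r_a c_b})_{a,b}`. -/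
noncomputable def kroneckerSymbol {n k : ℕ} (r c : Fin k → Fin n) : ℝ :=
  (Matrix.of fun a b : Fin k => if r a = c b then (1 : ℝ) else 0).det

theorem kroneckerSymbol_swap_left {n k : ℕ} (r c : Fin k → Fin n) {a b : Fin k} (hab : a ≠ b) :
    kroneckerSymbol (r ∘ Equiv.swap a b) c = -kroneckerSymbol r c := by
  have h := Matrix.det_permute (Equiv.swap a b)
    (Matrix.of fun a b : Fin k => if r a = c b then (1 : ℝ) else 0)
  rw [Equiv.Perm.sign_swap hab] at h
  simpa [kroneckerSymbol, Matrix.submatrix] using h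

theorem kroneckerSymbol_swap_right {n k : ℕ} (r c : Fin k → Fin n) {a b : Fin k} (hab : a ≠ b) :
    kroneckerSymbol r (c ∘ Equiv.swap a b) = -kroneckerSymbol r c := by
  have h := Matrix.det_permute' (Equiv.swap a b)
    (Matrix.of fun a b : Fin k => if r a = c b then (1 : ℝ) else 0)
  rw [Equiv.Perm.sign_swap hab] at h
  simpa [kroneckerSymbol, Matrix.submatrix] using h

/-- The polarization of `k! [A]_k`: a multilinear function of `k` matrices, written with the
generalized Kronecker symbol, so that it is a sum of products of single entries. -/
noncomputable def mixedTrace {n k : ℕ} (A : Fin k → Matrix (Fin n) (Fin n) ℝ) : ℝ :=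
  ∑ r : Fin k → Fin n, ∑ c : Fin k → Fin n, kroneckerSymbol r c * ∏ m, A m (r m) (c m)

theorem sum_kroneckerSymbol_mul_prod {n k : ℕ} (A : Matrix (Fin n) (Fin n) ℝ)
    (r : Fin k → Fin n) :
    ∑ c : Fin k → Fin n, kroneckerSymbol r c * ∏ m, A (r m) (c m) = (A.submatrix r r).det := by
  classical
  have h1 : ∀ c : Fin k → Fin n, kroneckerSymbol r c =
      ∑ σ : Equiv.Perm (Fin k), (Equiv.Perm.sign σ : ℝ) * (if r ∘ σ = c then 1 else 0) := by
    intro c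
    rw [kroneckerSymbol, Matrix.det_apply']
    refine Finset.sum_congr rfl fun σ _ => ?_
    congr 1
    simp only [Matrix.of_apply, Finset.prod_ite_zero, Finset.mem_univ, true_implies,
      Finset.prod_const_one, funext_iff, Function.comp_apply]
  simp_rw [h1, Finset.sum_mul]
  rw [Finset.sum_comm, ← Matrix.det_transpose, Matrix.det_apply']
  refine Finset.sum_congr rfl fun σ _ => ?_
  simp

theorem sum_det_submatrix_eq {n k : ℕ} (A : Matrix (Fin n) (Fin n) ℝ) :
    ∑ r : Fin k → Fin n, (A.submatrix r r).det = (k.factorial : ℝ) * kTrace k A := by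
  classical
  have h0 : ∑ r : Fin k → Fin n, (A.submatrix r r).det =
      ∑ r : Fin k → Fin n with Function.Injective r, (A.submatrix r r).det := by
    symm
    apply Finset.sum_subset (Finset.filter_subset _ _)
    intro r _ hr
    have hr : ¬ Function.Injective r := by simpa using hr
    simp only [Function.Injective, not_forall] at hr
    obtain ⟨a, b, h, hab⟩ := hr
    exact Matrix.det_zero_of_row_eq hab (by ext j; simp [Matrix.submatrix, h])
  rw [h0, kTrace, Finset.mul_sum]
  rw [← Finset.sum_fiberwise_of_maps_to
    (g := fun r : Fin k → Fin n => Finset.univ.image r)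
    (t := Finset.powersetCard k (Finset.univ : Finset (Fin n)))]
  · refine Finset.sum_congr rfl fun α hα => ?_
    have hα' : α.card = k := (Finset.mem_powersetCard.1 hα).2
    have h2 : ∑ e : Fin k ≃ α, (A.submatrix (fun i : α => (i : Fin n)) (fun i : α => (i : Fin n))).det
        = ∑ r ∈ (Finset.univ.filter fun r : Fin k → Fin n => Function.Injective r).filter
          (fun r => Finset.univ.image r = α), (A.submatrix r r).det := by
      refine Finset.sum_bij (fun e _ => fun i => (e i : Fin n)) ?_ ?_ ?_ ?_
      · intro e _
        simp only [Finset.mem_filter, Finset.mem_univ, true_and]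
        refine ⟨fun a b h => e.injective (Subtype.ext h), ?_⟩
        ext x
        simp only [Finset.mem_image, Finset.mem_univ, true_and]
        constructor
        · rintro ⟨a, rfl⟩
          exact (e a).2
        · intro hx
          exact ⟨e.symm ⟨x, hx⟩, by simp⟩
      · intro e _ e' _ h
        ext i
        exact congrArg Fin.val (congrFun h i)
      · intro r hr
        simp only [Finset.mem_filter, Finset.mem_univ, true_and] at hr
        obtain ⟨hr, hi⟩ := hr
        have hm : ∀ i, r i ∈ α := fun i => hi ▸ Finset.mem_image_of_mem r (Finset.mem_univ i)
        refine ⟨Equiv.ofBijective (fun i => (⟨r i, hm i⟩ : α)) ⟨?_, ?_⟩, Finset.mem_univ _, ?_⟩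
        · intro a b h
          exact hr (congrArg Subtype.val h)
        · rintro ⟨x, hx⟩
          rw [← hi] at hx
          obtain ⟨i, _, rfl⟩ := Finset.mem_image.1 hx
          exact ⟨i, rfl⟩
        · rfl
      · intro e _
        rw [← Matrix.det_submatrix_equiv_self e]
        rfl
    rw [← h2, Finset.sum_const, Finset.card_univ,
      Fintype.card_equiv (Fintype.equivOfCardEq (by simp [hα'])), Fintype.card_fin, nsmul_eq_mul]
  · intro r hr
    simp only [Finset.mem_filter, Finset.mem_univ, true_and] at hr
    simp [Finset.mem_powersetCard, Finset.card_image_of_injective _ hr]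

/-- On the diagonal the polarization gives back `k! [A]_k`. -/
theorem mixedTrace_diag {n k : ℕ} (A : Matrix (Fin n) (Fin n) ℝ) :
    mixedTrace (fun _ : Fin k => A) = (k.factorial : ℝ) * kTrace k A := by
  rw [← sum_det_submatrix_eq, mixedTrace]
  exact Finset.sum_congr rfl fun r _ => sum_kroneckerSymbol_mul_prod A r

/-! ### Partial derivatives and integration by parts -/

section PartialDerivatives

variable {n : ℕ}

/-- The `i`-th partial derivative of a function on `ℝⁿ`. -/
noncomputable def partialDeriv (i : Fin n) (f : EuclideanSpace ℝ (Fin n) → ℝ)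
    (x : EuclideanSpace ℝ (Fin n)) : ℝ :=
  fderiv ℝ f x (EuclideanSpace.single i 1)

theorem ContDiff.partialDeriv {f : EuclideanSpace ℝ (Fin n) → ℝ} {m m' : WithTop ℕ∞}
    (hf : ContDiff ℝ m f) (hm : m' + 1 ≤ m) (i : Fin n) : ContDiff ℝ m' (partialDeriv i f) :=
  (hf.fderiv_right hm).clm_apply contDiff_const

theorem HasCompactSupport.partialDeriv {f : EuclideanSpace ℝ (Fin n) → ℝ}
    (hf : HasCompactSupport f) (i : Fin n) : HasCompactSupport (partialDeriv i f) :=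
  hf.fderiv_apply (𝕜 := ℝ) _

theorem partialDeriv_partialDeriv_eq_fderiv {f : EuclideanSpace ℝ (Fin n) → ℝ}
    (hf : ContDiff ℝ 2 f) (i j : Fin n) (x : EuclideanSpace ℝ (Fin n)) :
    partialDeriv i (partialDeriv j f) x =
      fderiv ℝ (fderiv ℝ f) x (EuclideanSpace.single i 1) (EuclideanSpace.single j 1) := by
  have h : DifferentiableAt ℝ (fderiv ℝ f) x :=
    (hf.fderiv_right (m := 1) (by norm_num)).differentiable one_ne_zero x
  unfold partialDeriv
  rw [fderiv_clm_apply h (differentiableAt_const _)]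
  simp

theorem partialDeriv_comm {f : EuclideanSpace ℝ (Fin n) → ℝ} (hf : ContDiff ℝ 2 f)
    (i j : Fin n) : partialDeriv i (partialDeriv j f) = partialDeriv j (partialDeriv i f) := by
  ext x
  rw [partialDeriv_partialDeriv_eq_fderiv hf, partialDeriv_partialDeriv_eq_fderiv hf]
  exact (hf.contDiffAt.isSymmSndFDerivAt (by simp)).eq _ _

theorem hessianMatrix_apply_eq_partialDeriv {f : EuclideanSpace ℝ (Fin n) → ℝ}
    (hf : ContDiff ℝ 2 f) (x : EuclideanSpace ℝ (Fin n)) (i j : Fin n) :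
    hessianMatrix f x i j = partialDeriv i (partialDeriv j f) x := by
  rw [partialDeriv_partialDeriv_eq_fderiv hf, hessianMatrix, Matrix.of_apply,
    iteratedFDeriv_two_apply]
  simp

theorem partialDeriv_mul {f g : EuclideanSpace ℝ (Fin n) → ℝ} (hf : ContDiff ℝ 1 f)
    (hg : ContDiff ℝ 1 g) (i : Fin n) (x : EuclideanSpace ℝ (Fin n)) :
    partialDeriv i (fun y => f y * g y) x = partialDeriv i f x * g x + f x * partialDeriv i g x := by
  unfold partialDeriv
  rw [fderiv_fun_mul (hf.differentiable one_ne_zero x) (hg.differentiable one_ne_zero x)]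
  simp only [add_apply, smul_apply, smul_eq_mul]
  ring

theorem partialDeriv_prod {ι : Type*} [DecidableEq ι] (s : Finset ι)
    (f : ι → EuclideanSpace ℝ (Fin n) → ℝ)
    (hf : ∀ m, ContDiff ℝ 1 (f m)) (i : Fin n) (x : EuclideanSpace ℝ (Fin n)) :
    partialDeriv i (fun y => ∏ m ∈ s, f m y) x =
      ∑ m ∈ s, (∏ l ∈ s.erase m, f l x) * partialDeriv i (f m) x := by
  unfold partialDeriv
  have := HasFDerivAt.finsetProd (u := s) (x := x)
    (fun m _ => ((hf m).differentiable one_ne_zero x).hasFDerivAt)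
  rw [this.fderiv]
  simp

/-- Integration by parts, for a linear combination of terms with different directions. -/
theorem integral_sum_partialDeriv_mul {ι : Type*} (s : Finset ι) (δ : ι → ℝ) (d : ι → Fin n)
    (w ψ : ι → EuclideanSpace ℝ (Fin n) → ℝ) (hw : ∀ i, ContDiff ℝ 1 (w i))
    (hψ : ∀ i, ContDiff ℝ 1 (ψ i)) (hc : ∀ i, HasCompactSupport (ψ i)) :
    ∫ x, ∑ i ∈ s, δ i * (partialDeriv (d i) (w i) x * ψ i x) =
      -∫ x, ∑ i ∈ s, δ i * (w i x * partialDeriv (d i) (ψ i) x) := by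
  have h1 : ∀ i, Integrable (fun x => partialDeriv (d i) (w i) x * ψ i x) := fun i =>
    (((hw i).partialDeriv (m' := 0) (by norm_num) (d i)).continuous.mul
      (hψ i).continuous).integrable_of_hasCompactSupport (hc i).mul_left
  have h2 : ∀ i, Integrable (fun x => w i x * partialDeriv (d i) (ψ i) x) := fun i =>
    ((hw i).continuous.mul ((hψ i).partialDeriv (m' := 0) (by norm_num)
      (d i)).continuous).integrable_of_hasCompactSupport ((hc i).partialDeriv _).mul_left
  have h3 : ∀ i, Integrable (fun x => w i x * ψ i x) := fun i =>
    ((hw i).continuous.mul (hψ i).continuous).integrable_of_hasCompactSupport (hc i).mul_left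
  rw [integral_finsetSum _ fun i _ => (h1 i).const_mul _,
    integral_finsetSum _ fun i _ => (h2 i).const_mul _, ← Finset.sum_neg_distrib]
  refine Finset.sum_congr rfl fun i _ => ?_
  rw [integral_const_mul, integral_const_mul, ← mul_neg]
  congr 1
  rw [eq_comm, neg_eq_iff_eq_neg]
  exact integral_mul_fderiv_eq_neg_fderiv_mul_of_integrable (h1 i) (h2 i) (h3 i)
    (fun x _ => (hw i).differentiable one_ne_zero x) (fun x _ => (hψ i).differentiable one_ne_zero x)

end PartialDerivatives

/-! ### The null-Lagrangian structure of the `k`-Hessian -/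

section NullLagrangian

variable {n k : ℕ}

theorem sum_eq_zero_of_swap_antisymm (T : (Fin k → Fin n) → ℝ) (a b : Fin k)
    (h : ∀ r, T (r ∘ Equiv.swap a b) = -T r) : ∑ r, T r = 0 := by
  have h1 := Equiv.sum_comp ((Equiv.swap a b).arrowCongr (Equiv.refl (Fin n))) T
  have h2 : ∀ r, T ((Equiv.swap a b).arrowCongr (Equiv.refl (Fin n)) r) = -T r := fun r => by
    rw [← h r]
    rfl
  simp_rw [h2, Finset.sum_neg_distrib] at h1
  linarith

/-- The cofactors of a matrix of second derivatives are divergence free, in polarized form: an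
antisymmetric coefficient annihilates the symmetric third derivatives. -/
theorem sum_mul_partialDeriv_prod_eq_zero (δ : (Fin k → Fin n) → ℝ) (a : Fin k)
    (hδ : ∀ r m, m ≠ a → δ (r ∘ Equiv.swap a m) = -δ r)
    (g : Fin k → EuclideanSpace ℝ (Fin n) → ℝ) (hg : ∀ m, ContDiff ℝ 2 (g m))
    (x : EuclideanSpace ℝ (Fin n)) :
    ∑ r, δ r * partialDeriv (r a)
      (fun y => ∏ m ∈ Finset.univ.erase a, partialDeriv (r m) (g m) y) x = 0 := by
  have h1 : ∀ r : Fin k → Fin n, δ r * partialDeriv (r a)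
      (fun y => ∏ m ∈ Finset.univ.erase a, partialDeriv (r m) (g m) y) x =
      ∑ m ∈ Finset.univ.erase a, δ r * ((∏ l ∈ (Finset.univ.erase a).erase m,
        partialDeriv (r l) (g l) x) * partialDeriv (r a) (partialDeriv (r m) (g m)) x) := by
    intro r
    rw [partialDeriv_prod _ _ fun m => (hg m).partialDeriv (by norm_num) _, Finset.mul_sum]
  simp_rw [h1]
  rw [Finset.sum_comm]
  refine Finset.sum_eq_zero fun m hm => ?_
  have hma : m ≠ a := Finset.ne_of_mem_erase hm
  refine sum_eq_zero_of_swap_antisymm _ a m fun r => ?_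
  rw [hδ r m hma]
  have h2 : ∏ l ∈ (Finset.univ.erase a).erase m, partialDeriv ((r ∘ Equiv.swap a m) l) (g l) x =
      ∏ l ∈ (Finset.univ.erase a).erase m, partialDeriv (r l) (g l) x := by
    refine Finset.prod_congr rfl fun l hl => ?_
    have hl1 : l ≠ m := Finset.ne_of_mem_erase hl
    have hl2 : l ≠ a := Finset.ne_of_mem_erase (Finset.mem_of_mem_erase hl)
    rw [Function.comp_apply, Equiv.swap_apply_of_ne_of_ne hl2 hl1]
  rw [h2, Function.comp_apply, Function.comp_apply, Equiv.swap_apply_left,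
    Equiv.swap_apply_right, partialDeriv_comm (hg m)]
  ring

/-- The polarized `k`-Hessian of `k` functions, without the factor `1 / k!`. -/
noncomputable def mixedHessian (f : Fin k → EuclideanSpace ℝ (Fin n) → ℝ)
    (x : EuclideanSpace ℝ (Fin n)) : ℝ :=
  mixedTrace fun m => Matrix.of fun i j => partialDeriv i (partialDeriv j (f m)) x

theorem mixedHessian_diag {u : EuclideanSpace ℝ (Fin n) → ℝ} (hu : ContDiff ℝ 2 u)
    (x : EuclideanSpace ℝ (Fin n)) :
    mixedHessian (fun _ : Fin k => u) x = (k.factorial : ℝ) * kHessian k u x := by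
  rw [kHessian, ← mixedTrace_diag, mixedHessian]
  congr 1
  ext m i j
  exact (hessianMatrix_apply_eq_partialDeriv hu x i j).symm

theorem mixedHessian_eq_sum (f : Fin k → EuclideanSpace ℝ (Fin n) → ℝ)
    (x : EuclideanSpace ℝ (Fin n)) :
    mixedHessian f x = ∑ q : (Fin k → Fin n) × (Fin k → Fin n), kroneckerSymbol q.1 q.2 *
      ∏ m, partialDeriv (q.1 m) (partialDeriv (q.2 m) (f m)) x := by
  rw [Fintype.sum_prod_type]
  rfl

theorem contDiff_prod_partialDeriv {f : Fin k → EuclideanSpace ℝ (Fin n) → ℝ}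
    (hf : ∀ m, ContDiff ℝ 3 (f m)) (s : Finset (Fin k)) (r c : Fin k → Fin n) :
    ContDiff ℝ 1 fun y => ∏ m ∈ s, partialDeriv (r m) (partialDeriv (c m) (f m)) y :=
  contDiff_prod fun m _ =>
    ((hf m).partialDeriv (m' := 2) (by norm_num) _).partialDeriv (by norm_num) _

/-- The first integration by parts takes one derivative off the `a`-th function; because of the
null-Lagrangian structure, it only meets the test function. -/
theorem integral_mixedHessian_mul_eq_neg {f : Fin k → EuclideanSpace ℝ (Fin n) → ℝ}
    (hf : ∀ m, ContDiff ℝ 3 (f m)) {φ : EuclideanSpace ℝ (Fin n) → ℝ} (hφ : ContDiff ℝ 2 φ)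
    (hc : HasCompactSupport φ) (a : Fin k) :
    ∫ x, mixedHessian f x * φ x =
      -∫ x, ∑ q : (Fin k → Fin n) × (Fin k → Fin n), kroneckerSymbol q.1 q.2 *
        (partialDeriv (q.2 a) (f a) x * (partialDeriv (q.1 a) φ x *
          ∏ m ∈ Finset.univ.erase a, partialDeriv (q.1 m) (partialDeriv (q.2 m) (f m)) x)) := by
  have hφ1 : ContDiff ℝ 1 φ := hφ.of_le (by norm_num)
  have h := integral_sum_partialDeriv_mul Finset.univ
    (fun q : (Fin k → Fin n) × (Fin k → Fin n) => kroneckerSymbol q.1 q.2) (fun q => q.1 a)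
    (fun q => partialDeriv (q.2 a) (f a))
    (fun q x => φ x *
      ∏ m ∈ Finset.univ.erase a, partialDeriv (q.1 m) (partialDeriv (q.2 m) (f m)) x)
    (fun q => (hf a).partialDeriv (by norm_num) _)
    (fun q => hφ1.mul (contDiff_prod_partialDeriv hf _ _ _)) (fun q => hc.mul_right)
  have h1 : ∀ x, mixedHessian f x * φ x = ∑ q : (Fin k → Fin n) × (Fin k → Fin n),
      kroneckerSymbol q.1 q.2 * (partialDeriv (q.1 a) (partialDeriv (q.2 a) (f a)) x * (φ x *
      ∏ m ∈ Finset.univ.erase a, partialDeriv (q.1 m) (partialDeriv (q.2 m) (f m)) x)) := by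
    intro x
    rw [mixedHessian_eq_sum, Finset.sum_mul]
    refine Finset.sum_congr rfl fun q _ => ?_
    rw [← Finset.mul_prod_erase Finset.univ _ (Finset.mem_univ a)]
    ring
  simp_rw [h1]
  rw [h]
  congr 2
  ext x
  simp_rw [partialDeriv_mul hφ1 (contDiff_prod_partialDeriv hf _ _ _), mul_add,
    Finset.sum_add_distrib]
  -- the derivatives falling on the other second derivatives cancel
  rw [add_eq_left, Fintype.sum_prod_type_right]
  refine Finset.sum_eq_zero fun c _ => ?_
  have h2 := sum_mul_partialDeriv_prod_eq_zero (fun r => kroneckerSymbol r c) a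
    (fun r m hm => kroneckerSymbol_swap_left r c hm.symm) (fun m => partialDeriv (c m) (f m))
    (fun m => (hf m).partialDeriv (by norm_num) _) x
  calc _ = partialDeriv (c a) (f a) x * φ x * ∑ r : Fin k → Fin n, kroneckerSymbol r c *
        partialDeriv (r a) (fun y => ∏ m ∈ Finset.univ.erase a,
          partialDeriv (r m) (partialDeriv (c m) (f m)) y) x := by
        rw [Finset.mul_sum]
        exact Finset.sum_congr rfl fun r _ => by ring
    _ = 0 := by rw [h2, mul_zero]

/-- Two integrations by parts move both derivatives from the `a`-th function to the test
function. -/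
theorem integral_mixedHessian_mul {f : Fin k → EuclideanSpace ℝ (Fin n) → ℝ}
    (hf : ∀ m, ContDiff ℝ 3 (f m)) {φ : EuclideanSpace ℝ (Fin n) → ℝ} (hφ : ContDiff ℝ 2 φ)
    (hc : HasCompactSupport φ) (a : Fin k) :
    ∫ x, mixedHessian f x * φ x =
      ∫ x, ∑ q : (Fin k → Fin n) × (Fin k → Fin n), kroneckerSymbol q.1 q.2 *
        (f a x * (partialDeriv (q.2 a) (partialDeriv (q.1 a) φ) x *
          ∏ m ∈ Finset.univ.erase a, partialDeriv (q.1 m) (partialDeriv (q.2 m) (f m)) x)) := by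
  have hφ1 : ∀ i, ContDiff ℝ 1 (partialDeriv i φ) := fun i => hφ.partialDeriv (by norm_num) i
  rw [integral_mixedHessian_mul_eq_neg hf hφ hc a,
    integral_sum_partialDeriv_mul Finset.univ
    (fun q : (Fin k → Fin n) × (Fin k → Fin n) => kroneckerSymbol q.1 q.2) (fun q => q.2 a)
    (fun q => f a)
    (fun q x => partialDeriv (q.1 a) φ x *
      ∏ m ∈ Finset.univ.erase a, partialDeriv (q.1 m) (partialDeriv (q.2 m) (f m)) x)
    (fun q => (hf a).of_le (by norm_num))
    (fun q => (hφ1 _).mul (contDiff_prod_partialDeriv hf _ _ _))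
    (fun q => (hc.partialDeriv _).mul_right), neg_neg]
  congr 1
  ext x
  simp_rw [partialDeriv_mul (hφ1 _) (contDiff_prod_partialDeriv hf _ _ _), mul_add,
    Finset.sum_add_distrib]
  -- again the derivatives falling on the other second derivatives cancel
  rw [add_eq_left, Fintype.sum_prod_type]
  refine Finset.sum_eq_zero fun r _ => ?_
  have h2 := sum_mul_partialDeriv_prod_eq_zero (fun c => kroneckerSymbol r c) a
    (fun c m hm => kroneckerSymbol_swap_right r c hm.symm) (fun m => partialDeriv (r m) (f m))
    (fun m => (hf m).partialDeriv (by norm_num) _) x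
  have h3 : ∀ (c : Fin k → Fin n) m, partialDeriv (r m) (partialDeriv (c m) (f m)) =
      partialDeriv (c m) (partialDeriv (r m) (f m)) := fun c m =>
    partialDeriv_comm ((hf m).of_le (by norm_num)) _ _
  simp_rw [h3]
  calc _ = f a x * partialDeriv (r a) φ x * ∑ c : Fin k → Fin n, kroneckerSymbol r c *
        partialDeriv (c a) (fun y => ∏ m ∈ Finset.univ.erase a,
          partialDeriv (c m) (partialDeriv (r m) (f m)) y) x := by
        rw [Finset.mul_sum]
        exact Finset.sum_congr rfl fun r _ => by ring
    _ = 0 := by rw [h2, mul_zero]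

/-- For `k = 2`, the two integrations by parts can be distributed over the two functions, so that
only first derivatives of them remain. -/
theorem integral_mixedHessian_two_mul {f : Fin 2 → EuclideanSpace ℝ (Fin n) → ℝ}
    (hf : ∀ m, ContDiff ℝ 3 (f m)) {φ : EuclideanSpace ℝ (Fin n) → ℝ} (hφ : ContDiff ℝ 2 φ)
    (hc : HasCompactSupport φ) :
    ∫ x, mixedHessian f x * φ x =
      ∫ x, ∑ q : (Fin 2 → Fin n) × (Fin 2 → Fin n), kroneckerSymbol q.1 q.2 *
        (partialDeriv (q.1 1) (f 1) x * (partialDeriv (q.2 0) (f 0) x *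
          partialDeriv (q.2 1) (partialDeriv (q.1 0) φ) x)) := by
  have hφ1 : ∀ i, ContDiff ℝ 1 (partialDeriv i φ) := fun i => hφ.partialDeriv (by norm_num) i
  have hf1 : ∀ m i, ContDiff ℝ 1 (partialDeriv i (f m)) := fun m i =>
    (hf m).partialDeriv (by norm_num) i
  rw [integral_mixedHessian_mul_eq_neg hf hφ hc 0]
  have h1 := integral_sum_partialDeriv_mul Finset.univ
    (fun q : (Fin 2 → Fin n) × (Fin 2 → Fin n) => kroneckerSymbol q.1 q.2) (fun q => q.2 1)
    (fun q => partialDeriv (q.1 1) (f 1))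
    (fun q x => partialDeriv (q.2 0) (f 0) x * partialDeriv (q.1 0) φ x)
    (fun q => hf1 _ _) (fun q => (hf1 _ _).mul (hφ1 _))
    (fun q => (hc.partialDeriv _).mul_left)
  have h2 : (Finset.univ : Finset (Fin 2)).erase 0 = {1} := by decide
  simp_rw [h2, Finset.prod_singleton]
  have h3 : ∀ (r c : Fin 2 → Fin n) m, partialDeriv (r m) (partialDeriv (c m) (f m)) =
      partialDeriv (c m) (partialDeriv (r m) (f m)) := fun r c m =>
    partialDeriv_comm ((hf m).of_le (by norm_num)) _ _
  rw [neg_eq_iff_eq_neg]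
  calc _ = _ := by
        congr 1
        ext x
        refine Finset.sum_congr rfl fun q _ => ?_
        rw [h3, ← mul_assoc (partialDeriv (q.2 0) (f 0) x),
          mul_comm (partialDeriv (q.2 0) (f 0) x * _)]
    _ = _ := h1
    _ = _ := by
        congr 2
        ext x
        simp_rw [partialDeriv_mul (hf1 _ _) (hφ1 _), mul_add, Finset.sum_add_distrib]
        -- the terms with second derivatives of `f 0` are antisymmetric in the column indices
        rw [add_eq_right, Fintype.sum_prod_type]
        refine Finset.sum_eq_zero fun r _ => ?_
        refine sum_eq_zero_of_swap_antisymm _ 0 1 fun c => ?_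
        dsimp only
        rw [kroneckerSymbol_swap_right r c (by decide), Function.comp_apply, Function.comp_apply,
          Equiv.swap_apply_left, Equiv.swap_apply_right,
          partialDeriv_comm ((hf 0).of_le (by norm_num))]
        ring

end NullLagrangian

/-! ### Mollification -/

section Mollification

variable {n : ℕ} {F : Type*} [NormedAddCommGroup F] [NormedSpace ℝ F]

/-- A smooth, even mollifier with integral one, supported in the closed unit ball. -/
noncomputable def mollifier (n : ℕ) : EuclideanSpace ℝ (Fin n) → ℝ :=
  (⟨1 / 2, 1, by norm_num, by norm_num⟩ : ContDiffBump (0 : EuclideanSpace ℝ (Fin n))).normed volume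

/-- The rescaled mollifier `η_t(y) = t⁻ⁿ η(y / t)`. -/
noncomputable def mollifierAt (t : ℝ) (y : EuclideanSpace ℝ (Fin n)) : ℝ :=
  (t⁻¹) ^ n * mollifier n (t⁻¹ • y)

/-- The mollification `η_t * f`. -/
noncomputable def mollify (t : ℝ) (f : EuclideanSpace ℝ (Fin n) → F)
    (x : EuclideanSpace ℝ (Fin n)) : F :=
  ∫ y, mollifierAt t y • f (x - y)

theorem contDiff_mollifier {m : ℕ∞} : ContDiff ℝ m (mollifier n) := ContDiffBump.contDiff_normed _

theorem mollifier_eq_zero {y : EuclideanSpace ℝ (Fin n)} (hy : 1 ≤ ‖y‖) : mollifier n y = 0 := by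
  have h : y ∉ Function.support (mollifier n) := by
    rw [mollifier, ContDiffBump.support_normed_eq]
    simpa using hy
  simpa using h

theorem hasCompactSupport_mollifier : HasCompactSupport (mollifier n) :=
  ContDiffBump.hasCompactSupport_normed _

theorem mollifier_neg (y : EuclideanSpace ℝ (Fin n)) : mollifier n (-y) = mollifier n y :=
  ContDiffBump.normed_neg _ y

theorem integral_mollifier : ∫ y, mollifier n y = 1 := ContDiffBump.integral_normed _

theorem contDiff_mollifierAt (t : ℝ) {m : ℕ∞} :
    ContDiff ℝ m (mollifierAt t : EuclideanSpace ℝ (Fin n) → ℝ) :=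
  contDiff_const.mul (contDiff_mollifier.comp (contDiff_const_smul _))

theorem mollifierAt_eq_zero {t : ℝ} (ht : 0 < t) {y : EuclideanSpace ℝ (Fin n)}
    (hy : t ≤ ‖y‖) : mollifierAt t y = 0 := by
  rw [mollifierAt, mollifier_eq_zero, mul_zero]
  rw [norm_smul, Real.norm_of_nonneg (by positivity), ← div_eq_inv_mul, one_le_div ht]
  exact hy

theorem tsupport_mollifierAt_subset {t : ℝ} (ht : 0 < t) :
    tsupport (mollifierAt t : EuclideanSpace ℝ (Fin n) → ℝ) ⊆ Metric.closedBall 0 t := by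
  refine closure_minimal (fun y hy => ?_) Metric.isClosed_closedBall
  by_contra h
  exact hy (mollifierAt_eq_zero ht (by simpa using (not_le.1 (by simpa using h)).le))

theorem hasCompactSupport_mollifierAt {t : ℝ} (ht : 0 < t) :
    HasCompactSupport (mollifierAt t : EuclideanSpace ℝ (Fin n) → ℝ) :=
  (isCompact_closedBall _ _).of_isClosed_subset (isClosed_tsupport _)
    (tsupport_mollifierAt_subset ht)

theorem partialDeriv_mollifierAt_eq_zero {t : ℝ} (ht : 0 < t) {y : EuclideanSpace ℝ (Fin n)}
    (hy : t < ‖y‖) (i : Fin n) : partialDeriv i (mollifierAt t) y = 0 := by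
  have h : y ∉ tsupport (fderiv ℝ (mollifierAt t : EuclideanSpace ℝ (Fin n) → ℝ)) := fun h =>
    hy.not_ge (by simpa using tsupport_mollifierAt_subset ht (tsupport_fderiv_subset ℝ h))
  rw [partialDeriv, image_eq_zero_of_notMem_tsupport h, zero_apply]

theorem integral_mollifierAt {t : ℝ} (ht : 0 < t) :
    ∫ y : EuclideanSpace ℝ (Fin n), mollifierAt t y = 1 := by
  simp_rw [mollifierAt]
  rw [integral_const_mul, Measure.integral_comp_inv_smul_of_nonneg _ _ ht.le, integral_mollifier]
  simp [ht.ne']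

theorem exists_mollifier_bound (n : ℕ) : ∃ M : ℝ, 0 ≤ M ∧
    (∀ y, |mollifier n y| ≤ M) ∧ ∀ y, ‖fderiv ℝ (mollifier n) y‖ ≤ M := by
  obtain ⟨C, hC⟩ := (contDiff_mollifier (n := n) (m := 1)).continuous.bounded_above_of_compact_support
    hasCompactSupport_mollifier
  obtain ⟨D, hD⟩ := ((contDiff_mollifier (n := n) (m := 1)).continuous_fderiv
    (by norm_num)).bounded_above_of_compact_support (hasCompactSupport_mollifier.fderiv ℝ)
  exact ⟨max C D, (norm_nonneg _).trans ((hC 0).trans (le_max_left _ _)),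
    fun y => (hC y).trans (le_max_left _ _), fun y => (hD y).trans (le_max_right _ _)⟩

/-- A common bound for the mollifier and its gradient. -/
noncomputable def mollifierBound (n : ℕ) : ℝ := (exists_mollifier_bound n).choose

theorem mollifierBound_nonneg (n : ℕ) : 0 ≤ mollifierBound n :=
  (exists_mollifier_bound n).choose_spec.1

theorem abs_mollifier_le (y : EuclideanSpace ℝ (Fin n)) : |mollifier n y| ≤ mollifierBound n :=
  (exists_mollifier_bound n).choose_spec.2.1 y

theorem abs_mollifierAt_le {t : ℝ} (ht : 0 < t) (y : EuclideanSpace ℝ (Fin n)) :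
    |mollifierAt t y| ≤ mollifierBound n * (t⁻¹) ^ n := by
  rw [mollifierAt, abs_mul, abs_of_nonneg (by positivity), mul_comm]
  gcongr
  exact abs_mollifier_le _

theorem abs_partialDeriv_mollifierAt_le {t : ℝ} (ht : 0 < t) (i : Fin n)
    (y : EuclideanSpace ℝ (Fin n)) :
    |partialDeriv i (mollifierAt t) y| ≤ mollifierBound n * (t⁻¹) ^ n * t⁻¹ := by
  have h1 : HasFDerivAt (mollifierAt t : EuclideanSpace ℝ (Fin n) → ℝ)
      ((t⁻¹) ^ n • (fderiv ℝ (mollifier n) (t⁻¹ • y)).comp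
        (t⁻¹ • ContinuousLinearMap.id ℝ (EuclideanSpace ℝ (Fin n)))) y := by
    refine HasFDerivAt.const_mul ?_ _
    exact HasFDerivAt.comp y
      ((contDiff_mollifier (m := 1)).differentiable (by norm_num) _).hasFDerivAt
      (t⁻¹ • ContinuousLinearMap.id ℝ (EuclideanSpace ℝ (Fin n))).hasFDerivAt
  rw [partialDeriv, h1.fderiv]
  simp only [smul_apply, ContinuousLinearMap.comp_apply, ContinuousLinearMap.id_apply, map_smul,
    smul_eq_mul]
  rw [abs_mul, abs_mul, abs_of_nonneg (by positivity : 0 ≤ (t⁻¹) ^ n),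
    abs_of_nonneg (by positivity : 0 ≤ t⁻¹)]
  have h2 : |fderiv ℝ (mollifier n) (t⁻¹ • y) (EuclideanSpace.single i 1)| ≤ mollifierBound n :=
    ((fderiv ℝ (mollifier n) (t⁻¹ • y)).le_opNorm _).trans
      (by simpa [mollifierBound] using (exists_mollifier_bound n).choose_spec.2.2 _)
  calc _ ≤ (t⁻¹) ^ n * (t⁻¹ * mollifierBound n) := by gcongr
    _ = _ := by ring

theorem mollify_eq_convolution (t : ℝ) (f : EuclideanSpace ℝ (Fin n) → F) :
    mollify t f = convolution (mollifierAt t) f (ContinuousLinearMap.lsmul ℝ ℝ) volume := by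
  ext x
  rw [convolution_lsmul]
  rfl

theorem contDiff_mollify {t : ℝ} (ht : 0 < t) {f : EuclideanSpace ℝ (Fin n) → F}
    (hf : LocallyIntegrable f volume) {m : ℕ∞} : ContDiff ℝ m (mollify t f) := by
  rw [mollify_eq_convolution]
  exact (hasCompactSupport_mollifierAt ht).contDiff_convolution_left _ (contDiff_mollifierAt t) hf

theorem HasCompactSupport.mollify {t : ℝ} (ht : 0 < t) {f : EuclideanSpace ℝ (Fin n) → F}
    (hf : HasCompactSupport f) : HasCompactSupport (mollify t f) := by
  rw [mollify_eq_convolution]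
  exact (hasCompactSupport_mollifierAt ht).convolution _ hf

theorem integrable_mul_comp_sub {f : EuclideanSpace ℝ (Fin n) → F}
    (hf : LocallyIntegrable f volume) {w : EuclideanSpace ℝ (Fin n) → ℝ} (hw : Continuous w)
    (hc : HasCompactSupport w) (x : EuclideanSpace ℝ (Fin n)) :
    Integrable (fun y => w y • f (x - y)) := by
  have := hc.convolutionExists_left (ContinuousLinearMap.lsmul ℝ ℝ) hw hf (μ := volume) x
  simpa [ConvolutionExistsAt] using this

theorem partialDeriv_mollify {t : ℝ} (ht : 0 < t) {f : EuclideanSpace ℝ (Fin n) → ℝ}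
    (hf : LocallyIntegrable f volume) (i : Fin n) (x : EuclideanSpace ℝ (Fin n)) :
    partialDeriv i (mollify t f) x = ∫ y, partialDeriv i (mollifierAt t) y * f (x - y) := by
  have hη := hasCompactSupport_mollifierAt ht (n := n)
  have hη1 := contDiff_mollifierAt t (n := n) (m := 1)
  have h := hη.hasFDerivAt_convolution_right (ContinuousLinearMap.lsmul ℝ ℝ).flip hf hη1 x
  rw [partialDeriv, mollify_eq_convolution, ← convolution_flip, h.fderiv,
    convolution_precompR_apply _ hf (hη.fderiv ℝ) (hη1.continuous_fderiv (by norm_num)),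
    convolution_flip]
  rfl

theorem partialDeriv_mollify_of_contDiff (t : ℝ)
    {f : EuclideanSpace ℝ (Fin n) → ℝ} (hf : ContDiff ℝ 1 f) (hc : HasCompactSupport f)
    (i : Fin n) : partialDeriv i (mollify t f) = mollify t (partialDeriv i f) := by
  ext x
  have hη : LocallyIntegrable (mollifierAt t : EuclideanSpace ℝ (Fin n) → ℝ) volume :=
    (contDiff_mollifierAt t (m := 1)).continuous.locallyIntegrable
  have h := hc.hasFDerivAt_convolution_right (ContinuousLinearMap.lsmul ℝ ℝ) hη hf x
  rw [partialDeriv, mollify_eq_convolution, mollify_eq_convolution, h.fderiv,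
    convolution_precompR_apply _ hη (hc.fderiv ℝ) (hf.continuous_fderiv one_ne_zero)]
  rfl

theorem integral_partialDeriv_mollifierAt {t : ℝ} (ht : 0 < t) (i : Fin n) :
    ∫ y, partialDeriv i (mollifierAt t : EuclideanSpace ℝ (Fin n) → ℝ) y = 0 := by
  have h := integral_sum_partialDeriv_mul (n := n) {()} (fun _ => 1) (fun _ => i) (fun _ _ => 1)
    (fun _ => mollifierAt t) (fun _ => contDiff_const) (fun _ => contDiff_mollifierAt t (m := 1))
    (fun _ => hasCompactSupport_mollifierAt ht)
  simpa [partialDeriv] using h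

/-- Mollification in the variable `z = y / t`. -/
theorem mollify_eq_integral_smul {t : ℝ} (ht : 0 < t) (f : EuclideanSpace ℝ (Fin n) → F)
    (x : EuclideanSpace ℝ (Fin n)) :
    mollify t f x = ∫ z, mollifier n z • f (x - t • z) := by
  have h := Measure.integral_comp_inv_smul_of_nonneg (volume : Measure (EuclideanSpace ℝ (Fin n)))
    (fun z => mollifier n z • f (x - t • z)) ht.le
  simp only [smul_inv_smul₀ ht.ne', finrank_euclideanSpace, Fintype.card_fin] at h
  simp only [mollify, mollifierAt, mul_smul]
  rw [integral_smul, h, inv_pow, inv_smul_smul₀ (by positivity)]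

end Mollification

/-! ### Mean oscillation and mollification -/

section Oscillation

variable {n : ℕ} {F : Type*} [NormedAddCommGroup F]

/-- The mean oscillation `t⁻ⁿ ∫_{|y| ≤ t} |G(x - y) - G(x)| dy` of `G` at scale `t` (up to the
volume of the unit ball). -/
noncomputable def meanOscillation (t : ℝ) (G : EuclideanSpace ℝ (Fin n) → F)
    (x : EuclideanSpace ℝ (Fin n)) : ℝ :=
  (t⁻¹) ^ n * ∫ y in Metric.closedBall 0 t, ‖G (x - y) - G x‖

theorem meanOscillation_nonneg {t : ℝ} (ht : 0 < t) (G : EuclideanSpace ℝ (Fin n) → F)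
    (x : EuclideanSpace ℝ (Fin n)) : 0 ≤ meanOscillation t G x :=
  mul_nonneg (by positivity) (integral_nonneg fun _ => norm_nonneg _)

theorem integrableOn_norm_sub {G : EuclideanSpace ℝ (Fin n) → F} (hG : Continuous G)
    (x : EuclideanSpace ℝ (Fin n)) (t : ℝ) :
    IntegrableOn (fun y => ‖G (x - y) - G x‖) (Metric.closedBall 0 t) :=
  ContinuousOn.integrableOn_compact (isCompact_closedBall _ _) (by fun_prop)

theorem meanOscillation_le_of_half_le {G : EuclideanSpace ℝ (Fin n) → F} (hG : Continuous G)
    {s t : ℝ} (ht : 0 < t) (hs : t / 2 ≤ s) (hst : s ≤ t) (x : EuclideanSpace ℝ (Fin n)) :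
    meanOscillation s G x ≤ 2 ^ n * meanOscillation t G x := by
  have hs0 : 0 < s := by linarith
  have h1 : (s⁻¹) ^ n ≤ 2 ^ n * (t⁻¹) ^ n := by
    rw [← mul_pow]
    gcongr
    rw [← div_eq_mul_inv, inv_le_comm₀ hs0 (by positivity), inv_div]
    exact hs
  rw [meanOscillation, meanOscillation, ← mul_assoc]
  refine mul_le_mul h1 ?_ (integral_nonneg fun _ => norm_nonneg _) (by positivity)
  exact setIntegral_mono_set (integrableOn_norm_sub hG x t)
    (Filter.Eventually.of_forall fun _ => norm_nonneg _)
    (Metric.closedBall_subset_closedBall hst).eventuallyLE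

/-- The gradient of a mollification is controlled by the mean oscillation. The oscillation is taken of
a field `G` dominating that of `g`, so that it can be the full gradient when `g` is a component. -/
theorem abs_partialDeriv_mollify_le {t : ℝ} (ht : 0 < t) {g : EuclideanSpace ℝ (Fin n) → ℝ}
    (hg : Continuous g) {G : EuclideanSpace ℝ (Fin n) → F} (hG : Continuous G)
    (hgG : ∀ x y, |g x - g y| ≤ ‖G x - G y‖) (i : Fin n) (x : EuclideanSpace ℝ (Fin n)) :
    |partialDeriv i (mollify t g) x| ≤ mollifierBound n * t⁻¹ * meanOscillation t G x := by
  have hη : Continuous (partialDeriv i (mollifierAt t : EuclideanSpace ℝ (Fin n) → ℝ)) :=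
    ((contDiff_mollifierAt t (m := 1)).partialDeriv (m' := 0) (by norm_num) i).continuous
  have hη' := (hasCompactSupport_mollifierAt ht (n := n)).partialDeriv i
  -- the kernel has mean zero, so that `g x` may be subtracted
  have h1 : partialDeriv i (mollify t g) x =
      ∫ y, partialDeriv i (mollifierAt t) y * (g (x - y) - g x) := by
    have hi : Integrable fun y => partialDeriv i (mollifierAt t) y * g (x - y) :=
      integrable_mul_comp_sub hg.locallyIntegrable hη hη' x
    simp_rw [mul_sub]
    rw [partialDeriv_mollify ht hg.locallyIntegrable,
      integral_sub hi ((hη.integrable_of_hasCompactSupport hη').mul_const _),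
      integral_mul_const, integral_partialDeriv_mollifierAt ht, zero_mul, sub_zero]
  rw [h1, ← Real.norm_eq_abs]
  refine (norm_integral_le_of_norm_le (((integrableOn_norm_sub hG x t).integrable_indicator
    measurableSet_closedBall).const_mul (mollifierBound n * (t⁻¹) ^ n * t⁻¹))
    (Filter.Eventually.of_forall fun y => ?_)).trans_eq ?_
  · by_cases hy : y ∈ Metric.closedBall (0 : EuclideanSpace ℝ (Fin n)) t
    · rw [Set.indicator_of_mem hy, norm_mul]
      gcongr
      · have := mollifierBound_nonneg n
        positivity
      · exact abs_partialDeriv_mollifierAt_le ht i y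
      · exact hgG _ _
    · rw [partialDeriv_mollifierAt_eq_zero ht (by simpa using hy)]
      simp [Set.indicator_of_notMem hy]
  · rw [integral_const_mul, integral_indicator measurableSet_closedBall, meanOscillation]
    ring

theorem hasDerivAt_mollify {f : EuclideanSpace ℝ (Fin n) → ℝ} (hf : ContDiff ℝ 1 f)
    (x : EuclideanSpace ℝ (Fin n)) (s : ℝ) :
    HasDerivAt (fun s => ∫ z, mollifier n z • f (x - s • z))
      (∫ z, mollifier n z • fderiv ℝ f (x - s • z) (-z)) s := by
  have hc : Continuous (fun q : ℝ × EuclideanSpace ℝ (Fin n) =>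
      mollifier n q.2 • fderiv ℝ f (x - q.1 • q.2) (-q.2)) := by
    have h1 := hf.continuous_fderiv one_ne_zero
    have h2 := (contDiff_mollifier (n := n) (m := 1)).continuous
    exact (h2.comp continuous_snd).smul ((h1.comp (by fun_prop)).clm_apply (by fun_prop))
  have hK : IsCompact (Metric.closedBall s 1 ×ˢ
      Metric.closedBall (0 : EuclideanSpace ℝ (Fin n)) 1) :=
    (isCompact_closedBall _ _).prod (isCompact_closedBall _ _)
  obtain ⟨C, hC⟩ := hK.exists_bound_of_continuousOn hc.continuousOn
  have hη := (contDiff_mollifier (n := n) (m := 1)).continuous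
  have hf0 := hf.continuous
  refine (hasDerivAt_integral_of_dominated_loc_of_deriv_le
    (F := fun s z => mollifier n z • f (x - s • z))
    (F' := fun s z => mollifier n z • fderiv ℝ f (x - s • z) (-z))
    (bound := (Metric.closedBall (0 : EuclideanSpace ℝ (Fin n)) 1).indicator fun _ => C)
    (Metric.closedBall_mem_nhds s one_pos) ?_ ?_ ?_ ?_ ?_ ?_).2
  · exact Filter.Eventually.of_forall fun s =>
      (Continuous.aestronglyMeasurable (by fun_prop))
  · exact Continuous.integrable_of_hasCompactSupport (by fun_prop)
      hasCompactSupport_mollifier.smul_right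
  · exact (hc.comp (Continuous.prodMk_right s)).aestronglyMeasurable
  · refine Filter.Eventually.of_forall fun z s' hs' => ?_
    by_cases hz : z ∈ Metric.closedBall (0 : EuclideanSpace ℝ (Fin n)) 1
    · rw [Set.indicator_of_mem hz]
      exact hC (s', z) ⟨hs', hz⟩
    · rw [mollifier_eq_zero (by simpa using (not_le.1 (by simpa using hz)).le), zero_smul, norm_zero]
      simp [Set.indicator_of_notMem hz]
  · exact (integrable_indicator_iff measurableSet_closedBall).2
      (integrableOn_const (isCompact_closedBall _ _).measure_lt_top.ne)
  · refine Filter.Eventually.of_forall fun z s' _ => ?_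
    refine HasDerivAt.const_smul (mollifier n z) (f := fun s => f (x - s • z)) ?_
    have h1 : HasDerivAt (fun s : ℝ => x - s • z) (-z) s' := by
      simpa using ((hasDerivAt_id s').smul_const z).const_sub x
    exact (hf.differentiable one_ne_zero _).hasFDerivAt.comp_hasDerivAt s' h1

/-- The mollifier being even, the derivative of `t ↦ η_t * f` is controlled by the oscillation of
the gradient of `f`. -/
theorem abs_deriv_mollify_le {f : EuclideanSpace ℝ (Fin n) → ℝ} (hf : ContDiff ℝ 1 f)
    (x : EuclideanSpace ℝ (Fin n)) {s : ℝ} (hs : 0 < s) :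
    |∫ z, mollifier n z • fderiv ℝ f (x - s • z) (-z)| ≤
      mollifierBound n * meanOscillation s (fderiv ℝ f) x := by
  have hη := (contDiff_mollifier (n := n) (m := 1)).continuous
  have hf' := hf.continuous_fderiv one_ne_zero
  -- the integrand is odd, so that `Df(x)` may be subtracted from `Df(x - s z)` below
  have hodd : ∫ z, mollifier n z • fderiv ℝ f x (-z) = 0 := by
    have h := integral_neg_eq_self (fun z => mollifier n z • fderiv ℝ f x (-z)) volume
    simp only [mollifier_neg, neg_neg] at h
    simp only [map_neg, smul_neg, integral_neg] at h ⊢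
    linarith
  have hi1 : Integrable (fun z => mollifier n z • fderiv ℝ f (x - s • z) (-z)) :=
    Continuous.integrable_of_hasCompactSupport
      (hη.smul ((hf'.comp (by fun_prop)).clm_apply (by fun_prop)))
      hasCompactSupport_mollifier.smul_right
  have hi2 : Integrable (fun z => mollifier n z • fderiv ℝ f x (-z)) :=
    Continuous.integrable_of_hasCompactSupport (by fun_prop)
      hasCompactSupport_mollifier.smul_right
  have h1 : ∫ z, mollifier n z • fderiv ℝ f (x - s • z) (-z) =
      ∫ z, mollifier n z • (fderiv ℝ f (x - s • z) - fderiv ℝ f x) (-z) := by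
    simp_rw [sub_apply, smul_sub]
    rw [integral_sub hi1 hi2, hodd, sub_zero]
  have h2 : IntegrableOn (fun z => ‖fderiv ℝ f (x - s • z) - fderiv ℝ f x‖)
      (Metric.closedBall 0 1) :=
    ContinuousOn.integrableOn_compact (isCompact_closedBall _ _)
      ((hf'.comp (by fun_prop)).sub continuous_const).norm.continuousOn
  rw [h1, ← Real.norm_eq_abs]
  refine (norm_integral_le_of_norm_le ((h2.integrable_indicator
    measurableSet_closedBall).const_mul (mollifierBound n))
    (Filter.Eventually.of_forall fun y => ?_)).trans_eq ?_
  · by_cases hy : y ∈ Metric.closedBall (0 : EuclideanSpace ℝ (Fin n)) 1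
    · have hy' : ‖y‖ ≤ 1 := by simpa using hy
      rw [Set.indicator_of_mem hy, norm_smul]
      refine mul_le_mul (abs_mollifier_le y) ?_ (norm_nonneg _) (mollifierBound_nonneg n)
      refine (ContinuousLinearMap.le_opNorm _ _).trans ?_
      rw [norm_neg]
      exact mul_le_of_le_one_right (norm_nonneg _) hy'
    · rw [mollifier_eq_zero (by simpa using (not_le.1 (by simpa using hy)).le)]
      simp [Set.indicator_of_notMem hy]
  · rw [integral_const_mul, integral_indicator measurableSet_closedBall, meanOscillation,
      Measure.setIntegral_comp_smul_of_pos volume (fun y => ‖fderiv ℝ f (x - y) - fderiv ℝ f x‖) _ hs]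
    simp [smul_closedBall, abs_of_pos hs]

/-- Consecutive dyadic mollifications differ by the scale times the oscillation of the gradient. -/
theorem abs_mollify_sub_mollify_half_le {f : EuclideanSpace ℝ (Fin n) → ℝ} (hf : ContDiff ℝ 1 f)
    (x : EuclideanSpace ℝ (Fin n)) {t : ℝ} (ht : 0 < t) :
    |mollify (t / 2) f x - mollify t f x| ≤
      mollifierBound n * 2 ^ n * t * meanOscillation t (fderiv ℝ f) x := by
  have hf' := hf.continuous_fderiv one_ne_zero
  have hM := mollifierBound_nonneg n
  have hO := meanOscillation_nonneg ht (fderiv ℝ f) x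
  rw [mollify_eq_integral_smul ht, mollify_eq_integral_smul (half_pos ht), ← Real.norm_eq_abs]
  refine ((convex_Icc (t / 2) t).norm_image_sub_le_of_norm_hasDerivWithin_le
    (C := mollifierBound n * (2 ^ n * meanOscillation t (fderiv ℝ f) x))
    (fun s _ => (hasDerivAt_mollify hf x s).hasDerivWithinAt) (fun s hs => ?_)
    (Set.right_mem_Icc.2 (by linarith)) (Set.left_mem_Icc.2 (by linarith))).trans ?_
  · refine (abs_deriv_mollify_le hf x (by linarith [hs.1])).trans ?_
    gcongr
    exact meanOscillation_le_of_half_le hf' ht hs.1 hs.2 x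
  · have h1 : ‖t / 2 - t‖ ≤ t := by
      rw [Real.norm_eq_abs, abs_le]
      constructor <;> linarith
    calc _ ≤ mollifierBound n * (2 ^ n * meanOscillation t (fderiv ℝ f) x) * t := by gcongr
      _ = _ := by ring

end Oscillation

/-! ### Power integrals of means and oscillations -/

section PowerMeans

/-- Jensen's inequality for natural powers and a not necessarily normalized measure. -/
theorem pow_setLIntegral_le {α : Type*} [MeasurableSpace α] {μ : Measure α} {s : Set α}
    {F : α → ℝ≥0∞} (hF : AEMeasurable F (μ.restrict s)) {k : ℕ} (hk : 2 ≤ k) :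
    (∫⁻ x in s, F x ∂μ) ^ k ≤ μ s ^ (k - 1) * ∫⁻ x in s, F x ^ k ∂μ := by
  have hk1 : (1 : ℝ) < k := by exact_mod_cast hk
  have hk0 : (0 : ℝ) < k := by linarith
  have hpq := Real.HolderConjugate.conjExponent hk1
  have h := ENNReal.lintegral_mul_le_Lp_mul_Lq (μ.restrict s) hpq hF
    (aemeasurable_const (b := (1 : ℝ≥0∞)))
  simp only [Pi.mul_apply, mul_one, ENNReal.one_rpow, lintegral_const, one_mul,
    Measure.restrict_apply MeasurableSet.univ, Set.univ_inter, ENNReal.rpow_natCast] at h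
  calc (∫⁻ x in s, F x ∂μ) ^ k
      ≤ ((∫⁻ x in s, F x ^ k ∂μ) ^ (1 / (k : ℝ)) * μ s ^ (1 / Real.conjExponent k)) ^ k := by
        gcongr
    _ = μ s ^ (k - 1) * ∫⁻ x in s, F x ^ k ∂μ := by
        rw [mul_pow, ← ENNReal.rpow_natCast, ← ENNReal.rpow_mul, one_div_mul_cancel hk0.ne',
          ENNReal.rpow_one, mul_comm]
        congr 1
        rw [← ENNReal.rpow_natCast, ← ENNReal.rpow_mul, ← ENNReal.rpow_natCast]
        congr 1
        rw [Real.conjExponent, Nat.cast_sub (by omega), Nat.cast_one]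
        field_simp

theorem prod_le_sum_pow {k : ℕ} (hk : 1 ≤ k) (p : Fin k → ℝ≥0∞) :
    ∏ m, p m ≤ ∑ m, p m ^ k := by
  have : Nonempty (Fin k) := ⟨⟨0, hk⟩⟩
  obtain ⟨a, ha⟩ := Finite.exists_max p
  calc ∏ m, p m ≤ ∏ _m : Fin k, p a := Finset.prod_le_prod' fun m _ => ha m
    _ = p a ^ k := by simp
    _ ≤ ∑ m, p m ^ k :=
        Finset.single_le_sum (f := fun m => p m ^ k) (fun m _ => zero_le) (Finset.mem_univ a)

variable {n : ℕ} {F : Type*} [NormedAddCommGroup F]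

/-- The volume of the unit ball of `ℝⁿ`. -/
noncomputable def unitBallVolume (n : ℕ) : ℝ≥0∞ :=
  volume (Metric.closedBall (0 : EuclideanSpace ℝ (Fin n)) 1)

theorem unitBallVolume_ne_top (n : ℕ) : unitBallVolume n ≠ ∞ :=
  (isCompact_closedBall _ _).measure_lt_top.ne

theorem volume_closedBall_eq {t : ℝ} (ht : 0 < t) :
    volume (Metric.closedBall (0 : EuclideanSpace ℝ (Fin n)) t) =
      ENNReal.ofReal t ^ n * unitBallVolume n := by
  have h := Measure.addHaar_closedBall_mul (volume : Measure (EuclideanSpace ℝ (Fin n))) 0 ht.le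
    zero_le_one
  rw [mul_one] at h
  rw [h, finrank_euclideanSpace, Fintype.card_fin, ENNReal.ofReal_pow ht.le, unitBallVolume]

theorem ofReal_inv_mul_ofReal_pow {t : ℝ} (ht : 0 < t) (m : ℕ) :
    ENNReal.ofReal t⁻¹ ^ m * ENNReal.ofReal t ^ m = 1 := by
  rw [← mul_pow, ← ENNReal.ofReal_mul (by positivity), inv_mul_cancel₀ ht.ne', ENNReal.ofReal_one,
    one_pow]

/-- Jensen's inequality for means over the ball of radius `t`. -/
theorem pow_mean_le {t : ℝ} (ht : 0 < t) {k : ℕ} (hk : 2 ≤ k)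
    {H : EuclideanSpace ℝ (Fin n) → ℝ≥0∞} (hH : Measurable H) :
    (ENNReal.ofReal t⁻¹ ^ n * ∫⁻ y in Metric.closedBall 0 t, H y) ^ k ≤
      unitBallVolume n ^ (k - 1) *
        (ENNReal.ofReal t⁻¹ ^ n * ∫⁻ y in Metric.closedBall 0 t, H y ^ k) := by
  obtain ⟨l, rfl⟩ : ∃ l, k = l + 1 := ⟨k - 1, by omega⟩
  rw [mul_pow, Nat.add_sub_cancel]
  calc _ ≤ (ENNReal.ofReal t⁻¹ ^ n) ^ (l + 1) *
        ((ENNReal.ofReal t ^ n * unitBallVolume n) ^ l *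
          ∫⁻ y in Metric.closedBall 0 t, H y ^ (l + 1)) := by
        gcongr
        have := pow_setLIntegral_le (μ := volume) (s := Metric.closedBall 0 t) hH.aemeasurable hk
        rwa [volume_closedBall_eq ht] at this
    _ = (ENNReal.ofReal t⁻¹ ^ n * ENNReal.ofReal t ^ n) ^ l * (unitBallVolume n ^ l *
        (ENNReal.ofReal t⁻¹ ^ n * ∫⁻ y in Metric.closedBall 0 t, H y ^ (l + 1))) := by ring
    _ = _ := by rw [ofReal_inv_mul_ofReal_pow ht, one_pow, one_mul]

theorem ofReal_meanOscillation {t : ℝ} (ht : 0 < t) {G : EuclideanSpace ℝ (Fin n) → F}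
    (hG : Continuous G) (x : EuclideanSpace ℝ (Fin n)) :
    ENNReal.ofReal (meanOscillation t G x) =
      ENNReal.ofReal t⁻¹ ^ n * ∫⁻ y in Metric.closedBall 0 t, ‖G (x - y) - G x‖ₑ := by
  have h : IntegrableOn (fun y => G (x - y) - G x) (Metric.closedBall 0 t) :=
    ContinuousOn.integrableOn_compact (isCompact_closedBall _ _) (by fun_prop)
  rw [meanOscillation, ENNReal.ofReal_mul (by positivity), ENNReal.ofReal_pow (by positivity),
    ofReal_integral_norm_eq_lintegral_enorm h]

/-- The integral `∬ |G(x - y) - G(x)|^k / |y|^e dx dy`. -/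
noncomputable def gagliardoIntegral (k e : ℕ) (G : EuclideanSpace ℝ (Fin n) → F) : ℝ≥0∞ :=
  ∫⁻ x, ∫⁻ y, ‖G (x - y) - G x‖ₑ ^ k / ‖y‖ₑ ^ e

/-- A dyadic sum of `t⁻ᵉ` over the scales `t ≥ r` is comparable to its last term. -/
theorem sum_dyadic_le {e : ℕ} (he : 1 ≤ e) {r : ℝ} (hr : 0 < r) (J : ℕ) :
    ∑ j ∈ Finset.range J, (if r ≤ (1 / 2 : ℝ) ^ j then (((1 / 2 : ℝ) ^ j)⁻¹) ^ e else 0) ≤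
      2 * (r⁻¹) ^ e := by
  have h1 : ∀ J, ∑ j ∈ Finset.range J,
      (if r ≤ (1 / 2 : ℝ) ^ j then (((1 / 2 : ℝ) ^ j)⁻¹) ^ e else 0) ≤
        (((1 / 2 : ℝ) ^ J)⁻¹) ^ e := by
    intro J
    induction J with
    | zero => simp
    | succ J ih =>
      rw [Finset.sum_range_succ]
      have h2 : (((1 / 2 : ℝ) ^ (J + 1))⁻¹) ^ e = 2 ^ e * (((1 / 2 : ℝ) ^ J)⁻¹) ^ e := by
        rw [← mul_pow, pow_succ, mul_inv]
        norm_num [mul_comm]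
      have h3 : (2 : ℝ) ≤ 2 ^ e := le_self_pow₀ (by norm_num) (by omega)
      have h4 : (0 : ℝ) ≤ (((1 / 2 : ℝ) ^ J)⁻¹) ^ e := by positivity
      have h5 : (if r ≤ (1 / 2 : ℝ) ^ J then (((1 / 2 : ℝ) ^ J)⁻¹) ^ e else 0) ≤
          (((1 / 2 : ℝ) ^ J)⁻¹) ^ e := by split_ifs <;> simp
      rw [h2]
      nlinarith
  induction J with
  | zero => simp; positivity
  | succ J ih =>
    rw [Finset.sum_range_succ]
    split_ifs with h
    · have h6 : (((1 / 2 : ℝ) ^ J)⁻¹) ^ e ≤ (r⁻¹) ^ e := by gcongr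
      linarith [h1 J]
    · simpa using ih

theorem sum_dyadic_indicator_le {e : ℕ} (he : 1 ≤ e) (y : EuclideanSpace ℝ (Fin n)) (J : ℕ)
    (c : ℝ≥0∞) :
    ∑ j ∈ Finset.range J, ENNReal.ofReal ((1 / 2 : ℝ) ^ j)⁻¹ ^ e *
      (Metric.closedBall (0 : EuclideanSpace ℝ (Fin n)) ((1 / 2 : ℝ) ^ j)).indicator (fun _ => c) y ≤
      2 * (c / ‖y‖ₑ ^ e) := by
  rcases eq_or_ne c 0 with rfl | hc
  · simp
  rcases eq_or_ne y 0 with rfl | hy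
  · rw [enorm_zero, zero_pow (by omega), ENNReal.div_zero hc]
    simp
  have hy' : 0 < ‖y‖ := norm_pos_iff.2 hy
  have h1 : ∀ j, ENNReal.ofReal ((1 / 2 : ℝ) ^ j)⁻¹ ^ e *
      (Metric.closedBall (0 : EuclideanSpace ℝ (Fin n)) ((1 / 2 : ℝ) ^ j)).indicator
        (fun _ => c) y =
      ENNReal.ofReal (if ‖y‖ ≤ (1 / 2 : ℝ) ^ j then (((1 / 2 : ℝ) ^ j)⁻¹) ^ e else 0) * c := by
    intro j
    by_cases h : ‖y‖ ≤ (1 / 2 : ℝ) ^ j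
    · rw [Set.indicator_of_mem (by simpa using h), if_pos h, ENNReal.ofReal_pow (by positivity)]
    · rw [Set.indicator_of_notMem (by simpa using h), if_neg h]
      simp
  simp_rw [h1]
  rw [← Finset.sum_mul, ← ENNReal.ofReal_sum_of_nonneg (fun j _ => by split_ifs <;> positivity)]
  calc _ ≤ ENNReal.ofReal (2 * (‖y‖⁻¹) ^ e) * c := by
        gcongr
        exact sum_dyadic_le he hy' J
    _ = 2 * (c / ‖y‖ₑ ^ e) := by
        rw [ENNReal.ofReal_mul (by norm_num), ENNReal.ofReal_pow (by positivity),
          ENNReal.ofReal_inv_of_pos hy', ofReal_norm, ← ENNReal.inv_pow, div_eq_mul_inv]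
        simp only [ENNReal.ofReal_ofNat]
        ring

theorem lintegral_meanOscillation_pow_le {k : ℕ} (hk : 2 ≤ k)
    {G : EuclideanSpace ℝ (Fin n) → F} (hG : Continuous G) {t : ℝ} (ht : 0 < t) :
    ENNReal.ofReal t⁻¹ ^ (k - 2) * ∫⁻ x, ENNReal.ofReal (meanOscillation t G x) ^ k ≤
      unitBallVolume n ^ (k - 1) * ∫⁻ x, ∫⁻ y, ENNReal.ofReal t⁻¹ ^ (n + (k - 2)) *
        (Metric.closedBall (0 : EuclideanSpace ℝ (Fin n)) t).indicator
          (fun _ => ‖G (x - y) - G x‖ₑ ^ k) y := by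
  have hm : ∀ x, Measurable fun y => ‖G (x - y) - G x‖ₑ := fun x =>
    Continuous.measurable (by fun_prop)
  have h1 : ∀ x, ENNReal.ofReal (meanOscillation t G x) ^ k ≤
      unitBallVolume n ^ (k - 1) * (ENNReal.ofReal t⁻¹ ^ n * ∫⁻ y,
      (Metric.closedBall (0 : EuclideanSpace ℝ (Fin n)) t).indicator
        (fun _ => ‖G (x - y) - G x‖ₑ ^ k) y) := by
    intro x
    rw [ofReal_meanOscillation ht hG]
    refine (pow_mean_le ht hk (hm x)).trans_eq ?_
    rw [← lintegral_indicator measurableSet_closedBall]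
    rfl
  have h2 := lintegral_mono h1 (μ := volume)
  rw [lintegral_const_mul' _ _ (by finiteness [unitBallVolume_ne_top n]),
    lintegral_const_mul' _ _ (by finiteness)] at h2
  simp_rw [lintegral_const_mul' (ENNReal.ofReal t⁻¹ ^ (n + (k - 2))) _
    (ENNReal.pow_ne_top ENNReal.ofReal_ne_top)]
  refine (mul_le_mul_right h2 _).trans_eq ?_
  rw [pow_add]
  ac_rfl

/-- The Besov seminorm of `G` controls the dyadic sum of the oscillations of `G`. -/
theorem sum_lintegral_meanOscillation_le {k : ℕ} (hk : 2 ≤ k) (hn : 1 ≤ n)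
    {G : EuclideanSpace ℝ (Fin n) → F}
    (hG : Continuous G) (J : ℕ) :
    ∑ j ∈ Finset.range J, ENNReal.ofReal ((1 / 2 : ℝ) ^ j)⁻¹ ^ (k - 2) *
      ∫⁻ x, ENNReal.ofReal (meanOscillation ((1 / 2 : ℝ) ^ j) G x) ^ k ≤
      unitBallVolume n ^ (k - 1) * (2 * gagliardoIntegral k (n + (k - 2)) G) := by
  have hm2 : Measurable fun q : EuclideanSpace ℝ (Fin n) × EuclideanSpace ℝ (Fin n) =>
      ‖G (q.1 - q.2) - G q.1‖ₑ ^ k := Continuous.measurable (by fun_prop)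
  have hm3 : ∀ t : ℝ, Measurable fun q : EuclideanSpace ℝ (Fin n) × EuclideanSpace ℝ (Fin n) =>
      (Metric.closedBall (0 : EuclideanSpace ℝ (Fin n)) t).indicator
        (fun _ => ‖G (q.1 - q.2) - G q.1‖ₑ ^ k) q.2 := fun t => by
    have : (fun q : EuclideanSpace ℝ (Fin n) × EuclideanSpace ℝ (Fin n) =>
        (Metric.closedBall (0 : EuclideanSpace ℝ (Fin n)) t).indicator
        (fun _ => ‖G (q.1 - q.2) - G q.1‖ₑ ^ k) q.2) =
        (Prod.snd ⁻¹' Metric.closedBall (0 : EuclideanSpace ℝ (Fin n)) t).indicator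
          fun q => ‖G (q.1 - q.2) - G q.1‖ₑ ^ k := by
      ext q
      simp [Set.indicator]
    rw [this]
    exact hm2.indicator (measurable_snd measurableSet_closedBall)
  have hm4 : ∀ (t : ℝ) (x), Measurable fun y =>
      (Metric.closedBall (0 : EuclideanSpace ℝ (Fin n)) t).indicator
        (fun _ => ‖G (x - y) - G x‖ₑ ^ k) y := fun t x =>
    Measurable.indicator (f := fun y => ‖G (x - y) - G x‖ₑ ^ k)
      (Continuous.measurable (by fun_prop)) measurableSet_closedBall
  have hj := fun j : ℕ => lintegral_meanOscillation_pow_le hk hG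
    (pow_pos one_half_pos j : (0 : ℝ) < (1 / 2 : ℝ) ^ j)
  have h1 : ∀ x, ∑ j ∈ Finset.range J, ∫⁻ y, ENNReal.ofReal ((1 / 2 : ℝ) ^ j)⁻¹ ^ (n + (k - 2)) *
      (Metric.closedBall (0 : EuclideanSpace ℝ (Fin n)) ((1 / 2 : ℝ) ^ j)).indicator
        (fun _ => ‖G (x - y) - G x‖ₑ ^ k) y ≤
      2 * ∫⁻ y, ‖G (x - y) - G x‖ₑ ^ k / ‖y‖ₑ ^ (n + (k - 2)) := by
    intro x
    rw [← lintegral_finsetSum _ fun j _ => (hm4 _ x).const_mul _,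
      ← lintegral_const_mul' _ _ ENNReal.ofNat_ne_top]
    exact lintegral_mono fun y => sum_dyadic_indicator_le (by omega) y J _
  have h2 := lintegral_mono h1 (μ := volume)
  rw [lintegral_finsetSum _ fun j _ => ((hm3 _).const_mul _).lintegral_prod_right',
    lintegral_const_mul' _ _ ENNReal.ofNat_ne_top] at h2
  refine (Finset.sum_le_sum fun j _ => hj j).trans ?_
  rw [← Finset.mul_sum]
  exact mul_le_mul_right h2 _

/-- The mean `t⁻ⁿ ∫_{|y| ≤ t} |G(x - y)| dy` (up to the volume of the unit ball). -/
noncomputable def localMean (t : ℝ) (G : EuclideanSpace ℝ (Fin n) → F)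
    (x : EuclideanSpace ℝ (Fin n)) : ℝ≥0∞ :=
  ENNReal.ofReal t⁻¹ ^ n * ∫⁻ y in Metric.closedBall 0 t, ‖G (x - y)‖ₑ

/-- Local means are bounded on `L^k`, uniformly in the scale. -/
theorem lintegral_localMean_pow_le {t : ℝ} (ht : 0 < t) {k : ℕ} (hk : 2 ≤ k)
    {G : EuclideanSpace ℝ (Fin n) → F} (hG : StronglyMeasurable G) :
    ∫⁻ x, localMean t G x ^ k ≤ unitBallVolume n ^ k * ∫⁻ x, ‖G x‖ₑ ^ k := by
  have hm := hG.enorm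
  calc ∫⁻ x, localMean t G x ^ k
      ≤ ∫⁻ x, unitBallVolume n ^ (k - 1) * (ENNReal.ofReal t⁻¹ ^ n *
          ∫⁻ y in Metric.closedBall 0 t, ‖G (x - y)‖ₑ ^ k) := by
        gcongr with x
        exact pow_mean_le ht hk (hm.comp (measurable_const.sub measurable_id))
    _ = unitBallVolume n ^ (k - 1) * (ENNReal.ofReal t⁻¹ ^ n *
          ∫⁻ y in Metric.closedBall 0 t, ∫⁻ x, ‖G (x - y)‖ₑ ^ k) := by
        rw [lintegral_const_mul' _ _ (by finiteness [unitBallVolume_ne_top n]),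
            lintegral_const_mul' _ _ (by finiteness), lintegral_lintegral_swap]
        exact ((hm.comp (measurable_fst.sub measurable_snd)).pow_const k).aemeasurable
    _ = unitBallVolume n ^ (k - 1) * ((ENNReal.ofReal t⁻¹ ^ n * ENNReal.ofReal t ^ n) *
          unitBallVolume n * ∫⁻ x, ‖G x‖ₑ ^ k) := by
        simp_rw [lintegral_sub_right_eq_self (fun x => ‖G x‖ₑ ^ k)]
        rw [setLIntegral_const, volume_closedBall_eq ht]
        ring
    _ = _ := by
        obtain ⟨l, rfl⟩ : ∃ l, k = l + 1 := ⟨k - 1, by omega⟩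
        rw [ofReal_inv_mul_ofReal_pow ht, Nat.add_sub_cancel]
        ring

theorem measurable_localMean (t : ℝ) {G : EuclideanSpace ℝ (Fin n) → F}
    (hG : StronglyMeasurable G) : Measurable (localMean t G) :=
  (Measurable.lintegral_prod_right'
    (hG.enorm.comp (measurable_fst.sub measurable_snd))).const_mul _

theorem measurable_ofReal_meanOscillation {t : ℝ} (ht : 0 < t)
    {G : EuclideanSpace ℝ (Fin n) → F} (hG : Continuous G) :
    Measurable fun x => ENNReal.ofReal (meanOscillation t G x) := by
  simp_rw [ofReal_meanOscillation ht hG]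
  refine (Measurable.lintegral_prod_right' (f := fun q : EuclideanSpace ℝ (Fin n) ×
    EuclideanSpace ℝ (Fin n) => ‖G (q.1 - q.2) - G q.1‖ₑ) ?_).const_mul _
  exact Continuous.measurable (by fun_prop)

theorem enorm_mollify_le_localMean {t : ℝ} (ht : 0 < t) [NormedSpace ℝ F]
    (G : EuclideanSpace ℝ (Fin n) → F) (x : EuclideanSpace ℝ (Fin n)) :
    ‖mollify t G x‖ₑ ≤ ENNReal.ofReal (mollifierBound n) * localMean t G x := by
  have hM := mollifierBound_nonneg n
  rw [localMean, ← mul_assoc, ← ENNReal.ofReal_pow (by positivity), ← ENNReal.ofReal_mul hM,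
    ← lintegral_const_mul' _ _ (by finiteness), ← lintegral_indicator measurableSet_closedBall]
  refine (enorm_integral_le_lintegral_enorm _).trans (lintegral_mono fun y => ?_)
  by_cases hy : y ∈ Metric.closedBall (0 : EuclideanSpace ℝ (Fin n)) t
  · rw [Set.indicator_of_mem hy, enorm_smul]
    gcongr
    rw [← ofReal_norm]
    exact ENNReal.ofReal_le_ofReal (abs_mollifierAt_le ht y)
  · rw [mollifierAt_eq_zero ht (not_le.1 (by simpa using hy)).le]
    simp

theorem enorm_partialDeriv_mollify_le_localMean {t : ℝ} (ht : 0 < t)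
    {g : EuclideanSpace ℝ (Fin n) → ℝ} (hg : LocallyIntegrable g volume) (i : Fin n)
    (x : EuclideanSpace ℝ (Fin n)) :
    ‖partialDeriv i (mollify t g) x‖ₑ ≤
      ENNReal.ofReal (mollifierBound n * t⁻¹) * localMean t g x := by
  have hM := mollifierBound_nonneg n
  rw [localMean, ← mul_assoc, ← ENNReal.ofReal_pow (by positivity),
    ← ENNReal.ofReal_mul (by positivity), mul_right_comm, partialDeriv_mollify ht hg,
    ← lintegral_const_mul' _ _ (by finiteness), ← lintegral_indicator measurableSet_closedBall]
  refine (enorm_integral_le_lintegral_enorm _).trans (lintegral_mono fun y => ?_)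
  by_cases hy : y ∈ Metric.closedBall (0 : EuclideanSpace ℝ (Fin n)) t
  · rw [Set.indicator_of_mem hy, enorm_mul]
    gcongr
    rw [← ofReal_norm]
    exact ENNReal.ofReal_le_ofReal (abs_partialDeriv_mollifierAt_le ht i y)
  · rw [partialDeriv_mollifierAt_eq_zero ht (by simpa using hy)]
    simp

theorem localMean_mono {F' : Type*} [NormedAddCommGroup F'] (t : ℝ)
    {g : EuclideanSpace ℝ (Fin n) → F} {G : EuclideanSpace ℝ (Fin n) → F'}
    (h : ∀ x, ‖g x‖ ≤ ‖G x‖) (x : EuclideanSpace ℝ (Fin n)) :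
    localMean t g x ≤ localMean t G x := by
  unfold localMean
  gcongr with y
  exact enorm_le_iff_norm_le.2 (h _)

end PowerMeans

/-! ### The `k`-Hessian as a multilinear form -/

section HessianForm

variable {n k : ℕ}

theorem CcSpace.contDiff_two (f : CcSpace n 2) : ContDiff ℝ 2 f := f.contDiff

theorem norm_iteratedFDeriv_le_hessianSupNorm (φ : CcSpace n 2) (x : EuclideanSpace ℝ (Fin n)) :
    ‖iteratedFDeriv ℝ 2 φ x‖ ≤ hessianSupNorm φ := by
  have hc : Continuous (iteratedFDeriv ℝ 2 φ) :=
    φ.contDiff_two.continuous_iteratedFDeriv (by norm_num)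
  have hb : eLpNorm (iteratedFDeriv ℝ 2 φ) ∞ volume ≠ ∞ :=
    (hc.memLp_top_of_hasCompactSupport (φ.hasCompactSupport.iteratedFDeriv 2) volume).2.ne
  have hae : ∀ᵐ x, ‖iteratedFDeriv ℝ 2 φ x‖ ≤ hessianSupNorm φ := by
    have h := ae_le_eLpNormEssSup (f := iteratedFDeriv ℝ 2 φ)
      (μ := (volume : Measure (EuclideanSpace ℝ (Fin n))))
    filter_upwards [h] with x hx
    rw [← eLpNorm_exponent_top] at hx
    rw [hessianSupNorm, ← toReal_enorm]
    exact ENNReal.toReal_mono hb hx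
  have hd : Dense {x | ‖iteratedFDeriv ℝ 2 φ x‖ ≤ hessianSupNorm φ} := Measure.dense_of_ae hae
  have hcl : IsClosed {x | ‖iteratedFDeriv ℝ 2 φ x‖ ≤ hessianSupNorm φ} :=
    isClosed_le hc.norm continuous_const
  have := hd.closure_eq
  rw [hcl.closure_eq] at this
  exact (Set.eq_univ_iff_forall.1 this) x

theorem hessianSupNorm_nonneg (φ : EuclideanSpace ℝ (Fin n) → ℝ) : 0 ≤ hessianSupNorm φ :=
  ENNReal.toReal_nonneg

theorem abs_partialDeriv_partialDeriv_le (φ : CcSpace n 2) (i j : Fin n)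
    (x : EuclideanSpace ℝ (Fin n)) :
    |partialDeriv i (partialDeriv j φ) x| ≤ hessianSupNorm φ := by
  rw [← hessianMatrix_apply_eq_partialDeriv φ.contDiff_two, hessianMatrix, Matrix.of_apply,
    ← Real.norm_eq_abs]
  refine (ContinuousMultilinearMap.le_opNorm _ _).trans ?_
  simpa [Fin.prod_univ_two] using norm_iteratedFDeriv_le_hessianSupNorm φ x

/-- The Hessian at a point, as a linear map. -/
noncomputable def hessianLinearMap (x : EuclideanSpace ℝ (Fin n)) :
    CcSpace n 2 →ₗ[ℝ] Matrix (Fin n) (Fin n) ℝ where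
  toFun f := Matrix.of fun i j => partialDeriv i (partialDeriv j f) x
  map_add' f g := by
    ext i j
    have h1 : ∀ h : CcSpace n 2, DifferentiableAt ℝ (partialDeriv j h) x := fun h =>
      (h.contDiff_two.partialDeriv (m' := 1) (by norm_num) j).differentiable one_ne_zero x
    have h2 : partialDeriv j ⇑(f + g) = partialDeriv j f + partialDeriv j g := by
      ext y
      simp only [partialDeriv, Pi.add_apply]
      rw [FunLike.coe_add, fderiv_add (f.contDiff_two.differentiable two_ne_zero y)
        (g.contDiff_two.differentiable two_ne_zero y)]
      rfl
    simp only [Matrix.of_apply, Matrix.add_apply]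
    rw [h2]
    simp only [partialDeriv] at h1 ⊢
    rw [fderiv_add (h1 f) (h1 g)]
    rfl
  map_smul' c f := by
    ext i j
    have h2 : partialDeriv j ⇑(c • f) = c • partialDeriv j f := by
      ext y
      simp only [partialDeriv, Pi.smul_apply]
      rw [FunLike.coe_smul, fderiv_const_smul (f.contDiff_two.differentiable two_ne_zero y)]
      rfl
    simp only [Matrix.of_apply, Matrix.smul_apply, RingHom.id_apply]
    rw [h2]
    simp only [partialDeriv]
    rw [fderiv_const_smul]
    · rfl
    · exact (f.contDiff_two.partialDeriv (m' := 1) (by norm_num) j).differentiable one_ne_zero x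

/-- `mixedTrace` as a multilinear map. -/
noncomputable def mixedTraceMultilinear :
    MultilinearMap ℝ (fun _ : Fin k => Matrix (Fin n) (Fin n) ℝ) ℝ :=
  ∑ r : Fin k → Fin n, ∑ c : Fin k → Fin n, kroneckerSymbol r c •
    (MultilinearMap.mkPiAlgebra ℝ (Fin k) ℝ).compLinearMap
      fun m => Matrix.entryLinearMap ℝ ℝ (r m) (c m)

theorem mixedTraceMultilinear_apply (A : Fin k → Matrix (Fin n) (Fin n) ℝ) :
    mixedTraceMultilinear A = mixedTrace A := by
  simp [mixedTraceMultilinear, mixedTrace]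

theorem continuous_mixedHessian {f : Fin k → EuclideanSpace ℝ (Fin n) → ℝ}
    (hf : ∀ m, ContDiff ℝ 2 (f m)) : Continuous (mixedHessian f) := by
  have h : ∀ m i j, Continuous (partialDeriv i (partialDeriv j (f m))) := fun m i j =>
    (((hf m).partialDeriv (m' := 1) (by norm_num) j).partialDeriv (m' := 0)
      (by norm_num) i).continuous
  unfold mixedHessian mixedTrace
  simp only [Matrix.of_apply]
  fun_prop

theorem integrable_mixedHessian_mul (f : Fin k → CcSpace n 2) {m : ℕ∞} (φ : CcSpace n m) :
    Integrable fun x => mixedHessian (fun m => ⇑(f m)) x * φ x :=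
  ((continuous_mixedHessian fun m => (f m).contDiff_two).mul
    φ.continuous).integrable_of_hasCompactSupport φ.hasCompactSupport.mul_left

/-- The form `(f₁, …, f_k) ↦ k! ∫ F_k[f₁, …, f_k] φ`, where `F_k[f₁, …, f_k]` is the polarized
`k`-Hessian. -/
noncomputable def hessianForm (k : ℕ) {m : ℕ∞} (φ : CcSpace n m) :
    MultilinearMap ℝ (fun _ : Fin k => CcSpace n 2) ℝ where
  toFun f := ∫ x, mixedHessian (fun m => ⇑(f m)) x * φ x
  map_update_add' f i a b := by
    have h : ∀ (f : Fin k → CcSpace n 2) x, mixedHessian (fun m => ⇑(f m)) x =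
      (mixedTraceMultilinear.compLinearMap fun _ => hessianLinearMap x) f := fun f x =>
        (mixedTraceMultilinear_apply _).symm
    rw [← integral_add (integrable_mixedHessian_mul _ φ) (integrable_mixedHessian_mul _ φ)]
    congr 1
    ext x
    rw [h, h, h, MultilinearMap.map_update_add, add_mul]
  map_update_smul' f i c a := by
    have h : ∀ (f : Fin k → CcSpace n 2) x, mixedHessian (fun m => ⇑(f m)) x =
      (mixedTraceMultilinear.compLinearMap fun _ => hessianLinearMap x) f := fun f x =>
        (mixedTraceMultilinear_apply _).symm
    rw [smul_eq_mul, ← integral_const_mul]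
    congr 1
    ext x
    rw [h, h, MultilinearMap.map_update_smul, smul_eq_mul, mul_assoc]

theorem hessianForm_apply {m : ℕ∞} (φ : CcSpace n m) (f : Fin k → CcSpace n 2) :
    hessianForm k φ f = ∫ x, mixedHessian (fun m => ⇑(f m)) x * φ x := rfl

theorem hessianForm_diag {m : ℕ∞} (φ : CcSpace n m) (f : CcSpace n 2) :
    hessianForm k φ (fun _ => f) = (k.factorial : ℝ) * ∫ x, kHessian k f x * φ x := by
  rw [hessianForm_apply, ← integral_const_mul]
  congr 1
  ext x
  rw [mixedHessian_diag f.contDiff_two, mul_assoc]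

/-- Telescoping: the difference of the values of a multilinear map at two points is controlled by
values with one slot equal to a difference. -/
theorem MultilinearMap.enorm_sub_le_of_forall {V : Type*} [AddCommGroup V] [Module ℝ V]
    (N : MultilinearMap ℝ (fun _ : Fin k => V) ℝ) (a b : Fin k → V) (Q : ℝ≥0∞)
    (hQ : ∀ (i : Fin k) (h : Fin k → V), h i = a i - b i → (∀ l ≠ i, h l = a l ∨ h l = b l) →
      ‖N h‖ₑ ≤ Q) :
    ‖N a - N b‖ₑ ≤ k * Q := by
  have key : ∀ s : Finset (Fin k), ‖N (s.piecewise a b) - N b‖ₑ ≤ s.card * Q := by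
    intro s
    induction s using Finset.induction_on with
    | empty => simp
    | insert i s hi ih =>
      have h1 : N ((insert i s).piecewise a b) - N (s.piecewise a b) =
          N (Function.update (s.piecewise a b) i (a i - b i)) := by
        rw [N.map_update_sub, Finset.piecewise_insert]
        congr 2
        rw [Function.eq_update_iff]
        exact ⟨Finset.piecewise_eq_of_notMem _ _ _ hi, fun _ _ => rfl⟩
      have h2 : ‖N (Function.update (s.piecewise a b) i (a i - b i))‖ₑ ≤ Q := by
        refine hQ i _ (by simp) fun l hl => ?_
        rw [Function.update_of_ne hl]
        by_cases h : l ∈ s <;> simp [h]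
      rw [Finset.card_insert_of_notMem hi, Nat.cast_add, Nat.cast_one, add_mul, one_mul,
        ← sub_add_sub_cancel _ (N (s.piecewise a b)), h1, add_comm]
      exact (enorm_add_le _ _).trans (add_le_add ih h2)
  simpa using key Finset.univ

end HessianForm

/-! ### Uniform bounds for the mollified form -/

section MollifiedForm

variable {n k : ℕ}

/-- The mollification of a `C_c²` function. -/
noncomputable def mollifyCc {t : ℝ} (ht : 0 < t) (f : CcSpace n 2) : CcSpace n 2 where
  toFun := mollify t f
  contDiff' := contDiff_mollify ht f.continuous.locallyIntegrable
  hasCompactSupport' := f.hasCompactSupport.mollify ht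
  tsupport_subset' := fun _ _ => trivial

theorem coe_mollifyCc {t : ℝ} (ht : 0 < t) (f : CcSpace n 2) : ⇑(mollifyCc ht f) = mollify t f :=
  rfl

/-- The sum of the absolute values of the generalized Kronecker symbols. -/
noncomputable def kroneckerBound (n k : ℕ) : ℝ≥0∞ :=
  ∑ q : (Fin k → Fin n) × (Fin k → Fin n), ‖kroneckerSymbol q.1 q.2‖ₑ

theorem kroneckerBound_ne_top (n k : ℕ) : kroneckerBound n k ≠ ∞ :=
  ENNReal.sum_ne_top.2 fun _ _ => enorm_ne_top

theorem enorm_sum_kroneckerSymbol_mul_le (w : (Fin k → Fin n) × (Fin k → Fin n) → ℝ) (B : ℝ≥0∞)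
    (h : ∀ q, ‖w q‖ₑ ≤ B) :
    ‖∑ q : (Fin k → Fin n) × (Fin k → Fin n), kroneckerSymbol q.1 q.2 * w q‖ₑ ≤
      kroneckerBound n k * B := by
  rw [kroneckerBound, Finset.sum_mul]
  refine (enorm_sum_le _ _).trans (Finset.sum_le_sum fun q _ => ?_)
  rw [enorm_mul]
  gcongr
  exact h q

theorem enorm_finset_prod {ι : Type*} (s : Finset ι) (f : ι → ℝ) :
    ‖∏ i ∈ s, f i‖ₑ = ∏ i ∈ s, ‖f i‖ₑ := by
  simp [enorm, nnnorm_prod]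

theorem lintegral_prod_le_sum (hk : 1 ≤ k) (c : ℝ≥0∞) {P : Fin k → EuclideanSpace ℝ (Fin n) → ℝ≥0∞}
    (hP : ∀ m, Measurable (P m)) :
    ∫⁻ x, c * ∏ m, P m x ≤ c * ∑ m, ∫⁻ x, P m x ^ k := by
  rw [← lintegral_finsetSum _ fun m _ => (hP m).pow_const k, ← lintegral_const_mul]
  · gcongr with x
    exact prod_le_sum_pow hk _
  · exact Finset.measurable_sum _ fun m _ => (hP m).pow_const k

theorem enorm_partialDeriv_partialDeriv_le (φ : CcSpace n 2) (i j : Fin n)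
    (x : EuclideanSpace ℝ (Fin n)) :
    ‖partialDeriv i (partialDeriv j φ) x‖ₑ ≤ ENNReal.ofReal (hessianSupNorm φ) := by
  rw [← ofReal_norm]
  exact ENNReal.ofReal_le_ofReal (abs_partialDeriv_partialDeriv_le φ i j x)

/-- After two integrations by parts, the form is bounded by one function and the second derivatives
of the others. -/
theorem enorm_integral_mixedHessian_mul_le (hk : 1 ≤ k)
    {f : Fin k → EuclideanSpace ℝ (Fin n) → ℝ} (hf : ∀ m, ContDiff ℝ 3 (f m)) (φ : CcSpace n 2)
    (a : Fin k) (A B : ℝ≥0∞) {P : Fin k → EuclideanSpace ℝ (Fin n) → ℝ≥0∞}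
    (hP : ∀ m, Measurable (P m)) (hA : ∀ x, ‖f a x‖ₑ ≤ A * P a x)
    (hB : ∀ m ≠ a, ∀ i j x, ‖partialDeriv i (partialDeriv j (f m)) x‖ₑ ≤ B * P m x) :
    ‖∫ x, mixedHessian f x * φ x‖ₑ ≤
      kroneckerBound n k * (A * ENNReal.ofReal (hessianSupNorm φ) * B ^ (k - 1)) *
        ∑ m, ∫⁻ x, P m x ^ k := by
  rw [integral_mixedHessian_mul hf φ.contDiff_two φ.hasCompactSupport a]
  refine (enorm_integral_le_lintegral_enorm _).trans
    (le_trans (lintegral_mono fun x => ?_) (lintegral_prod_le_sum hk _ hP))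
  rw [mul_assoc]
  refine enorm_sum_kroneckerSymbol_mul_le _ _ fun q => ?_
  rw [enorm_mul, enorm_mul, ← Finset.mul_prod_erase Finset.univ _ (Finset.mem_univ a),
    enorm_finset_prod]
  calc _ ≤ A * P a x * (ENNReal.ofReal (hessianSupNorm φ) *
        ∏ m ∈ Finset.univ.erase a, (B * P m x)) := by
        gcongr with m hm
        · exact hA x
        · exact enorm_partialDeriv_partialDeriv_le φ _ _ x
        · exact hB m (Finset.ne_of_mem_erase hm) _ _ x
    _ = _ := by
        rw [Finset.prod_mul_distrib, Finset.prod_const, Finset.card_erase_of_mem (Finset.mem_univ a),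
          Finset.card_univ, Fintype.card_fin]
        ring

/-- For `k = 2`, the form is bounded by the first derivatives. -/
theorem enorm_integral_mixedHessian_two_mul_le
    {f : Fin 2 → EuclideanSpace ℝ (Fin n) → ℝ} (hf : ∀ m, ContDiff ℝ 3 (f m)) (φ : CcSpace n 2)
    (B : ℝ≥0∞) {P : Fin 2 → EuclideanSpace ℝ (Fin n) → ℝ≥0∞} (hP : ∀ m, Measurable (P m))
    (hB : ∀ m i x, ‖partialDeriv i (f m) x‖ₑ ≤ B * P m x) :
    ‖∫ x, mixedHessian f x * φ x‖ₑ ≤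
      kroneckerBound n 2 * (ENNReal.ofReal (hessianSupNorm φ) * B ^ 2) *
        ∑ m, ∫⁻ x, P m x ^ 2 := by
  rw [integral_mixedHessian_two_mul hf φ.contDiff_two φ.hasCompactSupport]
  refine (enorm_integral_le_lintegral_enorm _).trans
    (le_trans (lintegral_mono fun x => ?_) (lintegral_prod_le_sum one_le_two _ hP))
  rw [mul_assoc]
  refine enorm_sum_kroneckerSymbol_mul_le _ _ fun q => ?_
  rw [enorm_mul, enorm_mul, Fin.prod_univ_two]
  calc _ ≤ B * P 1 x * (B * P 0 x * ENNReal.ofReal (hessianSupNorm φ)) := by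
        gcongr
        · exact hB 1 _ x
        · exact hB 0 _ x
        · exact enorm_partialDeriv_partialDeriv_le φ _ _ x
    _ = _ := by ring

theorem norm_partialDeriv_le {f : EuclideanSpace ℝ (Fin n) → ℝ} (i : Fin n)
    (x : EuclideanSpace ℝ (Fin n)) : ‖partialDeriv i f x‖ ≤ ‖fderiv ℝ f x‖ :=
  ((fderiv ℝ f x).le_opNorm _).trans (by simp)

theorem abs_partialDeriv_sub_le {f : EuclideanSpace ℝ (Fin n) → ℝ} (i : Fin n)
    (x y : EuclideanSpace ℝ (Fin n)) :
    |partialDeriv i f x - partialDeriv i f y| ≤ ‖fderiv ℝ f x - fderiv ℝ f y‖ :=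
  ((fderiv ℝ f x - fderiv ℝ f y).le_opNorm (EuclideanSpace.single i 1)).trans (by simp)

theorem CcSpace.continuous_fderiv (f : CcSpace n 2) : Continuous (fderiv ℝ f) :=
  f.contDiff_two.continuous_fderiv two_ne_zero

theorem CcSpace.stronglyMeasurable_fderiv (f : CcSpace n 2) : StronglyMeasurable (fderiv ℝ f) :=
  f.continuous_fderiv.stronglyMeasurable

theorem partialDeriv_mollify_Cc (t : ℝ) (f : CcSpace n 2) (i : Fin n) :
    partialDeriv i (mollify t f) = mollify t (partialDeriv i f) :=
  partialDeriv_mollify_of_contDiff t (f.contDiff_two.of_le (by norm_num)) f.hasCompactSupport i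

theorem CcSpace.continuous_partialDeriv (f : CcSpace n 2) (i : Fin n) :
    Continuous (partialDeriv i f) :=
  (f.contDiff_two.partialDeriv (m' := 1) (by norm_num) i).continuous

theorem contDiff_three_mollifyCc {t : ℝ} (ht : 0 < t) (f : CcSpace n 2) :
    ContDiff ℝ 3 (mollifyCc ht f) :=
  contDiff_mollify (m := 3) ht f.continuous.locallyIntegrable

/-- The form of functions mollified at the scale one. -/
theorem enorm_hessianForm_mollify_one_le (hk : 2 ≤ k) (f : Fin k → CcSpace n 2) (φ : CcSpace n 2)
    (h0 : ∀ m, ∫⁻ x, ‖f m x‖ₑ ^ k ≤ 1) (h1 : ∀ m, ∫⁻ x, ‖fderiv ℝ (f m) x‖ₑ ^ k ≤ 1) :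
    ‖hessianForm k φ fun m => mollifyCc one_pos (f m)‖ₑ ≤
      kroneckerBound n k * (ENNReal.ofReal (mollifierBound n) *
        ENNReal.ofReal (hessianSupNorm φ) * ENNReal.ofReal (mollifierBound n) ^ (k - 1)) *
        (k * unitBallVolume n ^ k) := by
  let a : Fin k := ⟨0, by omega⟩
  let P : Fin k → EuclideanSpace ℝ (Fin n) → ℝ≥0∞ := fun m =>
    if m = a then localMean 1 (f m) else localMean 1 (fderiv ℝ (f m))
  have hP : ∀ m, Measurable (P m) := fun m => by
    simp only [P]
    split_ifs
    · exact measurable_localMean _ (f m).stronglyMeasurable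
    · exact measurable_localMean _ (f m).stronglyMeasurable_fderiv
  have hP2 : ∀ m, ∫⁻ x, P m x ^ k ≤ unitBallVolume n ^ k := fun m => by
    simp only [P]
    split_ifs
    · exact (lintegral_localMean_pow_le one_pos hk (f m).stronglyMeasurable).trans
        (mul_le_of_le_one_right' (h0 m))
    · exact (lintegral_localMean_pow_le one_pos hk (f m).stronglyMeasurable_fderiv).trans
        (mul_le_of_le_one_right' (h1 m))
  refine (enorm_integral_mixedHessian_mul_le (by omega)
    (fun m => contDiff_three_mollifyCc one_pos (f m)) φ a (ENNReal.ofReal (mollifierBound n))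
    (ENNReal.ofReal (mollifierBound n)) hP (fun x => ?_) (fun m hm i j x => ?_)).trans ?_
  · simp only [P, if_true]
    exact enorm_mollify_le_localMean one_pos _ x
  · simp only [P, if_neg hm]
    rw [coe_mollifyCc, partialDeriv_mollify_Cc]
    refine (enorm_partialDeriv_mollify_le_localMean one_pos
      ((f m).continuous_partialDeriv j).locallyIntegrable i x).trans ?_
    rw [inv_one, mul_one]
    gcongr
    exact localMean_mono _ (norm_partialDeriv_le j) x
  · gcongr
    refine (Finset.sum_le_sum fun m _ => hP2 m).trans_eq ?_
    simp

/-- One dyadic step of the mollified form. -/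
theorem enorm_hessianForm_mollify_sub_le (hk : 2 ≤ k) (f : Fin k → CcSpace n 2) (φ : CcSpace n 2)
    {t : ℝ} (ht : 0 < t) :
    ‖(hessianForm k φ fun m => mollifyCc (half_pos ht) (f m)) -
        hessianForm k φ fun m => mollifyCc ht (f m)‖ₑ ≤
      k * (kroneckerBound n k * (ENNReal.ofReal (hessianSupNorm φ) *
        ENNReal.ofReal (mollifierBound n * 2 ^ (n + 1)) ^ k) *
          ∑ m, (ENNReal.ofReal t⁻¹ ^ (k - 2) *
            ∫⁻ x, ENNReal.ofReal (meanOscillation t (fderiv ℝ (f m)) x) ^ k)) := by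
  have hM := mollifierBound_nonneg n
  refine MultilinearMap.enorm_sub_le_of_forall _ _ _ _ fun a h ha hh => ?_
  set M := mollifierBound n * 2 ^ (n + 1) with hMdef
  have hM0 : 0 ≤ M := by positivity
  have hsmooth : ∀ m, ContDiff ℝ 3 (h m) := by
    intro m
    by_cases hm : m = a
    · rw [hm, ha]
      exact (contDiff_three_mollifyCc _ _).sub (contDiff_three_mollifyCc _ _)
    · rcases hh m hm with h' | h' <;> rw [h'] <;> exact contDiff_three_mollifyCc _ _
  have hA : ∀ x, ‖h a x‖ₑ ≤
      ENNReal.ofReal (M * t) * ENNReal.ofReal (meanOscillation t (fderiv ℝ (f a)) x) := by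
    intro x
    rw [ha, ← ENNReal.ofReal_mul (by positivity), ← ofReal_norm]
    refine ENNReal.ofReal_le_ofReal ?_
    refine (abs_mollify_sub_mollify_half_le ((f a).contDiff_two.of_le (by norm_num)) x ht).trans ?_
    have := meanOscillation_nonneg ht (fderiv ℝ (f a)) x
    gcongr
    rw [hMdef]
    gcongr <;> norm_num
  have hB : ∀ m ≠ a, ∀ i j x, ‖partialDeriv i (partialDeriv j (h m)) x‖ₑ ≤
      ENNReal.ofReal (M * t⁻¹) * ENNReal.ofReal (meanOscillation t (fderiv ℝ (f m)) x) := by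
    intro m hm i j x
    rw [← ENNReal.ofReal_mul (by positivity), ← ofReal_norm]
    refine ENNReal.ofReal_le_ofReal ?_
    have h0 := meanOscillation_nonneg ht (fderiv ℝ (f m)) x
    have h1 : ∀ s (hs : 0 < s), ‖partialDeriv i (partialDeriv j (mollifyCc hs (f m))) x‖ ≤
        mollifierBound n * s⁻¹ * meanOscillation s (fderiv ℝ (f m)) x := by
      intro s hs
      rw [coe_mollifyCc, partialDeriv_mollify_Cc]
      exact abs_partialDeriv_mollify_le hs ((f m).continuous_partialDeriv j)
        (f m).continuous_fderiv (abs_partialDeriv_sub_le j) i x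
    rcases hh m hm with h' | h' <;> rw [h']
    · refine (h1 _ _).trans ?_
      calc _ ≤ mollifierBound n * (t / 2)⁻¹ * (2 ^ n * meanOscillation t (fderiv ℝ (f m)) x) := by
            gcongr
            exact meanOscillation_le_of_half_le (f m).continuous_fderiv ht le_rfl (by linarith) x
        _ = _ := by rw [hMdef, inv_div, pow_succ]; ring
    · refine (h1 _ _).trans ?_
      gcongr
      rw [hMdef]
      exact le_mul_of_one_le_right hM (one_le_pow₀ (by norm_num))
  refine (enorm_integral_mixedHessian_mul_le (by omega) hsmooth φ a _ _
    (fun m => measurable_ofReal_meanOscillation ht (f m).continuous_fderiv) hA hB).trans_eq ?_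
  rw [← Finset.mul_sum]
  obtain ⟨l, rfl⟩ : ∃ l, k = l + 2 := ⟨k - 2, by omega⟩
  rw [show l + 2 - 1 = l + 1 by omega, Nat.add_sub_cancel, ENNReal.ofReal_mul hM0,
    ENNReal.ofReal_mul hM0]
  have h2 := ofReal_inv_mul_ofReal_pow ht 1
  rw [pow_one, pow_one] at h2
  calc _ = kroneckerBound n (l + 2) * (ENNReal.ofReal (hessianSupNorm φ) *
        ENNReal.ofReal M ^ (l + 2)) * ((ENNReal.ofReal t⁻¹ * ENNReal.ofReal t) *
        (ENNReal.ofReal t⁻¹ ^ l * ∑ m, ∫⁻ x,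
          ENNReal.ofReal (meanOscillation t (fderiv ℝ (f m)) x) ^ (l + 2))) := by ring
    _ = _ := by rw [h2, one_mul]

theorem enorm_hessianForm_mollify_two_le (f : Fin 2 → CcSpace n 2) (φ : CcSpace n 2)
    (h1 : ∀ m, ∫⁻ x, ‖fderiv ℝ (f m) x‖ₑ ^ 2 ≤ 1) {t : ℝ} (ht : 0 < t) :
    ‖hessianForm 2 φ fun m => mollifyCc ht (f m)‖ₑ ≤
      kroneckerBound n 2 * (ENNReal.ofReal (hessianSupNorm φ) *
        ENNReal.ofReal (mollifierBound n) ^ 2) * (2 * unitBallVolume n ^ 2) := by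
  refine (enorm_integral_mixedHessian_two_mul_le
    (fun m => contDiff_three_mollifyCc ht (f m)) φ (ENNReal.ofReal (mollifierBound n))
    (fun m => measurable_localMean t (f m).stronglyMeasurable_fderiv) fun m i x => ?_).trans ?_
  · rw [coe_mollifyCc, partialDeriv_mollify_Cc]
    refine (enorm_mollify_le_localMean ht _ x).trans ?_
    gcongr
    exact localMean_mono _ (norm_partialDeriv_le i) x
  · gcongr
    refine (Finset.sum_le_sum fun m _ => (lintegral_localMean_pow_le ht le_rfl
      (f m).stronglyMeasurable_fderiv).trans (mul_le_of_le_one_right' (h1 m))).trans_eq ?_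
    simp

/-- The form of mollified functions is bounded, uniformly in the scale, when the functions are
bounded in the norm of `B(2 - 2/k, k)`. -/
theorem exists_enorm_hessianForm_mollify_le (hk : 2 ≤ k) (hkn : k ≤ n) :
    ∃ C : ℝ≥0∞, C ≠ ∞ ∧ ∀ (f : Fin k → CcSpace n 2) (φ : CcSpace n 2),
      (∀ m, ∫⁻ x, ‖f m x‖ₑ ^ k ≤ 1) → (∀ m, ∫⁻ x, ‖fderiv ℝ (f m) x‖ₑ ^ k ≤ 1) →
      (3 ≤ k → ∀ m, gagliardoIntegral k (n + (k - 2)) (fderiv ℝ (f m)) ≤ 1) →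
      ∀ J : ℕ, ‖hessianForm k φ fun m => mollifyCc (pow_pos one_half_pos J) (f m)‖ₑ ≤
        C * ENNReal.ofReal (hessianSupNorm φ) := by
  have hv := unitBallVolume_ne_top n
  have hK := kroneckerBound_ne_top n k
  rcases hk.eq_or_lt with rfl | hk3
  -- for `k = 2` each scale is bounded directly by the first derivatives
  · refine ⟨kroneckerBound n 2 * ENNReal.ofReal (mollifierBound n) ^ 2 *
      (2 * unitBallVolume n ^ 2), by finiteness, fun f φ _ h1 _ J => ?_⟩
    refine (enorm_hessianForm_mollify_two_le f φ h1 _).trans_eq ?_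
    ring
  · set C₀ := kroneckerBound n k * (ENNReal.ofReal (mollifierBound n) *
      ENNReal.ofReal (mollifierBound n) ^ (k - 1)) * (k * unitBallVolume n ^ k) with hC₀
    set C₁ := k * (kroneckerBound n k * ENNReal.ofReal (mollifierBound n * 2 ^ (n + 1)) ^ k *
      (k * (unitBallVolume n ^ (k - 1) * 2))) with hC₁
    refine ⟨C₀ + C₁, by finiteness, fun f φ h0 h1 h2 J => ?_⟩
    let T : ℕ → ℝ := fun J => hessianForm k φ fun m => mollifyCc (pow_pos one_half_pos J) (f m)
    let a : ℕ → ℝ≥0∞ := fun j => ∑ m, (ENNReal.ofReal ((1 / 2 : ℝ) ^ j)⁻¹ ^ (k - 2) *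
      ∫⁻ x, ENNReal.ofReal (meanOscillation ((1 / 2 : ℝ) ^ j) (fderiv ℝ (f m)) x) ^ k)
    have hT0 : ‖T 0‖ₑ ≤ C₀ * ENNReal.ofReal (hessianSupNorm φ) := by
      have h3 : T 0 = hessianForm k φ fun m => mollifyCc one_pos (f m) := by
        simp only [T]
        congr 1
      rw [h3]
      refine (enorm_hessianForm_mollify_one_le hk f φ h0 h1).trans_eq ?_
      rw [hC₀]
      ring
    have hstep : ∀ j, ‖T (j + 1) - T j‖ₑ ≤ k * (kroneckerBound n k *
        (ENNReal.ofReal (hessianSupNorm φ) *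
          ENNReal.ofReal (mollifierBound n * 2 ^ (n + 1)) ^ k) * a j) := by
      intro j
      have h3 : T (j + 1) = hessianForm k φ fun m =>
          mollifyCc (half_pos (pow_pos one_half_pos j)) (f m) := by
        simp only [T]
        congr 1
        ext m x
        simp only [coe_mollifyCc, pow_succ, mul_one_div]
      rw [h3]
      exact enorm_hessianForm_mollify_sub_le hk f φ _
    -- the weighted oscillations at the dyadic scales sum to the fractional seminorm
    have hsum : ∑ j ∈ Finset.range J, a j ≤ k * (unitBallVolume n ^ (k - 1) * 2) := by
      simp only [a]
      rw [Finset.sum_comm]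
      have h3 : ∀ m ∈ Finset.univ, ∑ j ∈ Finset.range J,
          ENNReal.ofReal ((1 / 2 : ℝ) ^ j)⁻¹ ^ (k - 2) *
          ∫⁻ x, ENNReal.ofReal (meanOscillation ((1 / 2 : ℝ) ^ j) (fderiv ℝ (f m)) x) ^ k ≤
          unitBallVolume n ^ (k - 1) * 2 := fun m _ => by
        refine (sum_lintegral_meanOscillation_le hk (by omega) (f m).continuous_fderiv J).trans ?_
        gcongr
        exact mul_le_of_le_one_right' (h2 hk3 m)
      refine (Finset.sum_le_sum h3).trans_eq ?_
      simp
    have hTJ : ‖T J‖ₑ ≤ ‖T 0‖ₑ + ∑ j ∈ Finset.range J, ‖T (j + 1) - T j‖ₑ := by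
      have h4 : T J = T 0 + ∑ j ∈ Finset.range J, (T (j + 1) - T j) := by
        rw [Finset.sum_range_sub]
        ring
      calc ‖T J‖ₑ = ‖T 0 + ∑ j ∈ Finset.range J, (T (j + 1) - T j)‖ₑ := by rw [← h4]
        _ ≤ _ := (enorm_add_le _ _).trans (by gcongr; exact enorm_sum_le _ _)
    calc ‖T J‖ₑ ≤ C₀ * ENNReal.ofReal (hessianSupNorm φ) + ∑ j ∈ Finset.range J,
          k * (kroneckerBound n k * (ENNReal.ofReal (hessianSupNorm φ) *
            ENNReal.ofReal (mollifierBound n * 2 ^ (n + 1)) ^ k) * a j) :=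
          hTJ.trans (add_le_add hT0 (Finset.sum_le_sum fun j _ => hstep j))
      _ ≤ C₀ * ENNReal.ofReal (hessianSupNorm φ) + k * (kroneckerBound n k *
          (ENNReal.ofReal (hessianSupNorm φ) *
            ENNReal.ofReal (mollifierBound n * 2 ^ (n + 1)) ^ k) *
            (k * (unitBallVolume n ^ (k - 1) * 2))) := by
          rw [← Finset.mul_sum, ← Finset.mul_sum]
          gcongr
      _ = _ := by
          rw [hC₁]
          ring

end MollifiedForm

/-! ### The fractional seminorm and translations -/

section Translations

variable {n k : ℕ} {F : Type*} [NormedAddCommGroup F]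

/-- In the critical case `s = 2 - 2/k`, `p = k ≥ 3`, the exponent of the kernel of the fractional
seminorm is the integer `n + k - 2`. -/
theorem besovSeminorm_pow_eq (hk : 3 ≤ k)
    (g : EuclideanSpace ℝ (Fin n) → EuclideanSpace ℝ (Fin n)) :
    besovSeminorm (2 - 2 / (k : ℝ)) (k : ℝ≥0) g ^ k = gagliardoIntegral k (n + (k - 2)) g := by
  have hk0 : (0 : ℝ) < k := by
    have : (3 : ℝ) ≤ k := by exact_mod_cast hk
    linarith
  have h1 : ¬ (2 - 2 / (k : ℝ) = 1) := by
    intro h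
    have h2 : (2 : ℝ) / k = 1 := by linarith
    rw [div_eq_one_iff_eq hk0.ne'] at h2
    have h3 : (2 : ℕ) = k := by exact_mod_cast h2
    omega
  have h4 : (n : ℝ) + (2 - 2 / (k : ℝ) - 1) * ((k : ℝ≥0) : ℝ) = ((n + (k - 2) : ℕ) : ℝ) := by
    rw [Nat.cast_add, Nat.cast_sub (by omega), NNReal.coe_natCast]
    field_simp
    push_cast
    ring
  rw [besovSeminorm, if_neg h1, h4, NNReal.coe_natCast, ← ENNReal.rpow_natCast,
    ← ENNReal.rpow_mul, one_div_mul_cancel hk0.ne', ENNReal.rpow_one, gagliardoIntegral]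
  refine lintegral_congr fun x => ?_
  rw [← lintegral_sub_left_eq_self _ x]
  refine lintegral_congr fun y => ?_
  rw [sub_sub_cancel, ← enorm_neg (g x - _), neg_sub, ENNReal.rpow_natCast, ENNReal.rpow_natCast]

theorem besovSeminorm_two (g : EuclideanSpace ℝ (Fin n) → EuclideanSpace ℝ (Fin n)) (p : ℝ≥0) :
    besovSeminorm (2 - 2 / ((2 : ℕ) : ℝ)) p g = 0 := by
  rw [besovSeminorm, if_pos (by norm_num)]

/-- The `L^k` modulus of continuity `‖G(· - h) - G‖_{L^k}`. -/
noncomputable def translationModulus (k : ℕ) (G : EuclideanSpace ℝ (Fin n) → F)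
    (h : EuclideanSpace ℝ (Fin n)) : ℝ≥0∞ :=
  eLpNorm (fun x => G (x - h) - G x) k volume

theorem eLpNorm_natCast_pow (hk : k ≠ 0) (G : EuclideanSpace ℝ (Fin n) → F) :
    eLpNorm G k volume ^ k = ∫⁻ x, ‖G x‖ₑ ^ k := by
  have h := eLpNorm_nnreal_pow_eq_lintegral (f := G) (p := (k : ℝ≥0))
    (μ := (volume : Measure (EuclideanSpace ℝ (Fin n)))) (by exact_mod_cast hk)
  simpa using h

theorem MeasureTheory.StronglyMeasurable.comp_sub {G : EuclideanSpace ℝ (Fin n) → F}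
    (hG : StronglyMeasurable G) (h : EuclideanSpace ℝ (Fin n)) :
    StronglyMeasurable fun x => G (x - h) :=
  hG.comp_measurable (measurable_id.sub_const h)

theorem gagliardoIntegral_eq (hk : k ≠ 0) (e : ℕ) {G : EuclideanSpace ℝ (Fin n) → F}
    (hG : StronglyMeasurable G) :
    gagliardoIntegral k e G = ∫⁻ h, translationModulus k G h ^ k / ‖h‖ₑ ^ e := by
  have hm : Measurable fun q : EuclideanSpace ℝ (Fin n) × EuclideanSpace ℝ (Fin n) =>
      ‖G (q.1 - q.2) - G q.1‖ₑ := ((hG.comp_measurable (measurable_fst.sub measurable_snd)).sub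
        (hG.comp_measurable measurable_fst)).enorm
  rw [gagliardoIntegral, lintegral_lintegral_swap]
  · refine lintegral_congr fun h => ?_
    simp_rw [div_eq_mul_inv]
    have hm1 : Measurable fun x => ‖G (x - h) - G x‖ₑ := ((hG.comp_sub h).sub hG).enorm
    rw [lintegral_mul_const _ (hm1.pow_const k), translationModulus, eLpNorm_natCast_pow hk]
  · exact ((hm.pow_const k).div (measurable_snd.enorm.pow_const e)).aemeasurable

theorem measurable_translationModulus (hk : k ≠ 0) {G : EuclideanSpace ℝ (Fin n) → F}
    (hG : StronglyMeasurable G) : Measurable (translationModulus k G) := by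
  have hm : Measurable fun q : EuclideanSpace ℝ (Fin n) × EuclideanSpace ℝ (Fin n) =>
      ‖G (q.2 - q.1) - G q.2‖ₑ ^ k := ((hG.comp_measurable (measurable_snd.sub measurable_fst)).sub
        (hG.comp_measurable measurable_snd)).enorm.pow_const k
  have h1 : translationModulus k G = fun h => (∫⁻ x, ‖G (x - h) - G x‖ₑ ^ k) ^ (1 / (k : ℝ)) := by
    ext h
    rw [← eLpNorm_natCast_pow hk, ← ENNReal.rpow_natCast, ← ENNReal.rpow_mul,
      mul_one_div_cancel (by exact_mod_cast hk), ENNReal.rpow_one]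
    rfl
  rw [h1]
  exact hm.lintegral_prod_right'.pow_const _

theorem eLpNorm_comp_sub {G : EuclideanSpace ℝ (Fin n) → F} (hG : StronglyMeasurable G)
    (p : ℝ≥0∞) (h : EuclideanSpace ℝ (Fin n)) :
    eLpNorm (fun x => G (x - h)) p volume = eLpNorm G p volume :=
  eLpNorm_comp_measurePreserving hG.aestronglyMeasurable (measurePreserving_sub_right volume h)

theorem translationModulus_le_two_mul (hk : 1 ≤ k) {G : EuclideanSpace ℝ (Fin n) → F}
    (hG : StronglyMeasurable G) (h : EuclideanSpace ℝ (Fin n)) :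
    translationModulus k G h ≤ 2 * eLpNorm G k volume := by
  refine (eLpNorm_sub_le (hG.comp_sub h).aestronglyMeasurable hG.aestronglyMeasurable
    (by exact_mod_cast hk)).trans_eq ?_
  rw [eLpNorm_comp_sub hG, two_mul]

theorem translationModulus_add_le (hk : 1 ≤ k) {G H : EuclideanSpace ℝ (Fin n) → F}
    (hG : StronglyMeasurable G) (hH : StronglyMeasurable H) (h : EuclideanSpace ℝ (Fin n)) :
    translationModulus k (G + H) h ≤ translationModulus k G h + translationModulus k H h := by
  refine le_trans (le_of_eq ?_) (eLpNorm_add_le ((hG.comp_sub h).sub hG).aestronglyMeasurable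
    ((hH.comp_sub h).sub hH).aestronglyMeasurable (by exact_mod_cast hk))
  rw [translationModulus]
  congr 1
  ext x
  simp only [Pi.add_apply]
  abel

theorem translationModulus_sub_le (hk : 1 ≤ k) {G H : EuclideanSpace ℝ (Fin n) → F}
    (hG : StronglyMeasurable G) (hH : StronglyMeasurable H) (h : EuclideanSpace ℝ (Fin n)) :
    translationModulus k (G - H) h ≤ translationModulus k G h + translationModulus k H h := by
  refine le_trans (le_of_eq ?_) (eLpNorm_sub_le ((hG.comp_sub h).sub hG).aestronglyMeasurable
    ((hH.comp_sub h).sub hH).aestronglyMeasurable (by exact_mod_cast hk))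
  rw [translationModulus]
  congr 1
  ext x
  simp only [Pi.sub_apply]
  abel

/-- For `C¹` functions the modulus of continuity is controlled by the derivative. -/
theorem translationModulus_le_enorm_mul [NormedSpace ℝ F] [CompleteSpace F] (hk : 2 ≤ k)
    {G : EuclideanSpace ℝ (Fin n) → F} (hG : ContDiff ℝ 1 G) (h : EuclideanSpace ℝ (Fin n)) :
    translationModulus k G h ≤ ‖h‖ₑ * eLpNorm (fderiv ℝ G) k volume := by
  have hG' := hG.continuous_fderiv one_ne_zero
  have h1 : ∀ x, ‖G (x - h) - G x‖ₑ ≤ ‖h‖ₑ * ∫⁻ s in Set.Icc (0 : ℝ) 1, ‖fderiv ℝ G (x - s • h)‖ₑ := by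
    intro x
    have hd : ∀ s ∈ Set.uIcc (0 : ℝ) 1, HasDerivAt (fun s : ℝ => G (x - s • h))
        (fderiv ℝ G (x - s • h) (-h)) s := fun s _ => by
      have h2 : HasDerivAt (fun s : ℝ => x - s • h) (-h) s := by
        simpa using ((hasDerivAt_id s).smul_const h).const_sub x
      exact (hG.differentiable one_ne_zero _).hasFDerivAt.comp_hasDerivAt s h2
    have hint : IntervalIntegrable (fun s : ℝ => fderiv ℝ G (x - s • h) (-h)) volume 0 1 :=
      ((hG'.comp (by fun_prop)).clm_apply continuous_const).intervalIntegrable _ _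
    have h3 := intervalIntegral.integral_eq_sub_of_hasDerivAt hd hint
    simp only [one_smul, zero_smul, sub_zero] at h3
    rw [← h3, intervalIntegral.integral_of_le zero_le_one, ← integral_Icc_eq_integral_Ioc,
      ← lintegral_const_mul' _ _ enorm_ne_top]
    refine (enorm_integral_le_lintegral_enorm _).trans (lintegral_mono fun s => ?_)
    rw [mul_comm, ← enorm_neg h]
    exact ContinuousLinearMap.le_opENorm _ _
  refine (ENNReal.pow_le_pow_left_iff (n := k) (by omega)).1 ?_
  rw [translationModulus, eLpNorm_natCast_pow (by omega), mul_pow, eLpNorm_natCast_pow (by omega)]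
  have hm : Measurable fun q : EuclideanSpace ℝ (Fin n) × ℝ => ‖fderiv ℝ G (q.1 - q.2 • h)‖ₑ :=
    ((hG'.comp (by fun_prop)).stronglyMeasurable).enorm
  calc ∫⁻ x, ‖G (x - h) - G x‖ₑ ^ k
      ≤ ∫⁻ x, ‖h‖ₑ ^ k * ∫⁻ s in Set.Icc (0 : ℝ) 1, ‖fderiv ℝ G (x - s • h)‖ₑ ^ k := by
        refine lintegral_mono fun x => ?_
        have h2 := pow_setLIntegral_le (μ := (volume : Measure ℝ)) (s := Set.Icc 0 1)
          (F := fun s => ‖fderiv ℝ G (x - s • h)‖ₑ)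
          (hm.comp (measurable_const.prodMk measurable_id)).aemeasurable hk
        simp only [Real.volume_Icc, sub_zero, ENNReal.ofReal_one, one_pow, one_mul] at h2
        calc _ ≤ (‖h‖ₑ * ∫⁻ s in Set.Icc (0 : ℝ) 1, ‖fderiv ℝ G (x - s • h)‖ₑ) ^ k := by
              gcongr
              exact h1 x
          _ ≤ _ := by
              rw [mul_pow]
              gcongr
    _ = ‖h‖ₑ ^ k * ∫⁻ s in Set.Icc (0 : ℝ) 1, ∫⁻ x, ‖fderiv ℝ G (x - s • h)‖ₑ ^ k := by
        rw [lintegral_const_mul' _ _ (by finiteness), lintegral_lintegral_swap]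
        exact (hm.pow_const k).aemeasurable
    _ = _ := by
        simp_rw [lintegral_sub_right_eq_self (fun x => ‖fderiv ℝ G x‖ₑ ^ k)]
        simp

/-- The integral at the critical exponent of a modulus of continuity which is linear near zero and
bounded at infinity. -/
theorem lintegral_min_one_pow_div_lt_top (hk : 3 ≤ k) (hn : 1 ≤ n) :
    ∫⁻ h : EuclideanSpace ℝ (Fin n), (min 1 ‖h‖ₑ) ^ k / ‖h‖ₑ ^ (n + (k - 2)) < ∞ := by
  have : Nonempty (Fin n) := ⟨⟨0, hn⟩⟩
  obtain ⟨l, rfl⟩ : ∃ l, k = l + 3 := ⟨k - 3, by omega⟩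
  obtain ⟨d, rfl⟩ : ∃ d, n = d + 1 := ⟨n - 1, by omega⟩
  let w : ℝ → ℝ := fun r => (min 1 r) ^ (l + 3) / r ^ (d + 1 + (l + 3 - 2))
  have h1 : Integrable (fun h : EuclideanSpace ℝ (Fin (d + 1)) => w ‖h‖) := by
    rw [integrable_fun_norm_addHaar, finrank_euclideanSpace, Fintype.card_fin,
      ← Set.Ioc_union_Ioi_eq_Ioi zero_le_one]
    refine IntegrableOn.union ?_ ?_
    · refine IntegrableOn.congr_fun (f := fun r : ℝ => r) ?_ (fun r hr => ?_) measurableSet_Ioc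
      · exact continuous_id.integrableOn_Ioc
      · simp only [w, min_eq_right hr.2, smul_eq_mul]
        have hr0 := hr.1.ne'
        rw [show d + 1 - 1 = d by omega, show l + 3 - 2 = l + 1 by omega]
        field_simp
        ring
    · have h2 := integrableOn_Ioi_rpow_of_lt (a := -((l : ℝ) + 2)) (c := 1)
        (by have : (0 : ℝ) ≤ l := by positivity
            linarith) one_pos
      refine h2.congr_fun (fun r hr => ?_) measurableSet_Ioi
      have hr0 : (0 : ℝ) < r := one_pos.trans hr
      simp only [w, min_eq_left (Set.mem_Ioi.1 hr).le, smul_eq_mul, one_pow]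
      rw [show d + 1 - 1 = d by omega, show l + 3 - 2 = l + 1 by omega,
        Real.rpow_neg hr0.le, ← Nat.cast_ofNat, ← Nat.cast_add, Real.rpow_natCast]
      field_simp
      ring
  have h2 := h1.2
  rw [HasFiniteIntegral] at h2
  refine lt_of_eq_of_lt (lintegral_congr fun h => ?_) h2
  rcases eq_or_ne h 0 with rfl | hh
  · simp [w]
  · have h3 : 0 < ‖h‖ := norm_pos_iff.2 hh
    rw [← ofReal_norm (w ‖h‖), Real.norm_of_nonneg (by positivity), ENNReal.ofReal_div_of_pos
      (by positivity), ENNReal.ofReal_pow (by positivity), ENNReal.ofReal_pow (by positivity),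
      ENNReal.ofReal_min, ofReal_norm, ENNReal.ofReal_one]

/-- A function with a modulus of continuity of the form `a * min 1 |h|` has finite fractional
seminorm. -/
theorem lintegral_const_mul_min_lt_top (hk : 3 ≤ k) (hn : 1 ≤ n) {a : ℝ≥0∞} (ha : a ≠ ∞) :
    ∫⁻ h : EuclideanSpace ℝ (Fin n), (a * min 1 ‖h‖ₑ) ^ k / ‖h‖ₑ ^ (n + (k - 2)) < ∞ := by
  simp_rw [mul_pow, mul_div_assoc]
  rw [lintegral_const_mul' _ _ (by finiteness)]
  exact ENNReal.mul_lt_top (by finiteness) (lintegral_min_one_pow_div_lt_top hk hn)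

theorem le_mul_min_of_le {a b c : ℝ≥0∞} {t : ℝ≥0∞} (h1 : a ≤ b) (h2 : a ≤ t * c) :
    a ≤ (b + c) * min 1 t := by
  rcases le_total 1 t with h | h
  · rw [min_eq_left h, mul_one]
    exact h1.trans le_self_add
  · rw [min_eq_right h, mul_comm]
    exact h2.trans (by gcongr; exact le_add_self)

end Translations

/-! ### Functions of class `C_c²` as elements of the Besov space -/

section ToBesov

variable {n k : ℕ}

theorem gradient_apply (f : EuclideanSpace ℝ (Fin n) → ℝ) (x : EuclideanSpace ℝ (Fin n))
    (i : Fin n) : gradient f x i = partialDeriv i f x := by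
  have h : inner ℝ (gradient f x) (EuclideanSpace.single i 1) = gradient f x i := by
    rw [EuclideanSpace.inner_single_right]
    simp
  rw [← h, partialDeriv, ← toDual_gradient]
  rfl

theorem contDiff_gradient {f : EuclideanSpace ℝ (Fin n) → ℝ} {m m' : WithTop ℕ∞}
    (hf : ContDiff ℝ m f) (hm : m' + 1 ≤ m) : ContDiff ℝ m' (gradient f) :=
  (InnerProductSpace.toDual ℝ _).symm.contDiff.comp (hf.fderiv_right hm)

theorem norm_gradient_sub (f : EuclideanSpace ℝ (Fin n) → ℝ) (x y : EuclideanSpace ℝ (Fin n)) :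
    ‖gradient f x - gradient f y‖ = ‖fderiv ℝ f x - fderiv ℝ f y‖ := by
  rw [gradient, gradient, ← map_sub, LinearIsometryEquiv.norm_map]

theorem norm_gradient (f : EuclideanSpace ℝ (Fin n) → ℝ) (x : EuclideanSpace ℝ (Fin n)) :
    ‖gradient f x‖ = ‖fderiv ℝ f x‖ := by
  rw [gradient, LinearIsometryEquiv.norm_map]

theorem HasCompactSupport.gradient {f : EuclideanSpace ℝ (Fin n) → ℝ}
    (hf : HasCompactSupport f) : HasCompactSupport (gradient f) :=
  (hf.fderiv ℝ).comp_left (g := (InnerProductSpace.toDual ℝ (EuclideanSpace ℝ (Fin n))).symm)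
    (map_zero _)

theorem hasWeakGradient_gradient {f : EuclideanSpace ℝ (Fin n) → ℝ} (hf : ContDiff ℝ 1 f) :
    HasWeakGradient f (gradient f) := by
  intro φ i
  have h := integral_sum_partialDeriv_mul (n := n) {()} (fun _ => 1) (fun _ => i) (fun _ => f)
    (fun _ => φ) (fun _ => hf) (fun _ => φ.contDiff.of_le (by simp)) (fun _ => φ.hasCompactSupport)
  simp only [Finset.sum_singleton, one_mul] at h
  simp_rw [gradient_apply]
  rw [h, neg_neg]
  rfl

theorem memLp_Cc (f : CcSpace n 2) (p : ℝ≥0∞) : MemLp f p volume :=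
  f.continuous.memLp_of_hasCompactSupport f.hasCompactSupport

theorem CcSpace.contDiff_gradient (f : CcSpace n 2) : ContDiff ℝ 1 (gradient f) :=
  _root_.contDiff_gradient f.contDiff_two (by norm_num)

theorem memLp_gradient_Cc (f : CcSpace n 2) (p : ℝ≥0∞) : MemLp (gradient f) p volume :=
  f.contDiff_gradient.continuous.memLp_of_hasCompactSupport f.hasCompactSupport.gradient

/-- A `C_c¹` vector field has finite critical fractional seminorm. -/
theorem besovSeminorm_lt_top_of_contDiff (hk : 2 ≤ k) (hn : 1 ≤ n)
    {g : EuclideanSpace ℝ (Fin n) → EuclideanSpace ℝ (Fin n)} (hg : ContDiff ℝ 1 g)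
    (hc : HasCompactSupport g) : besovSeminorm (2 - 2 / (k : ℝ)) (k : ℝ≥0) g < ∞ := by
  rcases hk.eq_or_lt with rfl | hk3
  · rw [besovSeminorm_two]
    exact ENNReal.zero_lt_top
  · have hsm : StronglyMeasurable g := hg.continuous.stronglyMeasurable
    have h0 : eLpNorm g k volume ≠ ∞ := (hg.continuous.memLp_of_hasCompactSupport hc).2.ne
    have h1 : eLpNorm (fderiv ℝ g) k volume ≠ ∞ :=
      ((hg.continuous_fderiv one_ne_zero).memLp_of_hasCompactSupport (hc.fderiv ℝ)).2.ne
    have h2 : besovSeminorm (2 - 2 / (k : ℝ)) (k : ℝ≥0) g ^ k < ∞ := by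
      rw [besovSeminorm_pow_eq hk3, gagliardoIntegral_eq (by omega) _ hsm]
      refine lt_of_le_of_lt (lintegral_mono fun h => ?_) (lintegral_const_mul_min_lt_top hk3 hn
        (a := 2 * eLpNorm g k volume + eLpNorm (fderiv ℝ g) k volume) (by finiteness))
      gcongr
      exact le_mul_min_of_le (translationModulus_le_two_mul (by omega) hsm h)
        (translationModulus_le_enorm_mul hk hg h)
    exact (ENNReal.pow_lt_top_iff.1 h2).resolve_right (by omega)

variable [Fact (1 ≤ (k : ℝ≥0))]

/-- The class of a `C_c²` function in `B(2 - 2/k, k)`. -/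
noncomputable def toBesov (hk : 2 ≤ k) (hkn : k ≤ n) (f : CcSpace n 2) :
    BesovSpace n (2 - 2 / (k : ℝ)) k :=
  ⟨((memLp_Cc f _).toLp f, (memLp_gradient_Cc f _).toLp (gradient f)), by
    refine ⟨(hasWeakGradient_gradient (f.contDiff_two.of_le (by norm_num))).congr
      (memLp_Cc f _).coeFn_toLp.symm (memLp_gradient_Cc f _).coeFn_toLp.symm, ?_⟩
    rw [besovSeminorm_congr (memLp_gradient_Cc f _).coeFn_toLp]
    exact besovSeminorm_lt_top_of_contDiff hk (by omega) f.contDiff_gradient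
      f.hasCompactSupport.gradient⟩

theorem toBesov_represents (hk : 2 ≤ k) (hkn : k ≤ n) (f : CcSpace n 2) :
    (toBesov hk hkn f).Represents f := (memLp_Cc f _).coeFn_toLp

theorem toBesov_grad_ae (hk : 2 ≤ k) (hkn : k ≤ n) (f : CcSpace n 2) :
    (toBesov hk hkn f).grad =ᵐ[volume] gradient f := (memLp_gradient_Cc f _).coeFn_toLp

theorem BesovSpace.Represents.eq {s : ℝ} {p : ℝ≥0} [Fact (1 ≤ p)] {v w : BesovSpace n s p}
    {u : EuclideanSpace ℝ (Fin n) → ℝ} (hv : v.Represents u) (hw : w.Represents u) : v = w :=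
  BesovSpace.ext_val (Lp.ext (hv.trans hw.symm))

theorem toBesov_sub (hk : 2 ≤ k) (hkn : k ≤ n) (f g : CcSpace n 2) :
    toBesov hk hkn (f - g) = toBesov hk hkn f - toBesov hk hkn g := by
  refine (toBesov_represents hk hkn (f - g)).eq ?_
  refine (Lp.coeFn_sub (toBesov hk hkn f).val (toBesov hk hkn g).val).trans ?_
  exact (toBesov_represents hk hkn f).sub (toBesov_represents hk hkn g)

theorem toBesov_smul (hk : 2 ≤ k) (hkn : k ≤ n) (c : ℝ) (f : CcSpace n 2) :
    toBesov hk hkn (c • f) = c • toBesov hk hkn f := by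
  refine (toBesov_represents hk hkn (c • f)).eq ?_
  refine (Lp.coeFn_smul c (toBesov hk hkn f).val).trans ?_
  exact (toBesov_represents hk hkn f).const_smul c

theorem norm_toBesov (hk : 2 ≤ k) (hkn : k ≤ n) (f : CcSpace n 2) :
    ‖toBesov hk hkn f‖ = (eLpNorm f k volume).toReal + (eLpNorm (gradient f) k volume).toReal +
      (besovSeminorm (2 - 2 / (k : ℝ)) (k : ℝ≥0) (gradient f)).toReal := by
  rw [BesovSpace.norm_def, besovSeminorm_congr (toBesov_grad_ae hk hkn f), Lp.norm_def, Lp.norm_def,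
    eLpNorm_congr_ae (toBesov_represents hk hkn f), eLpNorm_congr_ae (toBesov_grad_ae hk hkn f)]
  simp

theorem lintegral_le_one_of_norm_toBesov_le (hk : 2 ≤ k) (hkn : k ≤ n) {f : CcSpace n 2}
    (hf : ‖toBesov hk hkn f‖ ≤ 1) :
    ∫⁻ x, ‖f x‖ₑ ^ k ≤ 1 ∧ ∫⁻ x, ‖fderiv ℝ f x‖ₑ ^ k ≤ 1 ∧
      (3 ≤ k → gagliardoIntegral k (n + (k - 2)) (fderiv ℝ f) ≤ 1) := by
  rw [norm_toBesov] at hf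
  have h1 := ENNReal.toReal_nonneg (a := eLpNorm f k volume)
  have h2 := ENNReal.toReal_nonneg (a := eLpNorm (gradient f) k volume)
  have h3 := ENNReal.toReal_nonneg
    (a := besovSeminorm (2 - 2 / (k : ℝ)) (k : ℝ≥0) (gradient f))
  have key : ∀ a : ℝ≥0∞, a ≠ ∞ → a.toReal ≤ 1 → a ≤ 1 := fun a ha h => by
    rw [← ENNReal.ofReal_toReal ha]
    exact ENNReal.ofReal_le_one.2 h
  refine ⟨?_, ?_, fun hk3 => ?_⟩
  · rw [← eLpNorm_natCast_pow (by omega)]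
    exact pow_le_one₀ zero_le (key _ (memLp_Cc f _).2.ne (by linarith))
  · have h4 : ∀ x, ‖fderiv ℝ f x‖ₑ = ‖gradient f x‖ₑ := fun x => by
      rw [← ofReal_norm, ← ofReal_norm, norm_gradient]
    simp_rw [h4]
    rw [← eLpNorm_natCast_pow (by omega)]
    exact pow_le_one₀ zero_le (key _ (memLp_gradient_Cc f _).2.ne (by linarith))
  · have h4 : gagliardoIntegral k (n + (k - 2)) (fderiv ℝ f) =
        gagliardoIntegral k (n + (k - 2)) (gradient f) := by
      unfold gagliardoIntegral
      refine lintegral_congr fun x => lintegral_congr fun y => ?_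
      rw [← ofReal_norm (fderiv ℝ f _ - _), ← ofReal_norm (gradient f _ - _), norm_gradient_sub]
    rw [h4, ← besovSeminorm_pow_eq hk3]
    exact pow_le_one₀ zero_le (key _ (besovSeminorm_lt_top_of_contDiff hk (by omega)
      f.contDiff_gradient f.hasCompactSupport.gradient).ne (by linarith))

end ToBesov

/-! ### The multilinear estimate in the Besov norm -/

section MollifyLimit

variable {n : ℕ} {F : Type*} [NormedAddCommGroup F] [NormedSpace ℝ F] [CompleteSpace F]

theorem mollifierAt_nonneg {t : ℝ} (ht : 0 < t) (y : EuclideanSpace ℝ (Fin n)) :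
    0 ≤ mollifierAt t y :=
  mul_nonneg (by positivity) (ContDiffBump.nonneg_normed _ _)

theorem integrable_mollifierAt {t : ℝ} (ht : 0 < t) :
    Integrable (mollifierAt t : EuclideanSpace ℝ (Fin n) → ℝ) :=
  (contDiff_mollifierAt t (m := 1)).continuous.integrable_of_hasCompactSupport
    (hasCompactSupport_mollifierAt ht)

theorem mollify_sub_const {t : ℝ} (ht : 0 < t) {f : EuclideanSpace ℝ (Fin n) → F}
    (hf : LocallyIntegrable f volume) (x : EuclideanSpace ℝ (Fin n)) (v : F) :
    mollify t f x - v = ∫ y, mollifierAt t y • (f (x - y) - v) := by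
  simp_rw [smul_sub]
  rw [integral_sub (integrable_mul_comp_sub hf (contDiff_mollifierAt t (m := 1)).continuous
    (hasCompactSupport_mollifierAt ht) x) ((integrable_mollifierAt ht).smul_const v),
    integral_smul_const, integral_mollifierAt ht, one_smul]
  rfl

theorem norm_mollify_sub_le {t : ℝ} (ht : 0 < t) {f : EuclideanSpace ℝ (Fin n) → F}
    (hf : LocallyIntegrable f volume) {x : EuclideanSpace ℝ (Fin n)} {v : F} {ε : ℝ}
    (h : ∀ y, ‖y‖ < t → ‖f (x - y) - v‖ ≤ ε) : ‖mollify t f x - v‖ ≤ ε := by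
  rw [mollify_sub_const ht hf]
  refine (norm_integral_le_of_norm_le ((integrable_mollifierAt ht).mul_const ε)
    (Filter.Eventually.of_forall fun y => ?_)).trans_eq ?_
  · rw [norm_smul, Real.norm_of_nonneg (mollifierAt_nonneg ht y)]
    rcases lt_or_ge ‖y‖ t with hy | hy
    · exact mul_le_mul_of_nonneg_left (h y hy) (mollifierAt_nonneg ht y)
    · simp [mollifierAt_eq_zero ht hy]
  · rw [integral_mul_const, integral_mollifierAt ht, one_mul]

theorem norm_mollify_le {t : ℝ} (ht : 0 < t) {f : EuclideanSpace ℝ (Fin n) → F}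
    (hf : LocallyIntegrable f volume) {M : ℝ} (h : ∀ y, ‖f y‖ ≤ M)
    (x : EuclideanSpace ℝ (Fin n)) : ‖mollify t f x‖ ≤ M := by
  simpa using norm_mollify_sub_le (v := 0) (x := x) ht hf fun y _ => by simpa using h (x - y)

theorem tendsto_mollify {f : EuclideanSpace ℝ (Fin n) → F} (hf : Continuous f)
    (x : EuclideanSpace ℝ (Fin n)) {t : ℕ → ℝ} (ht : ∀ j, 0 < t j)
    (ht0 : Filter.Tendsto t Filter.atTop (nhds 0)) :
    Filter.Tendsto (fun j => mollify (t j) f x) Filter.atTop (nhds (f x)) := by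
  rw [Metric.tendsto_atTop]
  intro ε hε
  obtain ⟨δ, hδ, h⟩ := Metric.continuousAt_iff.1 hf.continuousAt (ε / 2) (half_pos hε)
  obtain ⟨J, hJ⟩ := Metric.tendsto_atTop.1 ht0 δ hδ
  refine ⟨J, fun j hj => ?_⟩
  rw [dist_eq_norm]
  refine (norm_mollify_sub_le (ht j) hf.locallyIntegrable fun y hy => ?_).trans_lt (half_lt_self hε)
  have h1 := hJ j hj
  rw [Real.dist_0_eq_abs, abs_of_pos (ht j)] at h1
  rw [← dist_eq_norm]
  refine (h ?_).le
  rw [dist_eq_norm, sub_sub_cancel_left, norm_neg]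
  exact hy.trans h1

end MollifyLimit

section Estimate

variable {n k : ℕ}

theorem partialDeriv_partialDeriv_mollifyCc {t : ℝ} (ht : 0 < t) (f : CcSpace n 2) (i j : Fin n) :
    partialDeriv i (partialDeriv j (mollifyCc ht f)) =
      mollify t (partialDeriv i (partialDeriv j f)) := by
  rw [coe_mollifyCc, partialDeriv_mollify_of_contDiff t (f.contDiff_two.of_le (by norm_num))
    f.hasCompactSupport, partialDeriv_mollify_of_contDiff t
    (f.contDiff_two.partialDeriv (by norm_num) j) (f.hasCompactSupport.partialDeriv j)]

theorem tendsto_hessianForm_mollifyCc (φ : CcSpace n 2) (f : Fin k → CcSpace n 2) :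
    Filter.Tendsto (fun J : ℕ => hessianForm k φ fun m => mollifyCc (pow_pos one_half_pos J) (f m))
      Filter.atTop (nhds (hessianForm k φ f)) := by
  have hc : ∀ m i j, Continuous (partialDeriv i (partialDeriv j (f m))) := fun m i j =>
    (((f m).contDiff_two.partialDeriv (m' := 1) (by norm_num) j).partialDeriv (m' := 0)
      (by norm_num) i).continuous
  simp_rw [hessianForm_apply]
  refine tendsto_integral_of_dominated_convergence
    (fun x => (∑ r : Fin k → Fin n, ∑ c : Fin k → Fin n,
      ‖(kroneckerSymbol r c : ℝ)‖ * ∏ m, hessianSupNorm (f m)) * ‖φ x‖)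
    (fun J => (integrable_mixedHessian_mul _ φ).aestronglyMeasurable)
    ((φ.continuous.integrable_of_hasCompactSupport φ.hasCompactSupport).norm.const_mul _)
    (fun J => Filter.Eventually.of_forall fun x => ?_) (Filter.Eventually.of_forall fun x => ?_)
  · rw [norm_mul]
    gcongr
    refine norm_sum_le_of_le _ fun r _ => norm_sum_le_of_le _ fun c _ => ?_
    rw [norm_mul, norm_prod]
    gcongr with m
    change ‖partialDeriv (r m) (partialDeriv (c m) (mollifyCc (pow_pos one_half_pos J) (f m))) x‖ ≤ _
    rw [partialDeriv_partialDeriv_mollifyCc]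
    exact norm_mollify_le (pow_pos one_half_pos J) (hc _ _ _).locallyIntegrable
      (fun y => abs_partialDeriv_partialDeriv_le (f m) _ _ y) x
  · refine Filter.Tendsto.mul_const _ ?_
    refine tendsto_finsetSum _ fun r _ => tendsto_finsetSum _ fun c _ => ?_
    refine Filter.Tendsto.const_mul _ (tendsto_finsetProd _ fun m _ => ?_)
    simp_rw [Matrix.of_apply, partialDeriv_partialDeriv_mollifyCc]
    exact tendsto_mollify (hc _ _ _) x (fun J => pow_pos one_half_pos J)
      (tendsto_pow_atTop_nhds_zero_of_lt_one (by norm_num) (by norm_num))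

variable [Fact (1 ≤ (k : ℝ≥0))]

theorem eq_zero_of_toBesov_eq_zero (hk : 2 ≤ k) (hkn : k ≤ n) {f : CcSpace n 2}
    (h : toBesov hk hkn f = 0) : f = 0 := by
  have h1 : (toBesov hk hkn f).val =ᵐ[volume] (0 : EuclideanSpace ℝ (Fin n) → ℝ) := by
    rw [h]
    exact Lp.coeFn_zero _ _ _
  have h2 : ⇑f = 0 := (f.continuous.ae_eq_iff_eq volume continuous_const).1
    ((toBesov_represents hk hkn f).symm.trans h1)
  exact DFunLike.coe_injective h2

/-- The `k`-Hessian form is bounded on `B(2 - 2/k, k)^k`, by the sup norm of the Hessian of the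
test function. -/
theorem exists_abs_hessianForm_le (hk : 2 ≤ k) (hkn : k ≤ n) :
    ∃ C : ℝ, 0 ≤ C ∧ ∀ (φ : CcSpace n 2) (f : Fin k → CcSpace n 2),
      |hessianForm k φ f| ≤ C * (∏ m, ‖toBesov hk hkn (f m)‖) * hessianSupNorm φ := by
  obtain ⟨C, hC, h⟩ := exists_enorm_hessianForm_mollify_le hk hkn
  refine ⟨C.toReal, ENNReal.toReal_nonneg, fun φ f => ?_⟩
  have key : ∀ f : Fin k → CcSpace n 2, (∀ m, ‖toBesov hk hkn (f m)‖ ≤ 1) →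
      |hessianForm k φ f| ≤ C.toReal * hessianSupNorm φ := by
    intro f hf
    have h1 : ‖hessianForm k φ f‖ₑ ≤ C * ENNReal.ofReal (hessianSupNorm φ) :=
      le_of_tendsto (tendsto_hessianForm_mollifyCc φ f).enorm (Filter.Eventually.of_forall
        (h f φ (fun m => (lintegral_le_one_of_norm_toBesov_le hk hkn (hf m)).1)
          (fun m => (lintegral_le_one_of_norm_toBesov_le hk hkn (hf m)).2.1)
          fun hk3 m => (lintegral_le_one_of_norm_toBesov_le hk hkn (hf m)).2.2 hk3))
    have h2 := ENNReal.toReal_mono (by finiteness) h1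
    rwa [ENNReal.toReal_mul, toReal_enorm, ENNReal.toReal_ofReal (hessianSupNorm_nonneg _)] at h2
  -- normalize the functions, unless one of them vanishes
  by_cases h0 : ∃ m, toBesov hk hkn (f m) = 0
  · obtain ⟨m, hm⟩ := h0
    rw [(hessianForm k φ).map_coord_zero m (eq_zero_of_toBesov_eq_zero hk hkn hm), abs_zero]
    exact mul_nonneg (mul_nonneg ENNReal.toReal_nonneg (Finset.prod_nonneg fun _ _ => norm_nonneg _))
      (hessianSupNorm_nonneg _)
  · push Not at h0
    have h1 : ∀ m, 0 < ‖toBesov hk hkn (f m)‖ := fun m => norm_pos_iff.2 (h0 m)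
    have h2 := key (fun m => ‖toBesov hk hkn (f m)‖⁻¹ • f m) fun m => by
      rw [toBesov_smul, norm_smul, norm_inv, norm_norm, inv_mul_cancel₀ (h1 m).ne']
    rw [MultilinearMap.map_smul_univ, smul_eq_mul, abs_mul, Finset.prod_inv_distrib, abs_inv,
      abs_of_pos (Finset.prod_pos fun m _ => h1 m), inv_mul_le_iff₀ (Finset.prod_pos fun m _ => h1 m)]
      at h2
    exact h2.trans_eq (by ring)

end Estimate

/-! ### Mollification and cut-off in `L^k` -/

section MollifyLp

variable {n k : ℕ} {F : Type*} [NormedAddCommGroup F] [NormedSpace ℝ F]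

theorem lintegral_ofReal_mollifierAt {t : ℝ} (ht : 0 < t) :
    ∫⁻ y : EuclideanSpace ℝ (Fin n), ENNReal.ofReal (mollifierAt t y) = 1 := by
  rw [← ofReal_integral_eq_lintegral_ofReal (integrable_mollifierAt ht)
    (Filter.Eventually.of_forall fun y => mollifierAt_nonneg ht y), integral_mollifierAt ht,
    ENNReal.ofReal_one]

/-- Jensen's inequality for averages against the mollifier. -/
theorem lintegral_enorm_integral_mollifierAt_smul_pow_le (hk : 2 ≤ k) {t : ℝ} (ht : 0 < t)
    {H : EuclideanSpace ℝ (Fin n) → EuclideanSpace ℝ (Fin n) → F}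
    (hH : StronglyMeasurable (Function.uncurry H)) :
    ∫⁻ x, ‖∫ y, mollifierAt t y • H x y‖ₑ ^ k ≤
      ∫⁻ y, ENNReal.ofReal (mollifierAt t y) * ∫⁻ x, ‖H x y‖ₑ ^ k := by
  have hη : Measurable fun y : EuclideanSpace ℝ (Fin n) => ENNReal.ofReal (mollifierAt t y) :=
    (contDiff_mollifierAt t (m := 1)).continuous.measurable.ennreal_ofReal
  have hm : Measurable fun q : EuclideanSpace ℝ (Fin n) × EuclideanSpace ℝ (Fin n) =>
      ‖H q.1 q.2‖ₑ := hH.enorm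
  have h1 : ∀ x, ‖∫ y, mollifierAt t y • H x y‖ₑ ^ k ≤
      ∫⁻ y, ENNReal.ofReal (mollifierAt t y) * ‖H x y‖ₑ ^ k := by
    intro x
    have hmx : Measurable fun y => ‖H x y‖ₑ := hm.comp measurable_prodMk_left
    have h2 : ‖∫ y, mollifierAt t y • H x y‖ₑ ≤
        ∫⁻ y, ENNReal.ofReal (mollifierAt t y) * ‖H x y‖ₑ := by
      refine (enorm_integral_le_lintegral_enorm _).trans_eq (lintegral_congr fun y => ?_)
      rw [enorm_smul, Real.enorm_of_nonneg (mollifierAt_nonneg ht y)]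
    have h3 := pow_setLIntegral_le (s := Set.univ) (μ := volume.withDensity
      fun y : EuclideanSpace ℝ (Fin n) => ENNReal.ofReal (mollifierAt t y)) hmx.aemeasurable hk
    rw [Measure.restrict_univ, withDensity_apply _ MeasurableSet.univ, Measure.restrict_univ,
      lintegral_ofReal_mollifierAt ht, one_pow, one_mul, lintegral_withDensity_eq_lintegral_mul _ hη hmx,
      lintegral_withDensity_eq_lintegral_mul _ hη (hmx.pow_const k)] at h3
    exact (pow_le_pow_left' h2 k).trans h3
  refine (lintegral_mono h1).trans_eq ?_
  rw [lintegral_lintegral_swap]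
  · refine lintegral_congr fun y => ?_
    rw [lintegral_const_mul' _ _ ENNReal.ofReal_ne_top]
  · exact ((hη.comp measurable_snd).mul (hm.pow_const k)).aemeasurable

theorem lintegral_enorm_integral_mollifierAt_smul_pow_le_of_le (hk : 2 ≤ k) {t : ℝ} (ht : 0 < t)
    {H : EuclideanSpace ℝ (Fin n) → EuclideanSpace ℝ (Fin n) → F}
    (hH : StronglyMeasurable (Function.uncurry H)) {B : ℝ≥0∞}
    (hB : ∀ y, ‖y‖ < t → eLpNorm (fun x => H x y) k volume ≤ B) :
    eLpNorm (fun x => ∫ y, mollifierAt t y • H x y) k volume ≤ B := by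
  refine (ENNReal.pow_le_pow_left_iff (n := k) (by omega)).1 ?_
  rw [eLpNorm_natCast_pow (by omega)]
  refine (lintegral_enorm_integral_mollifierAt_smul_pow_le hk ht hH).trans ?_
  calc _ ≤ ∫⁻ y : EuclideanSpace ℝ (Fin n), ENNReal.ofReal (mollifierAt t y) * B ^ k := by
        refine lintegral_mono fun y => ?_
        rcases lt_or_ge ‖y‖ t with hy | hy
        · gcongr
          rw [← eLpNorm_natCast_pow (by omega)]
          gcongr
          exact hB y hy
        · simp [mollifierAt_eq_zero ht hy]
    _ = B ^ k := by
        rw [lintegral_mul_const _ (contDiff_mollifierAt t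
          (m := 1)).continuous.measurable.ennreal_ofReal, lintegral_ofReal_mollifierAt ht, one_mul]

theorem eLpNorm_mollify_le (hk : 2 ≤ k) {t : ℝ} (ht : 0 < t) {G : EuclideanSpace ℝ (Fin n) → F}
    (hG : StronglyMeasurable G) :
    eLpNorm (mollify t G) k volume ≤ eLpNorm G k volume :=
  lintegral_enorm_integral_mollifierAt_smul_pow_le_of_le (H := fun x y => G (x - y)) hk ht
    (hG.comp_measurable (measurable_fst.sub measurable_snd)) fun y _ => (eLpNorm_comp_sub hG _ y).le

theorem translationModulus_mollify_le (hk : 2 ≤ k) {t : ℝ} (ht : 0 < t)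
    {G : EuclideanSpace ℝ (Fin n) → F} (hG : StronglyMeasurable G) (hl : LocallyIntegrable G volume)
    (h : EuclideanSpace ℝ (Fin n)) :
    translationModulus k (mollify t G) h ≤ translationModulus k G h := by
  have h1 : (fun x => mollify t G (x - h) - mollify t G x) =
      mollify t fun x => G (x - h) - G x := by
    ext x
    have hi := fun z => integrable_mul_comp_sub hl (contDiff_mollifierAt t (m := 1)).continuous
      (hasCompactSupport_mollifierAt ht) z
    rw [mollify, mollify, ← integral_sub (hi _) (hi _), mollify]
    congr 1
    ext y
    rw [smul_sub, sub_right_comm]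
  rw [translationModulus, h1]
  exact eLpNorm_mollify_le hk ht ((hG.comp_sub h).sub hG)

theorem tendsto_translationModulus {F : Type*} [NormedAddCommGroup F] (hk : 1 ≤ k)
    {G : EuclideanSpace ℝ (Fin n) → F} (hL : MemLp G k volume) :
    Filter.Tendsto (translationModulus k G) (nhds 0) (nhds 0) := by
  have : Fact ((1 : ℝ≥0∞) ≤ k) := ⟨by exact_mod_cast hk⟩
  have : Fact ((k : ℝ≥0∞) ≠ ∞) := ⟨by simp⟩
  have h1 : Continuous fun h : EuclideanSpace ℝ (Fin n) =>
      DomAddAct.mk (-h) +ᵥ hL.toLp G :=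
    (DomAddAct.continuous_mk.comp continuous_neg).vadd continuous_const
  have h2 : ∀ h, translationModulus k G h = edist (DomAddAct.mk (-h) +ᵥ hL.toLp G) (hL.toLp G) := by
    intro h
    rw [DomAddAct.mk_vadd_toLp, Lp.edist_toLp_toLp, translationModulus]
    congr 1
    ext x
    simp only [Pi.sub_apply, vadd_eq_add]
    rw [neg_add_eq_sub]
  have h3 := (h1.edist (continuous_const (y := hL.toLp G))).tendsto 0
  simp only [← h2] at h3
  rwa [show translationModulus k G 0 = 0 by simp [translationModulus]] at h3

theorem tendsto_eLpNorm_mollify_sub [CompleteSpace F] (hk : 2 ≤ k) {G : EuclideanSpace ℝ (Fin n) → F}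
    (hG : StronglyMeasurable G) (hL : MemLp G k volume) {t : ℕ → ℝ} (ht : ∀ j, 0 < t j)
    (ht0 : Filter.Tendsto t Filter.atTop (nhds 0)) :
    Filter.Tendsto (fun j => eLpNorm (mollify (t j) G - G) k volume) Filter.atTop (nhds 0) := by
  rw [ENNReal.tendsto_nhds_zero]
  intro ε hε
  have h1 := ENNReal.tendsto_nhds_zero.1 (tendsto_translationModulus (by omega) hL) ε hε
  obtain ⟨δ, hδ, h2⟩ := Metric.eventually_nhds_iff.1 h1
  filter_upwards [ht0.eventually (gt_mem_nhds hδ)] with j hj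
  have hl : LocallyIntegrable G volume := hL.locallyIntegrable (by exact_mod_cast (by omega : 1 ≤ k))
  have h3 : mollify (t j) G - G = fun x => ∫ y, mollifierAt (t j) y • (G (x - y) - G x) := by
    ext x
    rw [Pi.sub_apply, mollify_sub_const (ht j) hl]
  rw [h3]
  refine lintegral_enorm_integral_mollifierAt_smul_pow_le_of_le hk (ht j)
    (H := fun x y => G (x - y) - G x)
    ((hG.comp_measurable (measurable_fst.sub measurable_snd)).sub (hG.comp_measurable measurable_fst))
    fun y hy => ?_
  refine h2 ?_
  rw [dist_zero_right]
  exact hy.trans hj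

/-- The gradient of a mollification is the mollification of the weak gradient. -/
theorem gradient_mollify {t : ℝ} (ht : 0 < t) {u : EuclideanSpace ℝ (Fin n) → ℝ}
    {g : EuclideanSpace ℝ (Fin n) → EuclideanSpace ℝ (Fin n)} (hu : LocallyIntegrable u volume)
    (hg : LocallyIntegrable g volume) (h : HasWeakGradient u g) :
    gradient (mollify t u) = mollify t g := by
  ext x i
  have hs : ContDiff ℝ ((⊤ : ℕ∞) : WithTop ℕ∞) (fun z => mollifierAt t (x - z) : EuclideanSpace ℝ (Fin n) → ℝ) :=
    (contDiff_mollifierAt t (m := ⊤)).comp (contDiff_const.sub contDiff_id)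
  have hsupp : HasCompactSupport (fun z => mollifierAt t (x - z) : EuclideanSpace ℝ (Fin n) → ℝ) :=
    (hasCompactSupport_mollifierAt ht).comp_homeomorph (Homeomorph.subLeft x)
  have h1 := h ⟨_, hs, hsupp, by simp⟩ i
  have h2 : ∀ z, fderiv ℝ (fun z => mollifierAt t (x - z)) z (EuclideanSpace.single i 1) =
      -partialDeriv i (mollifierAt t) (x - z) := by
    intro z
    have h3 : HasFDerivAt (fun z => mollifierAt t (x - z) : EuclideanSpace ℝ (Fin n) → ℝ) _ z :=
      (((contDiff_mollifierAt t (m := 1)).differentiable one_ne_zero (x - z)).hasFDerivAt).comp z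
        ((hasFDerivAt_id z).const_sub x)
    rw [h3.fderiv]
    simp [partialDeriv]
  have h4 : ∫ z, u z * partialDeriv i (mollifierAt t) (x - z) =
      ∫ z, g z i * mollifierAt t (x - z) := by
    have h5 : ∫ z, u z * fderiv ℝ (fun z => mollifierAt t (x - z)) z (EuclideanSpace.single i 1) =
      -∫ z, g z i * mollifierAt t (x - z) := h1
    simp_rw [h2, mul_neg, integral_neg, neg_inj] at h5
    exact h5
  rw [gradient_apply, partialDeriv_mollify ht hu,
    ← integral_sub_left_eq_self (fun y => partialDeriv i (mollifierAt t) y * u (x - y)) _ x]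
  simp_rw [sub_sub_cancel]
  rw [← integral_sub_left_eq_self (fun y => g y i * mollifierAt t (x - y)) _ x] at h4
  simp_rw [sub_sub_cancel] at h4
  simp_rw [mul_comm (u _)] at h4
  rw [h4, mollify]
  have h6 : ∫ y, (mollifierAt t y • g (x - y)) i = (∫ y, mollifierAt t y • g (x - y)) i :=
    (EuclideanSpace.proj (𝕜 := ℝ) i).integral_comp_comm (integrable_mul_comp_sub hg
      (contDiff_mollifierAt t (m := 1)).continuous (hasCompactSupport_mollifierAt ht) x)
  rw [← h6]
  congr 1
  ext y
  rw [PiLp.smul_apply, smul_eq_mul, mul_comm]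

end MollifyLp

/-! ### Density of `C_c²` in the Besov space -/

section Cutoff

variable {n k : ℕ}

/-- The cut-off function `χ(t x)`, equal to one for `|x| ≤ 1/t`. -/
noncomputable def cutoff (t : ℝ) (x : EuclideanSpace ℝ (Fin n)) : ℝ :=
  (⟨1, 2, by norm_num, by norm_num⟩ : ContDiffBump (0 : EuclideanSpace ℝ (Fin n))) (t • x)

theorem contDiff_cutoff (t : ℝ) {m : ℕ∞} :
    ContDiff ℝ m (cutoff t : EuclideanSpace ℝ (Fin n) → ℝ) :=
  (ContDiffBump.contDiff _).comp (contDiff_const_smul t)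

theorem hasCompactSupport_cutoff {t : ℝ} (ht : 0 < t) :
    HasCompactSupport (cutoff t : EuclideanSpace ℝ (Fin n) → ℝ) :=
  (ContDiffBump.hasCompactSupport _).comp_homeomorph (Homeomorph.smulOfNeZero t ht.ne')

theorem cutoff_nonneg (t : ℝ) (x : EuclideanSpace ℝ (Fin n)) : 0 ≤ cutoff t x :=
  ContDiffBump.nonneg _

theorem cutoff_le_one (t : ℝ) (x : EuclideanSpace ℝ (Fin n)) : cutoff t x ≤ 1 :=
  ContDiffBump.le_one _

theorem cutoff_eq_one {t : ℝ} {x : EuclideanSpace ℝ (Fin n)} (h : ‖t • x‖ ≤ 1) :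
    cutoff t x = 1 :=
  ContDiffBump.one_of_mem_closedBall _ (by simpa using h)

theorem gradient_cutoff (t : ℝ) (x : EuclideanSpace ℝ (Fin n)) :
    gradient (cutoff t) x = t • gradient (cutoff 1) (t • x) := by
  have h : (cutoff t : EuclideanSpace ℝ (Fin n) → ℝ) = fun x => cutoff 1 (t • x) := by
    ext x
    simp [cutoff]
  rw [h, gradient, gradient, fderiv_comp_smul, map_smul]

/-- Bounds, uniform for `t ≤ 1`, on the first two derivatives of the cut-off functions. -/
theorem exists_cutoff_bound (n : ℕ) : ∃ K : ℝ, 0 ≤ K ∧ ∀ t : ℝ, 0 < t → t ≤ 1 →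
    ∀ x y : EuclideanSpace ℝ (Fin n), |cutoff t x - cutoff t y| ≤ K * min 1 ‖x - y‖ ∧
      ‖gradient (cutoff t) x‖ ≤ K * t ∧
      ‖gradient (cutoff t) x - gradient (cutoff t) y‖ ≤ K * min 1 ‖x - y‖ := by
  have hg : ContDiff ℝ 1 (gradient (cutoff 1 : EuclideanSpace ℝ (Fin n) → ℝ)) :=
    contDiff_gradient (contDiff_cutoff 1 (m := 2)) (by norm_num)
  have hc := hasCompactSupport_cutoff (n := n) one_pos
  obtain ⟨A, hA⟩ := hg.continuous.bounded_above_of_compact_support hc.gradient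
  obtain ⟨B, hB⟩ := (hg.continuous_fderiv one_ne_zero).bounded_above_of_compact_support
    (hc.gradient.fderiv ℝ)
  have hA0 : 0 ≤ A := (norm_nonneg _).trans (hA 0)
  have hB0 : 0 ≤ B := (norm_nonneg _).trans (hB 0)
  have h1 : ∀ x y : EuclideanSpace ℝ (Fin n), |cutoff 1 x - cutoff 1 y| ≤ A * ‖x - y‖ := fun x y =>
    convex_univ.norm_image_sub_le_of_norm_fderiv_le
      (fun z _ => (contDiff_cutoff 1 (m := 1)).differentiable one_ne_zero z)
      (fun z _ => (norm_gradient _ z).symm.trans_le (hA z)) (Set.mem_univ y) (Set.mem_univ x)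
  have h2 : ∀ x y : EuclideanSpace ℝ (Fin n),
      ‖gradient (cutoff 1) x - gradient (cutoff 1) y‖ ≤ B * ‖x - y‖ := fun x y =>
    convex_univ.norm_image_sub_le_of_norm_fderiv_le
      (fun z _ => hg.differentiable one_ne_zero z) (fun z _ => hB z) (Set.mem_univ y)
      (Set.mem_univ x)
  have key : ∀ a r : ℝ, 0 ≤ r → a ≤ 2 + 2 * A → a ≤ (A + B) * r →
      a ≤ (2 + 2 * A + B) * min 1 r := by
    intro a r hr h3 h4
    rcases le_total 1 r with h | h
    · rw [min_eq_left h]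
      linarith
    · rw [min_eq_right h]
      nlinarith [mul_nonneg hA0 hr]
  refine ⟨2 + 2 * A + B, by positivity, fun t ht ht1 x y => ⟨?_, ?_, ?_⟩⟩
  · refine key _ _ (norm_nonneg _) ?_ ?_
    · rw [abs_le]
      constructor <;> linarith [cutoff_nonneg t x, cutoff_nonneg t y, cutoff_le_one t x,
        cutoff_le_one t y]
    · have h3 := h1 (t • x) (t • y)
      have h4 : ∀ z : EuclideanSpace ℝ (Fin n), cutoff 1 (t • z) = cutoff t z := fun z => by
        simp [cutoff]
      rw [h4, h4, ← smul_sub, norm_smul, Real.norm_of_nonneg ht.le] at h3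
      refine h3.trans ?_
      gcongr
      · linarith
      · exact mul_le_of_le_one_left (norm_nonneg _) ht1
  · rw [gradient_cutoff, norm_smul, Real.norm_of_nonneg ht.le, mul_comm]
    have h3 := hA (t • x)
    gcongr
    linarith
  · rw [gradient_cutoff t x, gradient_cutoff t y, ← smul_sub, norm_smul, Real.norm_of_nonneg ht.le]
    have h5 : t * ‖gradient (cutoff 1) (t • x) - gradient (cutoff 1) (t • y)‖ ≤
        ‖gradient (cutoff 1) (t • x) - gradient (cutoff 1) (t • y)‖ :=
      mul_le_of_le_one_left (norm_nonneg _) ht1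
    refine key _ _ (norm_nonneg _) ?_ ?_
    · refine h5.trans ((norm_sub_le _ _).trans ?_)
      linarith [hA (t • x), hA (t • y)]
    · have h3 := h2 (t • x) (t • y)
      rw [← smul_sub, norm_smul, Real.norm_of_nonneg ht.le] at h3
      refine h5.trans (h3.trans ?_)
      gcongr
      · linarith
      · exact mul_le_of_le_one_left (norm_nonneg _) ht1

end Cutoff

section Convergence

variable {n k : ℕ} {F F' : Type*} [NormedAddCommGroup F] [NormedAddCommGroup F']

theorem translationModulus_le_of_norm_sub_le (hk : 1 ≤ k) {G : EuclideanSpace ℝ (Fin n) → F'}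
    {H : EuclideanSpace ℝ (Fin n) → F} (hH : StronglyMeasurable H) {h : EuclideanSpace ℝ (Fin n)}
    {M c : ℝ} (hM : 0 ≤ M) (hc : 0 ≤ c)
    (hG : ∀ x, ‖G (x - h) - G x‖ ≤ M * ‖H (x - h) - H x‖ + c * ‖H x‖) :
    translationModulus k G h ≤
      ENNReal.ofReal M * translationModulus k H h + ENNReal.ofReal c * eLpNorm H k volume := by
  calc translationModulus k G h
      ≤ eLpNorm ((M • fun x => ‖H (x - h) - H x‖) + c • fun x => ‖H x‖) k volume :=
        eLpNorm_mono_real hG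
    _ ≤ eLpNorm (M • fun x => ‖H (x - h) - H x‖) k volume +
        eLpNorm (c • fun x => ‖H x‖) k volume :=
        eLpNorm_add_le (((hH.comp_sub h).sub hH).norm.const_smul M).aestronglyMeasurable
          (hH.norm.const_smul c).aestronglyMeasurable (by exact_mod_cast hk)
    _ = _ := by
        rw [eLpNorm_const_smul, eLpNorm_const_smul, eLpNorm_norm, eLpNorm_norm,
          Real.enorm_of_nonneg hM, Real.enorm_of_nonneg hc]
        rfl

theorem ENNReal.tendsto_zero_of_tendsto_pow (hk : k ≠ 0) {a : ℕ → ℝ≥0∞}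
    (h : Filter.Tendsto (fun j => a j ^ k) Filter.atTop (nhds 0)) :
    Filter.Tendsto a Filter.atTop (nhds 0) := by
  have hk' : (0 : ℝ) < k := by positivity
  have h1 := ((ENNReal.continuous_rpow_const (y := 1 / (k : ℝ))).tendsto 0).comp h
  rw [ENNReal.zero_rpow_of_pos (by positivity)] at h1
  refine h1.congr fun j => ?_
  rw [Function.comp_apply, ← ENNReal.rpow_natCast, ← ENNReal.rpow_mul, mul_one_div_cancel hk'.ne',
    ENNReal.rpow_one]

variable [NormedSpace ℝ F]

theorem tendsto_eLpNorm_cutoff_smul_sub (hk : k ≠ 0) {G : EuclideanSpace ℝ (Fin n) → F}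
    (hG : StronglyMeasurable G) (hL : MemLp G k volume) {t : ℕ → ℝ}
    (ht0 : Filter.Tendsto t Filter.atTop (nhds 0)) :
    Filter.Tendsto (fun j => eLpNorm (fun x => cutoff (t j) x • G x - G x) k volume)
      Filter.atTop (nhds 0) := by
  refine ENNReal.tendsto_zero_of_tendsto_pow hk ?_
  simp_rw [eLpNorm_natCast_pow hk]
  have hfin : ∫⁻ x, ‖G x‖ₑ ^ k ≠ ∞ := by
    rw [← eLpNorm_natCast_pow hk]
    exact ENNReal.pow_ne_top hL.2.ne
  have h := tendsto_lintegral_of_dominated_convergence (μ := volume) (fun x => ‖G x‖ₑ ^ k)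
    (F := fun j x => ‖cutoff (t j) x • G x - G x‖ₑ ^ k) (f := fun _ => 0)
    (fun j => (((contDiff_cutoff (t j) (m := 1)).continuous.stronglyMeasurable.smul hG).sub
      hG).enorm.pow_const k) (fun j => Filter.Eventually.of_forall fun x => ?_) hfin
    (Filter.Eventually.of_forall fun x => ?_)
  · simpa using h
  · change ‖cutoff (t j) x • G x - G x‖ₑ ^ k ≤ ‖G x‖ₑ ^ k
    have h1 : cutoff (t j) x • G x - G x = (cutoff (t j) x - 1) • G x := by
      rw [sub_smul, one_smul]
    have h2 : ‖cutoff (t j) x - 1‖ₑ ≤ 1 := by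
      rw [← ofReal_norm, ENNReal.ofReal_le_one, Real.norm_eq_abs, abs_le]
      constructor <;> linarith [cutoff_nonneg (t j) x, cutoff_le_one (t j) x]
    rw [h1, enorm_smul]
    gcongr
    exact mul_le_of_le_one_left zero_le h2
  · have h1 : Filter.Tendsto (fun j => ‖t j • x‖) Filter.atTop (nhds 0) := by
      simpa using (ht0.smul_const x).norm
    refine tendsto_const_nhds.congr' ?_
    filter_upwards [h1.eventually (gt_mem_nhds one_pos)] with j hj
    rw [cutoff_eq_one hj.le]
    simp [hk]

theorem tendsto_eLpNorm_cutoff_smul_mollify_sub [CompleteSpace F] (hk : 2 ≤ k)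
    {G : EuclideanSpace ℝ (Fin n) → F} (hG : StronglyMeasurable G) (hL : MemLp G k volume)
    {t : ℕ → ℝ} (ht : ∀ j, 0 < t j) (ht0 : Filter.Tendsto t Filter.atTop (nhds 0)) :
    Filter.Tendsto (fun j => eLpNorm (fun x => cutoff (t j) x • mollify (t j) G x - G x) k volume)
      Filter.atTop (nhds 0) := by
  have hl : LocallyIntegrable G volume := hL.locallyIntegrable (by exact_mod_cast (by omega : 1 ≤ k))
  have h1 := (tendsto_eLpNorm_mollify_sub hk hG hL ht ht0).add
    (tendsto_eLpNorm_cutoff_smul_sub (by omega) hG hL ht0)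
  rw [add_zero] at h1
  refine tendsto_of_tendsto_of_tendsto_of_le_of_le tendsto_const_nhds h1 (fun _ => zero_le) fun j => ?_
  have hc : StronglyMeasurable (cutoff (t j) : EuclideanSpace ℝ (Fin n) → ℝ) :=
    (contDiff_cutoff (t j) (m := 1)).continuous.stronglyMeasurable
  have hm : StronglyMeasurable (mollify (t j) G) :=
    (contDiff_mollify (ht j) hl (m := 1)).continuous.stronglyMeasurable
  have h2 : (fun x => cutoff (t j) x • mollify (t j) G x - G x) =
      (fun x => cutoff (t j) x • (mollify (t j) G - G) x) +
        fun x => cutoff (t j) x • G x - G x := by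
    ext x
    simp only [Pi.add_apply, Pi.sub_apply, smul_sub]
    abel
  rw [h2]
  refine (eLpNorm_add_le (hc.smul (hm.sub hG)).aestronglyMeasurable
    ((hc.smul hG).sub hG).aestronglyMeasurable (by exact_mod_cast (by omega : 1 ≤ k))).trans ?_
  refine add_le_add ?_ le_rfl
  refine eLpNorm_mono fun x => ?_
  rw [Pi.smul_apply', norm_smul, Real.norm_of_nonneg (cutoff_nonneg _ _)]
  exact mul_le_of_le_one_left (norm_nonneg _) (cutoff_le_one _ _)

end Convergence

section Density

variable {n k : ℕ}

theorem gradient_mul {f g : EuclideanSpace ℝ (Fin n) → ℝ} (hf : ContDiff ℝ 1 f)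
    (hg : ContDiff ℝ 1 g) (x : EuclideanSpace ℝ (Fin n)) :
    gradient (fun x => f x * g x) x = f x • gradient g x + g x • gradient f x := by
  rw [gradient, fderiv_fun_mul (hf.differentiable one_ne_zero x) (hg.differentiable one_ne_zero x),
    map_add, map_smul, map_smul]
  rfl

/-- The mollified and cut off function `χ(t ·) (η_t * u)`. -/
noncomputable def smoothTruncation {t : ℝ} (ht : 0 < t) {u : EuclideanSpace ℝ (Fin n) → ℝ}
    (hu : LocallyIntegrable u volume) : CcSpace n 2 where
  toFun x := cutoff t x * mollify t u x
  contDiff' := (contDiff_cutoff t (m := 2)).mul (contDiff_mollify ht hu (m := 2))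
  hasCompactSupport' := (hasCompactSupport_cutoff ht).mul_right
  tsupport_subset' := fun _ _ => trivial

theorem gradient_smoothTruncation {t : ℝ} (ht : 0 < t) {u : EuclideanSpace ℝ (Fin n) → ℝ}
    {g : EuclideanSpace ℝ (Fin n) → EuclideanSpace ℝ (Fin n)} (hu : LocallyIntegrable u volume)
    (hg : LocallyIntegrable g volume) (h : HasWeakGradient u g) :
    gradient (smoothTruncation ht hu) = (fun x => cutoff t x • mollify t g x) +
      fun x => mollify t u x • gradient (cutoff t) x := by
  ext1 x
  refine (gradient_mul (contDiff_cutoff t (m := 1)) (contDiff_mollify ht hu (m := 1)) x).trans ?_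
  rw [gradient_mollify ht hu hg h]
  rfl

/-- A bound, uniform in the scale, for the modulus of continuity of the gradients of the mollified
and cut off functions. -/
theorem exists_translationModulus_gradient_smoothTruncation_le (hk : 2 ≤ k)
    {u : EuclideanSpace ℝ (Fin n) → ℝ} {g : EuclideanSpace ℝ (Fin n) → EuclideanSpace ℝ (Fin n)}
    (hum : StronglyMeasurable u) (hgm : StronglyMeasurable g) (huL : MemLp u k volume)
    (hgL : MemLp g k volume) (hu : LocallyIntegrable u volume) (hg : LocallyIntegrable g volume)
    (h : HasWeakGradient u g) :
    ∃ B : ℝ≥0∞, B ≠ ∞ ∧ ∀ (t : ℝ) (ht : 0 < t), t ≤ 1 → ∀ y,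
      translationModulus k (gradient (smoothTruncation ht hu) - g) y ≤
        2 * translationModulus k g y + B * min 1 ‖y‖ₑ := by
  obtain ⟨K, hK0, hK⟩ := exists_cutoff_bound n
  have hu0 := huL.2.ne
  have hg0 := hgL.2.ne
  have hk1 : 1 ≤ k := by omega
  refine ⟨ENNReal.ofReal K * eLpNorm g k volume +
    (ENNReal.ofReal K * (2 * eLpNorm u k volume + eLpNorm g k volume) +
      ENNReal.ofReal K * eLpNorm u k volume), by finiteness, fun t ht ht1 y => ?_⟩
  have hmin : ENNReal.ofReal (K * min 1 ‖y‖) = ENNReal.ofReal K * min 1 ‖y‖ₑ := by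
    rw [ENNReal.ofReal_mul hK0, ENNReal.ofReal_min, ofReal_norm, ENNReal.ofReal_one]
  have hmin0 : 0 ≤ K * min 1 ‖y‖ := by positivity
  have hUc : ContDiff ℝ 1 (mollify t u) := contDiff_mollify ht hu (m := 1)
  have hUm : StronglyMeasurable (mollify t u) := hUc.continuous.stronglyMeasurable
  have hGm : StronglyMeasurable (mollify t g) :=
    (contDiff_mollify ht hg (m := 1)).continuous.stronglyMeasurable
  have hcm : StronglyMeasurable (cutoff t : EuclideanSpace ℝ (Fin n) → ℝ) :=
    (contDiff_cutoff t (m := 1)).continuous.stronglyMeasurable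
  have hcgm : StronglyMeasurable (gradient (cutoff t : EuclideanSpace ℝ (Fin n) → ℝ)) :=
    (contDiff_gradient (contDiff_cutoff t (m := 1)) (m' := 0)
      (by norm_num)).continuous.stronglyMeasurable
  have hsub : ∀ x : EuclideanSpace ℝ (Fin n), ‖x - y - x‖ = ‖y‖ := fun x => by
    rw [sub_sub_cancel_left, norm_neg]
  -- the contribution of the mollified gradient
  have h1 : translationModulus k (fun x => cutoff t x • mollify t g x) y ≤
      translationModulus k g y + ENNReal.ofReal K * min 1 ‖y‖ₑ * eLpNorm g k volume := by
    refine (translationModulus_le_of_norm_sub_le hk1 hGm zero_le_one hmin0 fun x => ?_).trans ?_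
    · have h2 : cutoff t (x - y) • mollify t g (x - y) - cutoff t x • mollify t g x =
          cutoff t (x - y) • (mollify t g (x - y) - mollify t g x) +
            (cutoff t (x - y) - cutoff t x) • mollify t g x := by
        rw [smul_sub, sub_smul]
        abel
      rw [h2]
      refine (norm_add_le _ _).trans ?_
      rw [norm_smul, norm_smul, Real.norm_of_nonneg (cutoff_nonneg _ _), Real.norm_eq_abs]
      have h3 := (hK t ht ht1 (x - y) x).1
      rw [hsub] at h3
      gcongr
      exact cutoff_le_one _ _
    · rw [hmin, ENNReal.ofReal_one, one_mul]
      gcongr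
      · exact translationModulus_mollify_le hk ht hgm hg y
      · exact eLpNorm_mollify_le hk ht hgm
  -- the contribution of the gradient of the cut-off function
  have h2 : translationModulus k (fun x => mollify t u x • gradient (cutoff t) x) y ≤
      ENNReal.ofReal K * ((2 * eLpNorm u k volume + eLpNorm g k volume) * min 1 ‖y‖ₑ) +
        ENNReal.ofReal K * min 1 ‖y‖ₑ * eLpNorm u k volume := by
    refine (translationModulus_le_of_norm_sub_le hk1 hUm hK0 hmin0 fun x => ?_).trans ?_
    · have h2 : mollify t u (x - y) • gradient (cutoff t) (x - y) -
          mollify t u x • gradient (cutoff t) x =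
          (mollify t u (x - y) - mollify t u x) • gradient (cutoff t) (x - y) +
            mollify t u x • (gradient (cutoff t) (x - y) - gradient (cutoff t) x) := by
        rw [smul_sub, sub_smul]
        abel
      rw [h2]
      refine (norm_add_le _ _).trans ?_
      rw [norm_smul, norm_smul, mul_comm, mul_comm ‖mollify t u x‖]
      have h3 := (hK t ht ht1 (x - y) x).2
      rw [hsub] at h3
      gcongr
      · exact h3.1.trans (mul_le_of_le_one_right hK0 ht1)
      · exact h3.2
    · rw [hmin]
      have h4 := eLpNorm_mollify_le hk ht hum
      gcongr
      refine le_mul_min_of_le ((translationModulus_le_two_mul hk1 hUm y).trans (by gcongr))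
        ((translationModulus_le_enorm_mul hk hUc y).trans ?_)
      gcongr
      refine le_trans (le_of_eq ?_) (eLpNorm_mollify_le hk ht hgm)
      refine eLpNorm_congr_norm_ae (Filter.Eventually.of_forall fun x => ?_)
      rw [← norm_gradient, gradient_mollify ht hu hg h]
  rw [gradient_smoothTruncation ht hu hg h]
  refine (translationModulus_sub_le hk1 ((hcm.smul hGm).add (hUm.smul hcgm)) hgm y).trans ?_
  refine (add_le_add_left ((translationModulus_add_le hk1 (hcm.smul hGm) (hUm.smul hcgm) y).trans
    (add_le_add h1 h2)) _).trans_eq ?_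
  ring

theorem tendsto_eLpNorm_gradient_smoothTruncation_sub (hk : 2 ≤ k)
    {u : EuclideanSpace ℝ (Fin n) → ℝ} {g : EuclideanSpace ℝ (Fin n) → EuclideanSpace ℝ (Fin n)}
    (hum : StronglyMeasurable u) (hgm : StronglyMeasurable g) (huL : MemLp u k volume)
    (hgL : MemLp g k volume) (hu : LocallyIntegrable u volume) (hg : LocallyIntegrable g volume)
    (h : HasWeakGradient u g) {t : ℕ → ℝ} (ht : ∀ j, 0 < t j) (ht1 : ∀ j, t j ≤ 1)
    (ht0 : Filter.Tendsto t Filter.atTop (nhds 0)) :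
    Filter.Tendsto (fun j => eLpNorm (gradient (smoothTruncation (ht j) hu) - g) k volume)
      Filter.atTop (nhds 0) := by
  obtain ⟨K, hK0, hK⟩ := exists_cutoff_bound n
  have h1 : Filter.Tendsto (fun j => ENNReal.ofReal (K * t j) * eLpNorm u k volume)
      Filter.atTop (nhds 0) := by
    have h2 : Filter.Tendsto (fun j => ENNReal.ofReal (K * t j)) Filter.atTop (nhds 0) := by
      simpa using ENNReal.tendsto_ofReal (ht0.const_mul K)
    simpa using ENNReal.Tendsto.mul_const h2 (Or.inr huL.2.ne)
  have h3 := (tendsto_eLpNorm_cutoff_smul_mollify_sub hk hgm hgL ht ht0).add h1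
  rw [add_zero] at h3
  refine tendsto_of_tendsto_of_tendsto_of_le_of_le tendsto_const_nhds h3 (fun _ => zero_le) fun j => ?_
  have hUm : StronglyMeasurable (mollify (t j) u) :=
    (contDiff_mollify (ht j) hu (m := 1)).continuous.stronglyMeasurable
  have hGm : StronglyMeasurable (mollify (t j) g) :=
    (contDiff_mollify (ht j) hg (m := 1)).continuous.stronglyMeasurable
  have hcm : StronglyMeasurable (cutoff (t j) : EuclideanSpace ℝ (Fin n) → ℝ) :=
    (contDiff_cutoff (t j) (m := 1)).continuous.stronglyMeasurable
  have hcgm : StronglyMeasurable (gradient (cutoff (t j) : EuclideanSpace ℝ (Fin n) → ℝ)) :=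
    (contDiff_gradient (contDiff_cutoff (t j) (m := 1)) (m' := 0)
      (by norm_num)).continuous.stronglyMeasurable
  have h4 : gradient (smoothTruncation (ht j) hu) - g =
      (fun x => cutoff (t j) x • mollify (t j) g x - g x) +
        fun x => mollify (t j) u x • gradient (cutoff (t j)) x := by
    rw [gradient_smoothTruncation (ht j) hu hg h]
    ext1 x
    simp only [Pi.add_apply, Pi.sub_apply]
    abel
  change eLpNorm (gradient (smoothTruncation (ht j) hu) - g) k volume ≤ _
  rw [h4]
  refine (eLpNorm_add_le ((hcm.smul hGm).sub hgm).aestronglyMeasurable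
    (hUm.smul hcgm).aestronglyMeasurable (by exact_mod_cast (by omega : 1 ≤ k))).trans ?_
  refine add_le_add le_rfl ?_
  refine (eLpNorm_le_mul_eLpNorm_of_ae_le_mul (c := K * t j) (g := mollify (t j) u)
    (Filter.Eventually.of_forall fun x => ?_) k).trans ?_
  · rw [Pi.smul_apply', norm_smul, mul_comm]
    gcongr
    exact (hK (t j) (ht j) (ht1 j) x x).2.1
  · gcongr
    exact eLpNorm_mollify_le hk (ht j) hum

theorem tendsto_besovSeminorm_gradient_smoothTruncation_sub (hk : 2 ≤ k) (hn : 1 ≤ n)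
    {u : EuclideanSpace ℝ (Fin n) → ℝ} {g : EuclideanSpace ℝ (Fin n) → EuclideanSpace ℝ (Fin n)}
    (hum : StronglyMeasurable u) (hgm : StronglyMeasurable g) (huL : MemLp u k volume)
    (hgL : MemLp g k volume) (hu : LocallyIntegrable u volume) (hg : LocallyIntegrable g volume)
    (h : HasWeakGradient u g) (hB : besovSeminorm (2 - 2 / (k : ℝ)) (k : ℝ≥0) g < ∞)
    {t : ℕ → ℝ} (ht : ∀ j, 0 < t j) (ht1 : ∀ j, t j ≤ 1)
    (ht0 : Filter.Tendsto t Filter.atTop (nhds 0)) :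
    Filter.Tendsto (fun j => besovSeminorm (2 - 2 / (k : ℝ)) (k : ℝ≥0)
      (gradient (smoothTruncation (ht j) hu) - g)) Filter.atTop (nhds 0) := by
  rcases hk.eq_or_lt with rfl | hk3
  · simp_rw [besovSeminorm_two]
    exact tendsto_const_nhds
  obtain ⟨B, hB', hω⟩ := exists_translationModulus_gradient_smoothTruncation_le hk hum hgm huL hgL
    hu hg h
  have hm : ∀ j, StronglyMeasurable (gradient (smoothTruncation (ht j) hu) - g) := fun j =>
    (CcSpace.contDiff_gradient _).continuous.stronglyMeasurable.sub hgm
  have hωg : Measurable (translationModulus k g) := measurable_translationModulus (by omega) hgm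
  refine ENNReal.tendsto_zero_of_tendsto_pow (k := k) (by omega) ?_
  simp_rw [fun j => besovSeminorm_pow_eq hk3 (gradient (smoothTruncation (ht j) hu) - g),
    fun j => gagliardoIntegral_eq (k := k) (by omega) (n + (k - 2)) (hm j)]
  -- an integrable majorant
  let S : EuclideanSpace ℝ (Fin n) → ℝ≥0∞ := fun y =>
    4 ^ k * (translationModulus k g y ^ k / ‖y‖ₑ ^ (n + (k - 2))) +
      2 ^ k * ((B * min 1 ‖y‖ₑ) ^ k / ‖y‖ₑ ^ (n + (k - 2)))
  have hS : ∫⁻ y, S y ≠ ∞ := by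
    rw [lintegral_add_left (by fun_prop), lintegral_const_mul' _ _ (by finiteness),
      lintegral_const_mul' _ _ (by finiteness), ← gagliardoIntegral_eq (by omega) _ hgm,
      ← besovSeminorm_pow_eq hk3]
    have h1 := (lintegral_const_mul_min_lt_top hk3 hn hB').ne
    have h2 := hB.ne
    finiteness
  have hadd : ∀ a b : ℝ≥0∞, (a + b) ^ k ≤ 2 ^ k * a ^ k + 2 ^ k * b ^ k := by
    intro a b
    rw [← mul_pow, ← mul_pow]
    rcases le_total a b with hab | hab
    · exact (pow_le_pow_left' ((by gcongr : a + b ≤ b + b).trans_eq (two_mul b).symm) k).trans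
        le_add_self
    · exact (pow_le_pow_left' ((by gcongr : a + b ≤ a + a).trans_eq (two_mul a).symm) k).trans
        le_self_add
  have key := tendsto_lintegral_of_dominated_convergence (μ := volume) S
    (F := fun j y => translationModulus k (gradient (smoothTruncation (ht j) hu) - g) y ^ k /
      ‖y‖ₑ ^ (n + (k - 2))) (f := fun _ => 0)
    (fun j => ((measurable_translationModulus (by omega) (hm j)).pow_const k).div (by fun_prop))
    (fun j => Filter.Eventually.of_forall fun y => ?_) hS
    (Filter.Eventually.of_forall fun y => ?_)
  · simpa using key
  · change translationModulus k (gradient (smoothTruncation (ht j) hu) - g) y ^ k /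
      ‖y‖ₑ ^ (n + (k - 2)) ≤ S y
    simp only [S]
    rw [← mul_div_assoc, ← mul_div_assoc, ← ENNReal.add_div]
    gcongr
    refine (pow_le_pow_left' (hω (t j) (ht j) (ht1 j) y) k).trans ((hadd _ _).trans_eq ?_)
    rw [mul_pow 2, ← mul_assoc, ← mul_pow]
    norm_num
  -- at `y = 0` the integrand is `0 / 0 = 0`
  · rcases eq_or_ne y 0 with rfl | hy
    · simp [translationModulus, show k ≠ 0 by omega]
    · have h1 := tendsto_eLpNorm_gradient_smoothTruncation_sub hk hum hgm huL hgL hu hg h ht ht1 ht0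
      have h2 : Filter.Tendsto (fun j =>
          translationModulus k (gradient (smoothTruncation (ht j) hu) - g) y)
          Filter.atTop (nhds 0) := by
        have h3 := ENNReal.Tendsto.const_mul (a := 2) h1 (Or.inr (by simp))
        rw [mul_zero] at h3
        exact tendsto_of_tendsto_of_tendsto_of_le_of_le tendsto_const_nhds h3 (fun _ => zero_le)
          fun j => translationModulus_le_two_mul (by omega) (hm j) y
      have h4 := ENNReal.Tendsto.div_const (ENNReal.Tendsto.pow (n := k) h2)
        (b := ‖y‖ₑ ^ (n + (k - 2))) (Or.inr (by simp [hy]))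
      simpa [show k ≠ 0 by omega] using h4

variable [Fact (1 ≤ (k : ℝ≥0))]

/-- `C_c²(ℝⁿ)` is dense in `B(2 - 2/k, k)`. -/
theorem denseRange_toBesov (hk : 2 ≤ k) (hkn : k ≤ n) : DenseRange (toBesov hk hkn) := by
  intro U
  have huL : MemLp U.val k volume := Lp.memLp U.val
  have hgL : MemLp U.grad k volume := Lp.memLp U.grad
  have hum := Lp.stronglyMeasurable U.val
  have hgm := Lp.stronglyMeasurable U.grad
  have hu := locallyIntegrable_coe U.val
  have hg := locallyIntegrable_coe U.grad
  let t : ℕ → ℝ := fun j => 1 / ((j : ℝ) + 1)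
  have ht : ∀ j, 0 < t j := fun j => Nat.one_div_pos_of_nat
  have ht1 : ∀ j, t j ≤ 1 := fun j => by
    simp only [t]
    rw [div_le_one (by positivity)]
    linarith [(Nat.cast_nonneg j : (0 : ℝ) ≤ j)]
  have ht0 : Filter.Tendsto t Filter.atTop (nhds 0) := tendsto_one_div_add_atTop_nhds_zero_nat
  refine mem_closure_of_tendsto (f := fun j => toBesov hk hkn (smoothTruncation (ht j) hu))
    (b := Filter.atTop) ?_ (Filter.Eventually.of_forall fun j => Set.mem_range_self _)
  rw [tendsto_iff_norm_sub_tendsto_zero]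
  have hnorm : ∀ j, ‖toBesov hk hkn (smoothTruncation (ht j) hu) - U‖ =
      (eLpNorm (fun x => cutoff (t j) x • mollify (t j) U.val x - U.val x) k volume).toReal +
      (eLpNorm (gradient (smoothTruncation (ht j) hu) - ⇑U.grad) k volume).toReal +
      (besovSeminorm (2 - 2 / (k : ℝ)) (k : ℝ≥0)
        (gradient (smoothTruncation (ht j) hu) - ⇑U.grad)).toReal := by
    intro j
    set f := smoothTruncation (ht j) hu
    have h1 : (toBesov hk hkn f - U).val =ᵐ[volume] ⇑f - ⇑U.val :=
      (Lp.coeFn_sub (toBesov hk hkn f).val U.val).trans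
        ((toBesov_represents hk hkn f).sub Filter.EventuallyEq.rfl)
    have h2 : (toBesov hk hkn f - U).grad =ᵐ[volume] gradient f - ⇑U.grad :=
      (Lp.coeFn_sub (toBesov hk hkn f).grad U.grad).trans
        ((toBesov_grad_ae hk hkn f).sub Filter.EventuallyEq.rfl)
    rw [BesovSpace.norm_def, besovSeminorm_congr h2, Lp.norm_def, Lp.norm_def,
      eLpNorm_congr_ae h1, eLpNorm_congr_ae h2]
    rfl
  simp_rw [hnorm]
  have l1 := (ENNReal.tendsto_toReal ENNReal.zero_ne_top).comp
    (tendsto_eLpNorm_cutoff_smul_mollify_sub hk hum huL ht ht0)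
  have l2 := (ENNReal.tendsto_toReal ENNReal.zero_ne_top).comp
    (tendsto_eLpNorm_gradient_smoothTruncation_sub hk hum hgm huL hgL hu hg U.hasWeakGradient
      ht ht1 ht0)
  have l3 := (ENNReal.tendsto_toReal ENNReal.zero_ne_top).comp
    (tendsto_besovSeminorm_gradient_smoothTruncation_sub hk (by omega) hum hgm huL hgL hu hg
      U.hasWeakGradient U.besovSeminorm_lt_top ht ht1 ht0)
  simpa using (l1.add l2).add l3

end Density

/-! ### The extension of the `k`-Hessian -/

section Extension

variable {n k : ℕ}

theorem integrable_kHessian_mul (f φ : CcSpace n 2) :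
    Integrable fun x => kHessian k f x * φ x := by
  refine ((integrable_mixedHessian_mul (fun _ : Fin k => f) φ).const_mul
    (k.factorial : ℝ)⁻¹).congr (Filter.Eventually.of_forall fun x => ?_)
  have h : (k.factorial : ℝ) ≠ 0 := by positivity
  simp only [mixedHessian_diag f.contDiff_two]
  field_simp

theorem exists_continuous_norm_le (n : ℕ) (F : Type*) [NormedAddCommGroup F] [NormedSpace ℝ F] :
    ∃ S : 𝓓^{0}((⊤ : Opens (EuclideanSpace ℝ (Fin n))), F) → ℝ, Continuous S ∧ S 0 = 0 ∧
      ∀ f x, ‖f x‖ ≤ S f := by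
  refine ⟨fun f => ‖TestFunction.toBoundedContinuousFunctionCLM ℝ f‖,
    (ContinuousLinearMap.continuous _).norm, ?_, fun f x => ?_⟩
  · change ‖TestFunction.toBoundedContinuousFunctionCLM ℝ 0‖ = 0
    rw [map_zero, norm_zero]
  exact (TestFunction.toBoundedContinuousFunctionCLM ℝ f).norm_coe_le_norm x

/-- The sup norm of the Hessian is dominated by a continuous function on `C_c²` which vanishes at
zero. -/
theorem exists_hessianSupNorm_le (n : ℕ) :
    ∃ S : CcSpace n 2 → ℝ, Continuous S ∧ S 0 = 0 ∧ ∀ φ : CcSpace n 2, hessianSupNorm φ ≤ S φ := by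
  obtain ⟨S, hS, hS0, hS1⟩ := exists_continuous_norm_le n
    (EuclideanSpace ℝ (Fin n) →L[ℝ] EuclideanSpace ℝ (Fin n) →L[ℝ] ℝ)
  refine ⟨fun φ => S (TestFunction.fderivCLM ℝ 1 0 (TestFunction.fderivCLM ℝ 2 1 φ)),
    hS.comp ((ContinuousLinearMap.continuous _).comp (ContinuousLinearMap.continuous _)),
    by simp only [map_zero, hS0], fun φ => ?_⟩
  have h2 : ⇑(TestFunction.fderivCLM ℝ 2 1 φ) = fderiv ℝ φ :=
    TestFunction.fderivCLM_apply_of_le φ (by norm_num)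
  have h3 : ⇑(TestFunction.fderivCLM ℝ 1 0 (TestFunction.fderivCLM ℝ 2 1 φ)) =
      fderiv ℝ (TestFunction.fderivCLM ℝ 2 1 φ) :=
    TestFunction.fderivCLM_apply_of_le _ (by norm_num)
  have h4 : ∀ x, ‖iteratedFDeriv ℝ 2 φ x‖ ≤
      S (TestFunction.fderivCLM ℝ 1 0 (TestFunction.fderivCLM ℝ 2 1 φ)) := by
    intro x
    rw [← norm_iteratedFDeriv_fderiv, norm_iteratedFDeriv_one, ← h2, ← h3]
    exact hS1 _ x
  rw [hessianSupNorm, eLpNorm_exponent_top]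
  refine (ENNReal.toReal_mono ENNReal.ofReal_ne_top
    (eLpNormEssSup_le_of_ae_bound (Filter.Eventually.of_forall h4))).trans_eq ?_
  exact ENNReal.toReal_ofReal ((norm_nonneg _).trans (h4 0))

variable [Fact (1 ≤ (k : ℝ≥0))]

theorem toBesov_zero (hk : 2 ≤ k) (hkn : k ≤ n) : toBesov hk hkn (0 : CcSpace n 2) = 0 := by
  have h := toBesov_sub hk hkn (0 : CcSpace n 2) 0
  rwa [sub_self, sub_self] at h

/-- The `k`-Hessian is Lipschitz on bounded sets of `C_c²` functions in the Besov norm. -/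
theorem exists_abs_integral_kHessian_sub_le (hk : 2 ≤ k) (hkn : k ≤ n) :
    ∃ C : ℝ, 0 ≤ C ∧ ∀ f g φ : CcSpace n 2,
      |(∫ x, kHessian k f x * φ x) - ∫ x, kHessian k g x * φ x| ≤
        C * ‖toBesov hk hkn f - toBesov hk hkn g‖ *
          (‖toBesov hk hkn f‖ ^ (k - 1) + ‖toBesov hk hkn g‖ ^ (k - 1)) * hessianSupNorm φ := by
  obtain ⟨C, hC, h⟩ := exists_abs_hessianForm_le hk hkn
  refine ⟨k * C, by positivity, fun f g φ => ?_⟩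
  have hφ := hessianSupNorm_nonneg φ
  set a := ‖toBesov hk hkn f‖
  set b := ‖toBesov hk hkn g‖
  have ha : 0 ≤ a := norm_nonneg _
  have hb : 0 ≤ b := norm_nonneg _
  have h1 : |hessianForm k φ (fun _ => f) - hessianForm k φ (fun _ => g)| ≤
      k * (C * (‖toBesov hk hkn f - toBesov hk hkn g‖ * (a ^ (k - 1) + b ^ (k - 1))) *
        hessianSupNorm φ) := by
    have h2 := (hessianForm k φ).enorm_sub_le_of_forall (fun _ => f) (fun _ => g)
      (ENNReal.ofReal (C * (‖toBesov hk hkn f - toBesov hk hkn g‖ * (a ^ (k - 1) + b ^ (k - 1))) *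
        hessianSupNorm φ)) fun i q hqi hq => ?_
    · rw [← ofReal_norm, ← ENNReal.ofReal_natCast, ← ENNReal.ofReal_mul (by positivity)] at h2
      exact (ENNReal.ofReal_le_ofReal_iff (by positivity)).1 h2
    · rw [← ofReal_norm]
      refine ENNReal.ofReal_le_ofReal ((h φ q).trans ?_)
      gcongr
      rw [← Finset.mul_prod_erase Finset.univ _ (Finset.mem_univ i), hqi, toBesov_sub]
      gcongr
      have h3 : ∏ m ∈ Finset.univ.erase i, ‖toBesov hk hkn (q m)‖ ≤ max a b ^ (k - 1) := by
        refine (Finset.prod_le_prod (fun _ _ => norm_nonneg _) (g := fun _ => max a b)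
          fun m hm => ?_).trans_eq ?_
        · rcases hq m (Finset.ne_of_mem_erase hm) with h4 | h4 <;> rw [h4]
          · exact le_max_left _ _
          · exact le_max_right _ _
        · rw [Finset.prod_const, Finset.card_erase_of_mem (Finset.mem_univ i), Finset.card_univ,
            Fintype.card_fin]
      refine h3.trans ?_
      rcases le_total a b with hab | hab
      · rw [max_eq_right hab]
        exact le_add_of_nonneg_left (by positivity)
      · rw [max_eq_left hab]
        exact le_add_of_nonneg_right (by positivity)
  rw [hessianForm_diag, hessianForm_diag, ← mul_sub, abs_mul, Nat.abs_cast] at h1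
  refine (le_mul_of_one_le_left (abs_nonneg _) ?_).trans (h1.trans_eq (by ring))
  exact_mod_cast Nat.one_le_iff_ne_zero.2 k.factorial_ne_zero

theorem exists_seq_tendsto_toBesov (hk : 2 ≤ k) (hkn : k ≤ n)
    (u : BesovSpace n (2 - 2 / (k : ℝ)) k) : ∃ a : ℕ → CcSpace n 2,
      Filter.Tendsto (fun j => toBesov hk hkn (a j)) Filter.atTop (nhds u) := by
  obtain ⟨a, ha, hau⟩ := mem_closure_iff_seq_limit.1 (denseRange_toBesov hk hkn u)
  choose b hb using ha
  exact ⟨b, by simpa only [hb] using hau⟩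

/-- The limits of `∫ F_k[a_j] φ` along all sequences in `C_c²` converging in `B(2 - 2/k, k)` exist
and depend on the limit of the sequence only. -/
theorem exists_tendsto_integral_kHessian (hk : 2 ≤ k) (hkn : k ≤ n)
    (u : BesovSpace n (2 - 2 / (k : ℝ)) k) (φ : CcSpace n 2) :
    ∃ l : ℝ, ∀ a : ℕ → CcSpace n 2,
      Filter.Tendsto (fun j => toBesov hk hkn (a j)) Filter.atTop (nhds u) →
      Filter.Tendsto (fun j => ∫ x, kHessian k (a j) x * φ x) Filter.atTop (nhds l) := by
  obtain ⟨C, hC, h⟩ := exists_abs_integral_kHessian_sub_le hk hkn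
  -- the differences along two sequences tend to zero jointly
  have key : ∀ (a b : ℕ → CcSpace n 2),
      Filter.Tendsto (fun j => toBesov hk hkn (a j)) Filter.atTop (nhds u) →
      Filter.Tendsto (fun j => toBesov hk hkn (b j)) Filter.atTop (nhds u) →
      Filter.Tendsto (fun p : ℕ × ℕ => (∫ x, kHessian k (a p.1) x * φ x) -
        ∫ x, kHessian k (b p.2) x * φ x) Filter.atTop (nhds 0) := by
    intro a b ha hb
    rw [← Filter.prod_atTop_atTop_eq]
    have ha' := ha.comp (Filter.tendsto_fst (f := Filter.atTop) (g := (Filter.atTop : Filter ℕ)))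
    have hb' := hb.comp (Filter.tendsto_snd (f := (Filter.atTop : Filter ℕ)) (g := Filter.atTop))
    have h1 := ((((ha'.sub hb').norm.const_mul C).mul
      ((ha'.norm.pow (k - 1)).add (hb'.norm.pow (k - 1)))).mul_const (hessianSupNorm φ))
    rw [sub_self, norm_zero, mul_zero, zero_mul, zero_mul] at h1
    exact squeeze_zero_norm (fun p => h _ _ φ) h1
  obtain ⟨b, hbu⟩ := exists_seq_tendsto_toBesov hk hkn u
  have hcauchy : CauchySeq fun j => ∫ x, kHessian k (b j) x * φ x := by
    rw [Metric.cauchySeq_iff]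
    intro ε hε
    obtain ⟨⟨N, N'⟩, hN⟩ := Metric.tendsto_atTop.1 (key b b hbu hbu) ε hε
    refine ⟨max N N', fun i hi j hj => ?_⟩
    have := hN (i, j) ⟨(le_max_left _ _).trans hi, (le_max_right _ _).trans hj⟩
    rwa [dist_zero_right, ← dist_eq_norm] at this
  obtain ⟨l, hl⟩ := cauchySeq_tendsto_of_complete hcauchy
  refine ⟨l, fun a ha => ?_⟩
  have h2 := (key a b ha hbu).comp (Filter.tendsto_atTop_diagonal (α := ℕ))
  have h3 := h2.add hl
  rw [zero_add] at h3
  exact h3.congr fun j => by simp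

/-- The continuous extension of the `k`-Hessian, as a distribution of order at most two. -/
theorem exists_kHessian_extension (hk : 2 ≤ k) (hkn : k ≤ n) :
    ∃ 𝓕 : BesovSpace n (2 - 2 / (k : ℝ)) k → DistSpace n 2,
      ∀ u (a : ℕ → CcSpace n 2),
        Filter.Tendsto (fun j => toBesov hk hkn (a j)) Filter.atTop (nhds u) →
        ∀ φ, Filter.Tendsto (fun j => ∫ x, kHessian k (a j) x * φ x) Filter.atTop
          (nhds (𝓕 u φ)) := by
  choose P hP using exists_tendsto_integral_kHessian hk hkn
  obtain ⟨C, hC, h⟩ := exists_abs_integral_kHessian_sub_le hk hkn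
  obtain ⟨S, hS, hS0, hφS⟩ := exists_hessianSupNorm_le n
  let P' : ∀ u, CcSpace n 2 →ₗ[ℝ] ℝ := fun u =>
    { toFun := P u
      map_add' := fun φ ψ => by
        obtain ⟨a, ha⟩ := exists_seq_tendsto_toBesov hk hkn u
        refine tendsto_nhds_unique (hP u (φ + ψ) a ha)
          (((hP u φ a ha).add (hP u ψ a ha)).congr fun j => ?_)
        rw [← integral_add (integrable_kHessian_mul _ _) (integrable_kHessian_mul _ _)]
        simp_rw [← mul_add]
        rfl
      map_smul' := fun c φ => by
        obtain ⟨a, ha⟩ := exists_seq_tendsto_toBesov hk hkn u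
        refine tendsto_nhds_unique (hP u (c • φ) a ha)
          (((hP u φ a ha).const_mul c).congr fun j => ?_)
        rw [← integral_const_mul]
        congr 1
        ext x
        rw [smul_apply, smul_eq_mul]
        ring }
  have hbound : ∀ u φ, |P' u φ| ≤ C * ‖u‖ * ‖u‖ ^ (k - 1) * S φ := by
    intro u φ
    obtain ⟨a, ha⟩ := exists_seq_tendsto_toBesov hk hkn u
    have h0 : ∫ x, kHessian k (0 : CcSpace n 2) x * φ x = 0 := by
      have h1 := hessianForm_diag (k := k) φ (0 : CcSpace n 2)
      rw [(hessianForm k φ).map_coord_zero (⟨0, by omega⟩ : Fin k) rfl] at h1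
      exact (mul_eq_zero.1 h1.symm).resolve_left (by positivity)
    refine le_of_tendsto_of_tendsto (hP u φ a ha).abs
      (((ha.norm.const_mul C).mul (ha.norm.pow (k - 1))).mul_const (S φ))
      (Filter.Eventually.of_forall fun j => ?_)
    have h1 := h (a j) 0 φ
    rw [h0, sub_zero, toBesov_zero, sub_zero, norm_zero, zero_pow (by omega), add_zero] at h1
    exact h1.trans (mul_le_mul_of_nonneg_left (hφS φ) (by positivity))
  refine ⟨fun u => ⟨P' u, ?_⟩, fun u a ha φ => hP u φ a ha⟩
  refine continuous_of_continuousAt_zero (P' u) ?_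
  rw [ContinuousAt, map_zero]
  have h1 := (hS.const_mul (C * ‖u‖ * ‖u‖ ^ (k - 1))).tendsto 0
  rw [hS0, mul_zero] at h1
  exact squeeze_zero_norm (hbound u) h1

end Extension

section Continuity

variable {n k : ℕ} [Fact (1 ≤ (k : ℝ≥0))]

/-- A map into the distributions of order at most two which is Lipschitz on bounded sets, with
respect to the sup norm of the Hessian of the test functions, is continuous: this sup norm is
bounded on compact sets of test functions. -/
theorem continuous_of_abs_sub_apply_le {B : Type*} [NormedAddCommGroup B] {𝓕 : B → DistSpace n 2}
    {C : ℝ} {l : ℕ} (h : ∀ u₁ u₂ φ, |(𝓕 u₁ - 𝓕 u₂) φ| ≤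
      C * ‖u₁ - u₂‖ * (‖u₁‖ ^ l + ‖u₂‖ ^ l) * hessianSupNorm φ) : Continuous 𝓕 := by
  obtain ⟨S, hS, -, hφS⟩ := exists_hessianSupNorm_le n
  rw [continuous_iff_continuousAt]
  intro u
  rw [ContinuousAt, UniformConvergenceCLM.tendsto_iff_tendstoUniformlyOn]
  intro K hK
  obtain ⟨M, hM⟩ := hK.exists_bound_of_continuousOn hS.continuousOn
  rw [Metric.tendstoUniformlyOn_iff]
  intro ε hε
  have h1 : Filter.Tendsto (fun v => |C| * ‖v - u‖ * (‖v‖ ^ l + ‖u‖ ^ l) * |M|) (nhds u) (nhds 0) := by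
    have h2 : Continuous fun v : B => |C| * ‖v - u‖ * (‖v‖ ^ l + ‖u‖ ^ l) * |M| := by fun_prop
    simpa using h2.tendsto u
  filter_upwards [h1.eventually (gt_mem_nhds hε)] with v hv φ hφ
  rw [dist_comm, Real.dist_eq]
  refine lt_of_le_of_lt ((h v u φ).trans ?_) hv
  have h3 : hessianSupNorm φ ≤ |M| := (hφS φ).trans ((le_abs_self _).trans ((hM φ hφ).trans (le_abs_self M)))
  have h4 := hessianSupNorm_nonneg φ
  gcongr
  exact le_abs_self C

end Continuity

theorem theorem1p1 (n k : ℕ) (hk : 2 ≤ k) (hkn : k ≤ n) [Fact (1 ≤ (k : ℝ≥0))] :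
    -- every function in `C_c²(ℝⁿ)` belongs to `B(2 - 2/k, k)`
    (∀ u : CcSpace n 2, ∃ v : BesovSpace n (2 - 2 / (k : ℝ)) k, v.Represents u) ∧
    -- the `k`-Hessian has a continuous extension `𝓕 : B(2 - 2/k, k) → 𝓓'(ℝⁿ)`
    ∃ 𝓕 : BesovSpace n (2 - 2 / (k : ℝ)) k → DistSpace n ⊤,
      Continuous 𝓕 ∧ ExtendsKHessian k 𝓕 ∧
      -- which is the only one, even among the weakly continuous maps
      (∀ 𝓖 : BesovSpace n (2 - 2 / (k : ℝ)) k → DistSpace n ⊤,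
        (∀ φ : CcSpace n ⊤, Continuous fun u => 𝓖 u φ) → ExtendsKHessian k 𝓖 → 𝓖 = 𝓕) ∧
      -- each `𝓕 u` extends to a distribution of order at most two, which gives the pairing with
      -- functions in `C_c²(ℝⁿ)`, and the estimates hold with one constant
      ∃ (𝓕₂ : BesovSpace n (2 - 2 / (k : ℝ)) k → DistSpace n 2) (C : ℝ),
        (∀ (u : BesovSpace n (2 - 2 / (k : ℝ)) k) (φ : CcSpace n ⊤) (ψ : CcSpace n 2),
          (∀ x, ψ x = φ x) → 𝓕₂ u ψ = 𝓕 u φ) ∧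
        ExtendsKHessian k 𝓕₂ ∧
        (∀ (u₁ u₂ : BesovSpace n (2 - 2 / (k : ℝ)) k) (φ : CcSpace n 2),
          |(𝓕₂ u₁ - 𝓕₂ u₂) φ| ≤
            C * ‖u₁ - u₂‖ * (‖u₁‖ ^ (k - 1) + ‖u₂‖ ^ (k - 1)) * hessianSupNorm φ) ∧
        (∀ (u₁ u₂ φ : CcSpace n 2) (v₁ v₂ : BesovSpace n (2 - 2 / (k : ℝ)) k),
          v₁.Represents u₁ → v₂.Represents u₂ →
          |∫ x, (kHessian k u₁ x - kHessian k u₂ x) * φ x| ≤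
            C * ‖v₁ - v₂‖ * (‖v₁‖ ^ (k - 1) + ‖v₂‖ ^ (k - 1)) * hessianSupNorm φ) := by
  obtain ⟨𝓕₂, h𝓕₂⟩ := exists_kHessian_extension hk hkn
  obtain ⟨C, -, hC⟩ := exists_abs_integral_kHessian_sub_le hk hkn
  have hext : ExtendsKHessian k 𝓕₂ := by
    intro u v huv φ
    have h1 : v = toBesov hk hkn u := huv.eq (toBesov_represents hk hkn u)
    subst h1
    exact tendsto_nhds_unique (h𝓕₂ _ (fun _ => u) tendsto_const_nhds φ) tendsto_const_nhds
  have hest : ∀ (u₁ u₂ : BesovSpace n (2 - 2 / (k : ℝ)) k) (φ : CcSpace n 2),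
      |(𝓕₂ u₁ - 𝓕₂ u₂) φ| ≤
        C * ‖u₁ - u₂‖ * (‖u₁‖ ^ (k - 1) + ‖u₂‖ ^ (k - 1)) * hessianSupNorm φ := by
    intro u₁ u₂ φ
    obtain ⟨a, ha⟩ := exists_seq_tendsto_toBesov hk hkn u₁
    obtain ⟨b, hb⟩ := exists_seq_tendsto_toBesov hk hkn u₂
    exact le_of_tendsto_of_tendsto ((h𝓕₂ u₁ a ha φ).sub (h𝓕₂ u₂ b hb φ)).abs
      ((((ha.sub hb).norm.const_mul C).mul
        ((ha.norm.pow (k - 1)).add (hb.norm.pow (k - 1)))).mul_const (hessianSupNorm φ))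
      (Filter.Eventually.of_forall fun j => hC (a j) (b j) φ)
  -- the inclusion of `C_c^∞` in `C_c²`, along which the distributions are restricted
  let ι : CcSpace n ⊤ →L[ℝ] CcSpace n 2 := TestFunction.monoCLM ℝ
  have hι : ∀ φ : CcSpace n ⊤, ⇑(ι φ) = φ := fun φ => by
    rw [TestFunction.monoCLM_apply, if_pos ⟨le_top, le_rfl⟩]
  have hcont : Continuous fun u => ι.precompCompactConvergenceCLM ℝ (𝓕₂ u) :=
    (ι.precompCompactConvergenceCLM ℝ).continuous.comp (continuous_of_abs_sub_apply_le hest)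
  have hext' : ExtendsKHessian k fun u => ι.precompCompactConvergenceCLM ℝ (𝓕₂ u) := by
    intro u v huv φ
    have h1 := hext u v huv (ι φ)
    rw [hι] at h1
    exact h1
  refine ⟨fun u => ⟨toBesov hk hkn u, toBesov_represents hk hkn u⟩, _, hcont, hext',
    fun 𝓖 h𝓖 h𝓖' => ?_, 𝓕₂, C, fun u φ ψ h => ?_, hext, hest, fun u₁ u₂ φ v₁ v₂ h₁ h₂ => ?_⟩
  · ext u φ
    refine congrFun ((denseRange_toBesov hk hkn).equalizer (h𝓖 φ)
      ((continuous_eval_const φ).comp hcont) (funext fun f => ?_)) u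
    exact (h𝓖' f _ (toBesov_represents hk hkn f) φ).trans
      (hext' f _ (toBesov_represents hk hkn f) φ).symm
  · have h1 : ψ = ι φ := DFunLike.coe_injective ((funext h).trans (hι φ).symm)
    rw [h1]
    rfl
  · rw [h₁.eq (toBesov_represents hk hkn u₁), h₂.eq (toBesov_represents hk hkn u₂)]
    simp_rw [sub_mul]
    rw [integral_sub (integrable_kHessian_mul _ _) (integrable_kHessian_mul _ _)]
    exact hC u₁ u₂ φ
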